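/- A \emph{gate} on $n$ bits is a permutation of $\{0,1\}^n=\mathbb F_2^n$. For a set $S$ of gates (on possibly different numbers of bits), let $\langle S\rangle$ be the smallest set of gates that contains $S$ and the identity on every number of bits and is closed under: composition of gates on the same number of bits; permuting the input and output bits; extension, $G(x,b)=(F(x),b)$ for one extra bit $b$; and the ancilla rule (if $F\in\langle S\rangle$ and, for some fixed string $a$, $F(x,a)=(G(x),a)$ for all $x$, then $G\in\langle S\rangle$). Let $\#\langle S\rangle_n$ be the number of $n$-bit gates in $\langle S\rangle$. With $\bar x$ the bitwise complement of $x$ and $|x|$ its Hamming weight, let $\mathrm{NOT}(x)=\bar x$; $\mathrm{NOTNOT}(xy)=\bar x\bar y$; $\mathrm{CNOT}(x,y)=(x,y\oplus x)$; $\mathrm{CNOTNOT}(x,y,z)=(x,y\oplus x,z\oplus x)$; $\mathrm{Toffoli}(x,y,z)=(x,y,z\oplus xy)$; let $\mathrm{Fredkin}(x,y,z)$ swap $y$ and $z$ if $x=1$ and do nothing if $x=0$; let $\mathrm C_k$ be the $k$-bit gate exchanging $0^k$ and $1^k$ and fixing all other strings; for even $k$, let $\mathrm T_k$ be the $k$-bit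 gate mapping $x$ to $\bar x$ if $|x|$ is odd and fixing $x$ otherwise, and $\mathrm F_k$ the $k$-bit gate mapping $x$ to $\bar x$ if $|x|$ is even and fixing $x$ otherwise. A gate $G$ is \emph{affine} if $G(x)=Ax\oplus b$ for an invertible matrix $A$ over $\mathbb F_2$ and a vector $b$, and \emph{linear} if moreover $b=0$; it is \emph{parity-respecting} if there is a $j$ with $|G(x)|\equiv|x|+j\pmod 2$ for all $x$, and \emph{parity-preserving} if this holds with $j=0$. Call $\langle S\rangle$ a \emph{linear class} if every gate in $\langle S\rangle$ is linear. \textbf{Theorem.} Let $n\ge1$ be an integer. (1) The total number of $n$-bit gates is $\#\langle\mathrm{Toffoli}\rangle_n=(2^n)!$, and, for every $k\ge3$, $$\#\langle\mathrm{Fredkin},\mathrm{NOT}\rangle_n=2\bigl((2^{n-1})!\bigr)^2,\qquad \#\langle\mathrm{Fredkin},\mathrm{NOTNOT}\rangle_n=\bigl((2^{n-1})!\bigr)^2,$$ $$\#\langle\mathrm C_k\rangle_n=\prod_{i=0}^{k-1}\Bigl(\sum_{0\le j\le n,\ j\equiv i\ (\mathrm{mod}\ k)}\binom nj\Bigr)!,\qquad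 \#\langle\mathrm{Fredkin}\rangle_n=\prod_{i=0}^n\binom ni!.$$ (2) The total number of affine $n$-bit gates is $$\#\langle\mathrm{CNOT}\rangle_n=2^{n(n+1)/2}\prod_{i=1}^n(2^i-1).$$ (3) The numbers of parity-preserving affine and of parity-respecting affine $n$-bit gates are, respectively, $$\#\langle\mathrm{CNOTNOT}\rangle_n=2^{n(n+1)/2-1}\prod_{i=1}^{n-1}(2^i-1),\qquad \#\langle\mathrm{CNOTNOT},\mathrm{NOT}\rangle_n=2^{n(n+1)/2}\prod_{i=1}^{n-1}(2^i-1).$$ (4) $\#\langle\varnothing\rangle_n=n!$, $$\#\langle\mathrm T_4\rangle_n=\begin{cases}2^{m^2}\prod_{i=1}^{m-1}(2^{2i}-1),&n=2m,\\ 2^{m^2}\prod_{i=1}^{m}(2^{2i}-1),&n=2m+1,\end{cases}$$ $$\#\langle\mathrm T_6\rangle_n=\begin{cases}1,&n=1,\\ 2^{4m^2+1}\prod_{i=1}^{2m}(2^{2i}-1),&n=4m+2,\\ 2^{4m^2+2m+1}\bigl(2^{2m+1}+(-1)^m\bigr)\prod_{i=1}^{2m}(2^{2i}-1),&n=4m+3,\\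 2^{4m^2-2m+1}\bigl(2^{2m-1}-(-1)^m\bigr)\prod_{i=1}^{2m-2}(2^{2i}-1),&n=4m\ge4,\\ 2^{4m^2-2m+1}\bigl(2^{2m}-(-1)^m\bigr)\prod_{i=1}^{2m-1}(2^{2i}-1),&n=4m+1\ge5,\end{cases}$$ where $m\ge0$ is an integer, and $\#\langle\mathrm F_4\rangle_n=\#\langle\mathrm T_4\rangle_n$. (5) For every set $S$ of gates such that $\langle S\rangle$ is a linear class, $$\#\langle S\cup\{\mathrm{NOT}\}\rangle_n=\#\langle S\rangle_n\cdot2^n,\qquad \#\langle S\cup\{\mathrm{NOTNOT}\}\rangle_n=\#\langle S\rangle_n\cdot2^{n-1}.$$ -/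

import Mathlib

open scoped Nat

namespace RevGate

/-- Bit strings of length `n`, as vectors over the field with two elements. -/
abbrev Bits (n : ℕ) : Type := Fin n → ZMod 2

/-- A reversible gate on `n` bits: a permutation of the set of `n`-bit strings. -/
abbrev Gate (n : ℕ) : Type := Equiv.Perm (Bits n)

/-- Gates on an arbitrary number of bits. -/
abbrev AnyGate : Type := Σ n : ℕ, Gate n

/-- `Generates S G` says that `G` belongs to the smallest family of reversible transformations that
contains `S` and the identities and is closed under composition, permutation of the input and
output bits, adding a dummy bit, and using ancilla bits that are returned to their initial
values. -/
inductive Generates (S : Set AnyGate) : ∀ {n : ℕ}, Gate n → Prop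
  | base {n : ℕ} {G : Gate n} (h : (⟨n, G⟩ : AnyGate) ∈ S) : Generates S G
  | ident (n : ℕ) : Generates S (1 : Gate n)
  | comp {n : ℕ} {F G : Gate n} (hF : Generates S F) (hG : Generates S G) : Generates S (F * G)
  | swapping {n : ℕ} {F G : Gate n} (hF : Generates S F) (σ τ : Equiv.Perm (Fin n))
      (h : ∀ x : Bits n, G x = fun i => F (fun j => x (τ j)) (σ i)) : Generates S G
  | extension {n : ℕ} {F : Gate n} {G : Gate (n + 1)} (hF : Generates S F)
      (h : ∀ (x : Bits n) (b : ZMod 2),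
        G (Fin.snoc x b : Bits (n + 1)) = (Fin.snoc (F x) b : Bits (n + 1))) : Generates S G
  | ancilla {n k : ℕ} {F : Gate (n + k)} {G : Gate n} (a : Bits k) (hF : Generates S F)
      (h : ∀ x : Bits n, F (Fin.append x a) = Fin.append (G x) a) : Generates S G

/-- The set of `n`-bit gates generated by `S`. -/
def gateClass (S : Set AnyGate) (n : ℕ) : Set (Gate n) := {G | Generates S G}

/-- The number of `n`-bit gates generated by `S`. -/
noncomputable def count (S : Set AnyGate) (n : ℕ) : ℕ := (gateClass S n).ncard

/-- `x ↦ x̄` on one bit. -/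
def notGate : Gate 1 := Equiv.addRight 1

/-- `xy ↦ x̄ȳ` on two bits. -/
def notnotGate : Gate 2 := Equiv.addRight 1

/-- In characteristic two, adding the same bit twice does nothing. -/
lemma add_add_self (a b : ZMod 2) : a + b + b = a := by
  rw [add_assoc, CharTwo.add_self_eq_zero, add_zero]

/-- `x, y ↦ x, y ⊕ x`. -/
def cnotGate : Gate 2 :=
  Function.Involutive.toPerm (fun x : Bits 2 => (![x 0, x 1 + x 0] : Bits 2)) (by
    intro x; ext i; fin_cases i <;> simp [add_add_self])

/-- `x, y, z ↦ x, y ⊕ x, z ⊕ x`. -/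
def cnotnotGate : Gate 3 :=
  Function.Involutive.toPerm (fun x : Bits 3 => (![x 0, x 1 + x 0, x 2 + x 0] : Bits 3)) (by
    intro x; ext i; fin_cases i <;> simp [add_add_self])

/-- `x, y, z ↦ x, y, z ⊕ xy`. -/
def toffoliGate : Gate 3 :=
  Function.Involutive.toPerm (fun x : Bits 3 => (![x 0, x 1, x 2 + x 0 * x 1] : Bits 3)) (by
    intro x; ext i; fin_cases i <;> simp [add_add_self])

/-- `x, y, z ↦ x, y ⊕ x(y ⊕ z), z ⊕ x(y ⊕ z)`: swap `y` and `z` if `x = 1`. -/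
def fredkinGate : Gate 3 :=
  Function.Involutive.toPerm
    (fun x : Bits 3 => (![x 0, x 1 + x 0 * (x 1 + x 2), x 2 + x 0 * (x 1 + x 2)] : Bits 3)) (by
    have key : ∀ a b c : ZMod 2,
        b + a * (b + c) + a * (b + a * (b + c) + (c + a * (b + c))) = b ∧
        c + a * (b + c) + a * (b + a * (b + c) + (c + a * (b + c))) = c := by decide
    intro x; ext i
    fin_cases i
    · rfl
    · exact (key (x 0) (x 1) (x 2)).1
    · exact (key (x 0) (x 1) (x 2)).2)

/-- `C_k` exchanges the strings `0^k` and `1^k` and fixes all other `k`-bit strings. -/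
def cGate (k : ℕ) : Gate k := Equiv.swap 0 1

/-- `T_k` (`k` even): `x_i ↦ x_i ⊕ b` with `b = x_1 ⊕ ⋯ ⊕ x_k`; that is, `x` is inverted if its
Hamming weight is odd, and fixed otherwise. -/
def tGate (k : ℕ) (hk : Even k) : Gate k :=
  Function.Involutive.toPerm (fun x : Bits k => (fun i => x i + ∑ j, x j : Bits k)) (by
    have hk0 : (k : ZMod 2) = 0 := (ZMod.natCast_eq_zero_iff_even).2 hk
    intro x; funext i
    simp [Finset.sum_add_distrib, hk0, add_add_self])

/-- `F_k` (`k` even): `x_i ↦ x_i ⊕ b ⊕ 1` with `b = x_1 ⊕ ⋯ ⊕ x_k`; that is, `x` is inverted if its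
Hamming weight is even, and fixed otherwise. -/
def fGate (k : ℕ) (hk : Even k) : Gate k :=
  Function.Involutive.toPerm (fun x : Bits k => (fun i => x i + ((∑ j, x j) + 1) : Bits k)) (by
    have hk0 : (k : ZMod 2) = 0 := (ZMod.natCast_eq_zero_iff_even).2 hk
    intro x; funext i
    simp [Finset.sum_add_distrib, hk0, add_add_self])

/-! The named gates, together with their numbers of bits. -/
def NOT : AnyGate := ⟨1, notGate⟩
def NOTNOT : AnyGate := ⟨2, notnotGate⟩
def CNOT : AnyGate := ⟨2, cnotGate⟩
def CNOTNOT : AnyGate := ⟨3, cnotnotGate⟩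
def Toffoli : AnyGate := ⟨3, toffoliGate⟩
def Fredkin : AnyGate := ⟨3, fredkinGate⟩
def C (k : ℕ) : AnyGate := ⟨k, cGate k⟩
def T4 : AnyGate := ⟨4, tGate 4 (by decide)⟩
def T6 : AnyGate := ⟨6, tGate 6 (by decide)⟩
def F4 : AnyGate := ⟨4, fGate 4 (by decide)⟩

/-- `G(x) = Ax ⊕ b` for an invertible matrix `A` and a vector `b` over the two-element field. -/
def IsAffine {n : ℕ} (G : Gate n) : Prop :=
  ∃ A : Matrix (Fin n) (Fin n) (ZMod 2), IsUnit A ∧ ∃ b : Bits n, ∀ x, G x = A.mulVec x + b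

/-- `G(x) = Ax` for an invertible matrix `A` over the two-element field. -/
def IsLinear {n : ℕ} (G : Gate n) : Prop :=
  ∃ A : Matrix (Fin n) (Fin n) (ZMod 2), IsUnit A ∧ ∀ x, G x = A.mulVec x

/-- `|G(x)| ≡ |x| (mod 2)` for all `x`, with `|x|` the Hamming weight. -/
def IsParityPreserving {n : ℕ} (G : Gate n) : Prop :=
  ∀ x : Bits n, hammingNorm (G x) ≡ hammingNorm x [MOD 2]

/-- For some `j`, `|G(x)| ≡ |x| + j (mod 2)` for all `x`. -/
def IsParityRespecting {n : ℕ} (G : Gate n) : Prop :=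
  ∃ j : ℕ, ∀ x : Bits n, hammingNorm (G x) ≡ hammingNorm x + j [MOD 2]

/-- The class generated by `S` is linear: all of its members (not only those of `S`) are linear. -/
def IsLinearClass (S : Set AnyGate) : Prop :=
  ∀ (m : ℕ) (G : Gate m), G ∈ gateClass S m → IsLinear G

end RevGate

/-! Each class is bounded above by an invariant that survives all closure rules: the Hamming weight
modulo some `k` (up to a constant shift), affinity, or preservation of the standard bilinear form.
The work is to show that the invariant describes the class exactly; counting is then elementary.

Non-affine classes. A permutation that preserves a partition of the strings is a product of
transpositions inside its blocks (`genOn_of_rel`). In the presence of the Fredkin gate, a gate with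
a known fixed string can be controlled: whenever the control is off, an ancilla register holding
that string is swapped in (`GenOn.control`). With enough controls a gate shrinks to a single
transposition (`genOn_swap_of_controls`), so the class is a product of symmetric groups on the
blocks.

Affine classes. Gaussian elimination over the two-element field gives products of CNOT and NOT
(`affine_induction`). Appending a parity bit (`parityLift`) turns these into CNOTNOT and NOTNOT,
which settles the parity-preserving case.

The classes of `T_4`, of `T_6` and of no gates consist of the orthogonal maps that preserve weights
modulo 2, 4 and 0. Orbit and stabilizer of the last basis vector give their orders
(`ncard_orthogonalClass_succ`): the orbit is the set of strings of weight 1 modulo `m`, without the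
all-ones string when the length exceeds one, and the stabilizer is the same group on one bit less.

Linear classes are orthogonal (`IsLinearClass.isOrthogonal`): otherwise a conjugate of a swap leaves
a bit unchanged but depends on it, and holding that bit at 1 gives a nonlinear gate. After NOT or
NOTNOT is added, every gate is uniquely a translation after a gate of the linear class
(`count_of_linear_part`). For `F_4`, taking linear parts is a bijection onto the class of `T_4`:
`F_4` preserves weights modulo 4, which no nonzero translation does. -/

namespace RevGate

open Equiv

/-! ### Gates on arbitrary finite index types, and the derived closure rules -/

/-- Transport of a permutation of bit strings along a relabelling of the positions. -/
def reindexGate {ι κ : Type*} (e : ι ≃ κ) (G : Perm (ι → ZMod 2)) : Perm (κ → ZMod 2) :=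
  (Equiv.arrowCongr e (Equiv.refl (ZMod 2))).permCongr G

@[simp] lemma reindexGate_apply {ι κ : Type*} (e : ι ≃ κ) (G : Perm (ι → ZMod 2))
    (x : κ → ZMod 2) (k : κ) : reindexGate e G x k = G (fun i => x (e i)) (e.symm k) := rfl

lemma reindexGate_mul {ι κ : Type*} (e : ι ≃ κ) (F G : Perm (ι → ZMod 2)) :
    reindexGate e (F * G) = reindexGate e F * reindexGate e G := by
  ext x k
  simp [Perm.mul_apply]

@[simp] lemma reindexGate_one {ι κ : Type*} (e : ι ≃ κ) :
    reindexGate e (1 : Perm (ι → ZMod 2)) = 1 := by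
  ext x k
  simp

lemma reindexGate_trans {ι κ μ : Type*} (e : ι ≃ κ) (f : κ ≃ μ) (G : Perm (ι → ZMod 2)) :
    reindexGate f (reindexGate e G) = reindexGate (e.trans f) G := by
  ext x k
  simp

@[simp] lemma reindexGate_refl {ι : Type*} (G : Perm (ι → ZMod 2)) :
    reindexGate (Equiv.refl ι) G = G := by
  ext x k
  simp

lemma Generates.reindex {S : Set AnyGate} {n : ℕ} {G : Gate n} (h : Generates S G)
    (σ : Perm (Fin n)) : Generates S (reindexGate σ G) :=
  h.swapping σ.symm σ (fun _ => rfl)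

lemma Generates.pow {S : Set AnyGate} {n : ℕ} {G : Gate n} (h : Generates S G) (k : ℕ) :
    Generates S (G ^ k) := by
  induction k with
  | zero => simpa using Generates.ident n
  | succ k ih => rw [pow_succ]; exact ih.comp h

/-- Inverses are not among the closure rules, but a permutation of a finite set has finite order, so
its inverse is a power. -/
lemma Generates.inv {S : Set AnyGate} {n : ℕ} {G : Gate n} (h : Generates S G) :
    Generates S G⁻¹ := by
  have h1 : G⁻¹ = G ^ (orderOf G - 1) := by
    rw [inv_eq_iff_mul_eq_one, ← pow_succ', Nat.sub_add_cancel (orderOf_pos G), pow_orderOf_eq_one]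
  rw [h1]
  exact h.pow _

/-- `G`, a permutation of the strings indexed by a finite type, is generated by `S`. -/
def GenOn (S : Set AnyGate) {ι : Type*} (G : Perm (ι → ZMod 2)) : Prop :=
  ∃ (n : ℕ) (e : ι ≃ Fin n), Generates S (reindexGate e G)

variable {S S' : Set AnyGate} {ι κ : Type*}

/-- The numbering chosen in `GenOn` is immaterial: two numberings differ by a permutation of the
positions. -/
lemma GenOn.generates {G : Perm (ι → ZMod 2)} (h : GenOn S G) {n : ℕ} (e : ι ≃ Fin n) :
    Generates S (reindexGate e G) := by
  obtain ⟨m, f, hf⟩ := h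
  obtain rfl : m = n := Fin.equiv_iff_eq.1 ⟨f.symm.trans e⟩
  have := hf.reindex (f.symm.trans e)
  rwa [reindexGate_trans, ← Equiv.trans_assoc, Equiv.self_trans_symm, Equiv.refl_trans] at this

lemma genOn_fin {n : ℕ} {G : Gate n} : GenOn S G ↔ Generates S G := by
  refine ⟨fun h => ?_, fun h => ⟨n, Equiv.refl _, by simpa using h⟩⟩
  simpa using h.generates (Equiv.refl _)

lemma GenOn.reindex {G : Perm (ι → ZMod 2)} (h : GenOn S G) (e : ι ≃ κ) :
    GenOn S (reindexGate e G) := by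
  obtain ⟨m, f, hf⟩ := h
  refine ⟨m, e.symm.trans f, ?_⟩
  rwa [reindexGate_trans, ← Equiv.trans_assoc, Equiv.self_trans_symm, Equiv.refl_trans]

lemma GenOn.mul {F G : Perm (ι → ZMod 2)} (hF : GenOn S F) (hG : GenOn S G) :
    GenOn S (F * G) := by
  obtain ⟨n, e, he⟩ := hF
  exact ⟨n, e, by rw [reindexGate_mul]; exact he.comp (hG.generates e)⟩

lemma GenOn.one [Finite ι] : GenOn S (1 : Perm (ι → ZMod 2)) := by
  obtain ⟨n, ⟨e⟩⟩ := Finite.exists_equiv_fin ι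
  exact ⟨n, e, by simpa using Generates.ident n⟩

lemma GenOn.inv {G : Perm (ι → ZMod 2)} (hG : GenOn S G) : GenOn S G⁻¹ := by
  obtain ⟨n, e, he⟩ := hG
  refine ⟨n, e, ?_⟩
  have h1 : reindexGate e G⁻¹ = (reindexGate e G)⁻¹ := by
    rw [eq_inv_iff_mul_eq_one, ← reindexGate_mul]
    simp
  rw [h1]
  exact he.inv

/-- The gate that permutes the positions. -/
def bitPerm (σ : Perm ι) : Perm (ι → ZMod 2) := Equiv.arrowCongr σ (Equiv.refl (ZMod 2))

@[simp] lemma bitPerm_apply (σ : Perm ι) (x : ι → ZMod 2) (i : ι) :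
    bitPerm σ x i = x (σ.symm i) := rfl

lemma generates_bitPerm {n : ℕ} (σ : Perm (Fin n)) : Generates S (bitPerm σ : Gate n) :=
  (Generates.ident n).swapping σ.symm 1 (fun _ => rfl)

lemma GenOn.bitPerm [Finite ι] (σ : Perm ι) : GenOn S (bitPerm σ) := by
  obtain ⟨n, ⟨e⟩⟩ := Finite.exists_equiv_fin ι
  refine ⟨n, e, ?_⟩
  have : reindexGate e (RevGate.bitPerm σ) = RevGate.bitPerm (e.permCongr σ) := by
    ext x k
    simp [Equiv.permCongr_def]
  rw [this]
  exact generates_bitPerm _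

lemma Generates.append_extension {n : ℕ} {F : Gate n} (hF : Generates S F) (m : ℕ) :
    ∀ G : Gate (n + m), (∀ (x : Bits n) (y : Bits m), G (Fin.append x y) = Fin.append (F x) y) →
      Generates S G := by
  induction m with
  | zero =>
    intro G h
    have h1 : G = F := by
      ext x i
      have := congrFun (h x Fin.elim0) i
      simp only [Fin.append_elim0] at this
      exact this
    rw [h1]; exact hF
  | succ m ih =>
    intro G h
    let G' : Gate (n + m) := (Fin.appendEquiv n m).permCongr (Equiv.prodCongr F (Equiv.refl _))
    have hG' : ∀ (x : Bits n) (y : Bits m), G' (Fin.append x y) = Fin.append (F x) y := by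
      intro x y
      have h2 : Fin.append x y = Fin.appendEquiv n m (x, y) := rfl
      rw [h2]
      simp only [G', Equiv.permCongr_apply, Equiv.symm_apply_apply]
      rfl
    refine (ih G' hG').extension (G := G) ?_
    intro x b
    obtain ⟨⟨u, v⟩, rfl⟩ := (Fin.appendEquiv n m).surjective x
    change G (Fin.snoc (Fin.append u v) b) = Fin.snoc (G' (Fin.append u v)) b
    rw [hG', ← Fin.append_snoc, ← Fin.append_snoc]
    exact h u _

/-- Numbers the target positions so that the image of `f` comes first. Placement and the ancilla
rule on arbitrary positions then become statements about `Fin.append`. -/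
lemma exists_equiv_castAdd [Finite κ] (f : ι ↪ κ) {n : ℕ} (e : ι ≃ Fin n) :
    ∃ (m : ℕ) (g : κ ≃ Fin (n + m)), ∀ i, g (f i) = Fin.castAdd m (e i) := by
  classical
  obtain ⟨m, ⟨c⟩⟩ := Finite.exists_equiv_fin ((Set.range f)ᶜ : Set κ)
  let g : κ ≃ Fin (n + m) := (Equiv.Set.sumCompl (Set.range f)).symm.trans
    ((Equiv.sumCongr ((Equiv.ofInjective f f.injective).symm.trans e) c).trans finSumFinEquiv)
  refine ⟨m, g, fun i => ?_⟩
  have h1 : (Equiv.Set.sumCompl (Set.range f)).symm (f i) = Sum.inl ⟨f i, i, rfl⟩ :=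
    Equiv.Set.sumCompl_symm_apply_of_mem (Set.mem_range_self i)
  have h2 : (Equiv.ofInjective f f.injective).symm ⟨f i, i, rfl⟩ = i :=
    Equiv.ofInjective_symm_apply f.injective i
  simp [g, h1, h2]

/-- Applying a gate at the positions `f i`. -/
lemma GenOn.place [Finite κ] {F : Perm (ι → ZMod 2)} (hF : GenOn S F) (f : ι ↪ κ)
    {G : Perm (κ → ZMod 2)} (h : ∀ x i, G x (f i) = F (fun i => x (f i)) i)
    (h' : ∀ x j, j ∉ Set.range f → G x j = x j) : GenOn S G := by
  obtain ⟨n, e, he⟩ := hF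
  obtain ⟨m, g, hg⟩ := exists_equiv_castAdd f e
  refine ⟨n + m, g, he.append_extension m _ fun x y => ?_⟩
  ext k
  induction k using Fin.addCases with
  | left i =>
    obtain ⟨i, rfl⟩ := e.surjective i
    rw [Fin.append_left, reindexGate_apply, reindexGate_apply, ← hg, Equiv.symm_apply_apply, h]
    simp [hg]
  | right j =>
    rw [Fin.append_right, reindexGate_apply, h']
    · simp
    · rintro ⟨i, hi⟩
      have := hg i
      rw [hi, Equiv.apply_symm_apply] at this
      have := congrArg Fin.val this
      simp at this
      have := (e i).2
      omega

/-- The ancilla rule: the ancilla bits are those outside the range of `f`. -/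
lemma GenOn.ancilla {F : Perm (κ → ZMod 2)} (hF : GenOn S F) (f : ι ↪ κ) (a : κ → ZMod 2)
    {G : Perm (ι → ZMod 2)}
    (h : ∀ z : κ → ZMod 2, (∀ j, j ∉ Set.range f → z j = a j) →
      (∀ i, F z (f i) = G (fun i => z (f i)) i) ∧ ∀ j, j ∉ Set.range f → F z j = a j) :
    GenOn S G := by
  obtain ⟨N, e', he'⟩ := id hF
  have : Finite κ := Finite.of_equiv _ e'.symm
  have : Finite ι := Finite.of_injective f f.injective
  obtain ⟨n, ⟨e⟩⟩ := Finite.exists_equiv_fin ι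
  obtain ⟨m, g, hg⟩ := exists_equiv_castAdd f e
  refine ⟨n, e, Generates.ancilla (fun j => a (g.symm (Fin.natAdd n j))) (hF.generates g) ?_⟩
  have hr : ∀ j, j ∉ Set.range f → ∃ k, g j = Fin.natAdd n k := by
    intro j hj
    obtain ⟨l, hl⟩ : ∃ l, g j = l := ⟨_, rfl⟩
    rw [hl]
    induction l using Fin.addCases with
    | left i =>
      refine absurd ⟨e.symm i, g.injective ?_⟩ hj
      rw [hg, hl]; simp
    | right k => exact ⟨k, rfl⟩
  have hr' : ∀ k, g.symm (Fin.natAdd n k) ∉ Set.range f := by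
    rintro k ⟨i, hi⟩
    have := hg i
    rw [hi, Equiv.apply_symm_apply] at this
    have := congrArg Fin.val this
    simp at this
    have := (e i).2
    omega
  intro x
  set a' : Bits m := fun j => a (g.symm (Fin.natAdd n j)) with ha'
  have hz := h (fun k => Fin.append x a' (g k)) (by
    intro j hj
    obtain ⟨k, hk⟩ := hr j hj
    rw [hk, Fin.append_right]; change a (g.symm (Fin.natAdd n k)) = a j; rw [← hk]
    simp)
  ext k
  induction k using Fin.addCases with
  | left i =>
    obtain ⟨i, rfl⟩ := e.surjective i
    rw [Fin.append_left, reindexGate_apply, reindexGate_apply, ← hg, Equiv.symm_apply_apply, hz.1]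
    simp [hg]
  | right j =>
    rw [Fin.append_right, reindexGate_apply, hz.2 _ (hr' j)]

lemma Generates.mono {n : ℕ} {G : Gate n} (h : Generates S G)
    (hS : ∀ F ∈ S, Generates S' F.2) : Generates S' G := by
  induction h with
  | base h => exact hS _ h
  | ident n => exact .ident n
  | comp _ _ h1 h2 => exact h1.comp h2
  | swapping _ σ τ h h1 => exact h1.swapping σ τ h
  | extension _ h h1 => exact h1.extension h
  | ancilla a _ h h1 => exact h1.ancilla a h

/-! ### Controlled gates and transpositions of strings -/

section

lemma zmod_two_cases (b : ZMod 2) : b = 0 ∨ b = 1 := by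
  revert b; decide

lemma zmod_two_eq_add_one {a b : ZMod 2} : a ≠ b ↔ a = b + 1 := by
  revert a b; decide

/-- A permutation is a product of transpositions `(x y)` with `x`, `y` in the same class of an
equivalence relation that it preserves. -/
lemma perm_induction_of_rel {α : Type*} [Finite α] [DecidableEq α] {r : α → α → Prop}
    (hr : Equivalence r) {P : Perm α → Prop} (one : P 1) (mul : ∀ σ τ, P σ → P τ → P (σ * τ))
    (hswap : ∀ x y, r x y → P (swap x y)) (σ : Perm α) (hσ : ∀ x, r x (σ x)) : P σ := by
  have := Fintype.ofFinite α
  induction h : σ.support.card using Nat.strong_induction_on generalizing σ with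
  | _ n ih =>
    by_cases h1 : σ = 1
    · rw [h1]; exact one
    · obtain ⟨x, hx⟩ : ∃ x, σ x ≠ x := by
        by_contra! hc
        exact h1 (Equiv.ext hc)
      have h2 := Perm.card_support_swap_mul hx
      have h3 : P (swap x (σ x) * σ) := by
        refine ih _ (h ▸ h2) _ (fun y => ?_) rfl
        rw [Perm.mul_apply, swap_apply_def]
        split_ifs with h4 h5
        · have h6 := hσ y
          rw [h4] at h6
          exact hr.trans h6 (hσ x)
        · rw [σ.injective h5]; exact hr.refl x
        · exact hσ y
      have h4 : σ = swap x (σ x) * (swap x (σ x) * σ) := by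
        rw [← mul_assoc, swap_mul_self, one_mul]
      rw [h4]
      exact mul _ _ (hswap _ _ (hσ x)) h3

/-- Apply `Q` where the condition `p` holds. -/
def condPerm {α : Type*} (Q : Perm α) (p : α → Prop) [DecidablePred p]
    (hp : ∀ z, p (Q z) ↔ p z) : Perm α where
  toFun z := if p z then Q z else z
  invFun z := if p z then Q.symm z else z
  left_inv z := by
    by_cases h : p z <;> simp [h, hp]
  right_inv z := by
    have h' : p (Q.symm z) ↔ p z := by rw [← hp, Equiv.apply_symm_apply]
    by_cases h : p z <;> simp [h, h']

lemma condPerm_apply {α : Type*} (Q : Perm α) (p : α → Prop) [DecidablePred p]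
    (hp : ∀ z, p (Q z) ↔ p z) (z : α) : condPerm Q p hp z = if p z then Q z else z := rfl

/-- Apply `Q` to the left half of the bits. -/
def leftGate (κ : Type*) (Q : Perm (ι → ZMod 2)) : Perm (ι ⊕ κ → ZMod 2) :=
  (Equiv.sumArrowEquivProdArrow ι κ (ZMod 2)).symm.permCongr (Equiv.prodCongr Q (Equiv.refl _))

@[simp] lemma leftGate_inl (Q : Perm (ι → ZMod 2)) (z : ι ⊕ κ → ZMod 2) (i : ι) :
    leftGate κ Q z (Sum.inl i) = Q (fun i => z (Sum.inl i)) i := rfl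

lemma GenOn.leftGate [Finite κ] {Q : Perm (ι → ZMod 2)} (h : GenOn S Q) :
    GenOn S (leftGate κ Q) := by
  obtain ⟨n, e, -⟩ := id h
  have : Finite ι := Finite.of_equiv _ e.symm
  refine h.place Function.Embedding.inl (fun x i => rfl) ?_
  rintro x (j | j) hj
  · exact absurd ⟨j, rfl⟩ hj
  · rfl

lemma condPerm_bitPerm_aux {t : ι} {σ : Perm ι} (hσ : σ t = t) (b : ZMod 2) (z : ι → ZMod 2) :
    bitPerm σ z t = b ↔ z t = b := by
  have : σ.symm t = t := by rw [Equiv.symm_apply_eq, hσ]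
  simp [this]

lemma condPerm_agree_aux {Q : Perm (ι → ZMod 2)} {T : Finset ι} (hT : ∀ t ∈ T, ∀ z, Q z t = z t)
    (x z : ι → ZMod 2) : (∀ t ∈ T, Q z t = x t) ↔ ∀ t ∈ T, z t = x t :=
  forall₂_congr fun t ht => by rw [hT t ht]

@[simp] lemma bitPerm_one : bitPerm (1 : Perm ι) = 1 := rfl

variable [DecidableEq ι]

lemma genOn_fredkin_triple [Fintype ι] (hF : GenOn S fredkinGate) {t i j : ι} (hti : t ≠ i)
    (htj : t ≠ j) (hij : i ≠ j) {G : Perm (ι → ZMod 2)}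
    (hG : ∀ z, G z = if z t = 1 then bitPerm (swap i j) z else z) : GenOn S G := by
  have hinj : Function.Injective (![t, i, j] : Fin 3 → ι) := by
    intro a b
    fin_cases a <;> fin_cases b <;> simp [hti, htj, hij, hti.symm, htj.symm, hij.symm]
  have key : ∀ a b : ZMod 2, a + 1 * (a + b) = b ∧ a + 1 * (b + a) = b := by decide
  refine hF.place ⟨_, hinj⟩ (fun z k => ?_) (fun z l hl => ?_)
  · rw [hG]
    rcases zmod_two_cases (z t) with h | h
    · fin_cases k <;> simp [h, fredkinGate, Function.Involutive.toPerm]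
    · have h1 : swap i j t = t := swap_apply_of_ne_of_ne hti htj
      fin_cases k <;> simp [h, fredkinGate, Function.Involutive.toPerm, h1] <;>
      · have := key (z i) (z j); have := key (z j) (z i); simp_all
  · rw [hG]
    split_ifs
    · have h1 : l ≠ i := fun h => hl ⟨1, h.symm⟩
      have h2 : l ≠ j := fun h => hl ⟨2, h.symm⟩
      simp [swap_apply_of_ne_of_ne h1 h2]
    · rfl

/-- Permuting the positions under the control of one bit. -/
lemma genOn_condPerm_bitPerm [Fintype ι] (hF : GenOn S fredkinGate) (t : ι) (b : ZMod 2)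
    (σ : Perm ι) (hσ : σ t = t) :
    GenOn S (condPerm (bitPerm σ) (fun z => z t = b) (condPerm_bitPerm_aux hσ b)) := by
  have h1 : ∀ hσ : σ t = t,
      GenOn S (condPerm (bitPerm σ) (fun z => z t = 1) (condPerm_bitPerm_aux hσ 1)) := by
    -- The classes of this relation are `{t}` and its complement, so only transpositions of
    -- positions other than `t` occur.
    refine perm_induction_of_rel (r := fun x y => x = t ↔ y = t)
      (P := fun σ => σ t = t ∧ ∀ hσ : σ t = t,
        GenOn S (condPerm (bitPerm σ) (fun z => z t = 1) (condPerm_bitPerm_aux hσ 1)))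
      ⟨fun _ => Iff.rfl, fun h => h.symm, fun h h' => h.trans h'⟩ ?_ ?_ ?_ σ ?_ |>.2
    · refine ⟨rfl, fun _ => ?_⟩
      convert GenOn.one (S := S) (ι := ι)
      ext z k
      simp [condPerm_apply]
    · rintro σ τ ⟨hσ, h⟩ ⟨hτ, h'⟩
      refine ⟨by simp [hσ, hτ], fun _ => ?_⟩
      convert (h hσ).mul (h' hτ)
      have : τ.symm t = t := by rw [Equiv.symm_apply_eq, hτ]
      ext z k
      by_cases hz : z t = 1
      · simp [condPerm_apply, hz, this, Perm.mul_def]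
      · simp [condPerm_apply, hz]
    · intro i j hij
      by_cases h : i = j
      · subst h
        refine ⟨by simp, fun _ => ?_⟩
        convert GenOn.one (S := S) (ι := ι)
        ext z k
        simp [condPerm_apply, ← Perm.one_def]
      · have hti : t ≠ i := by
          rintro rfl; exact h (hij.1 rfl).symm
        have htj : t ≠ j := by
          rintro rfl; exact h (hij.2 rfl)
        exact ⟨swap_apply_of_ne_of_ne hti htj, fun _ =>
          genOn_fredkin_triple hF hti htj h (fun _ => rfl)⟩
    · intro x
      conv_rhs => rw [← hσ]
      exact σ.injective.eq_iff.symm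
  rcases zmod_two_cases b with rfl | rfl
  -- Control value 0: permute unconditionally, after undoing the permutation in the case where the
  -- bit is 1.
  · convert (GenOn.bitPerm (S := S) σ).mul (h1 hσ).inv
    rw [eq_mul_inv_iff_mul_eq]
    ext z k
    have : σ.symm t = t := by rw [Equiv.symm_apply_eq, hσ]
    rcases zmod_two_cases (z t) with h | h <;> simp [condPerm_apply, h, this]
  · exact h1 hσ

/-- Adding a control to a gate, where an ancilla register holding a fixed point of the gate is
swapped in when the gate is not to act. -/
lemma GenOn.control [Fintype ι] {Q : Perm (ι → ZMod 2)} (hQ : GenOn S Q)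
    (hF : GenOn S fredkinGate) {t : ι} (ht : ∀ z, Q z t = z t) (f : ι → ZMod 2)
    (hf : ∀ b, Q (Function.update f t b) = Function.update f t b) (c : ZMod 2)
    {G : Perm (ι → ZMod 2)} (hG : ∀ z, G z = if z t = c then Q z else z) : GenOn S G := by
  -- Exchanges the data register with the ancilla register everywhere except at the control `t`,
  -- which stays in place so that the second exchange reads the same control.
  let s : ι ⊕ ι → ι ⊕ ι := Sum.elim (fun i => if i = t then Sum.inl i else Sum.inr i)
    (fun i => if i = t then Sum.inr i else Sum.inl i)
  have hs : Function.Involutive s := by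
    rintro (i | i) <;> by_cases h : i = t <;> simp [s, h]
  let σ : Perm (ι ⊕ ι) := hs.toPerm
  have hσ' : ∀ a, σ.symm a = s a := fun a => rfl
  have hσt : σ (Sum.inl t) = Sum.inl t := by
    change s (Sum.inl t) = _
    simp [s]
  have hW := genOn_condPerm_bitPerm (S := S) hF (Sum.inl t) (c + 1) σ hσt
  set W := condPerm (RevGate.bitPerm σ) (fun z => z (Sum.inl t) = c + 1)
    (condPerm_bitPerm_aux hσt (c + 1)) with hWdef
  refine ((hW.mul (hQ.leftGate (κ := ι))).mul hW).ancilla Function.Embedding.inl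
    (Sum.elim 0 f) fun z hz => ?_
  have hz' : ∀ i, z (Sum.inr i) = f i := fun i => hz (Sum.inr i) (by simp)
  suffices h : (W * RevGate.leftGate ι Q * W) z =
      Sum.elim (G (fun i => z (Sum.inl i))) f by
    rw [h]
    refine ⟨fun i => rfl, ?_⟩
    rintro (j | j) hj
    · exact absurd ⟨j, rfl⟩ hj
    · rfl
  rw [Perm.mul_apply, Perm.mul_apply, hG]
  by_cases h : z (Sum.inl t) = c
  · have hne : c ≠ c + 1 := zmod_two_eq_add_one.2 (add_add_self c 1).symm
    have h1 : W z = z := by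
      rw [hWdef, condPerm_apply, if_neg (by rw [h]; exact hne)]
    rw [h1, if_pos h, hWdef, condPerm_apply, if_neg]
    · funext k
      rcases k with k | k
      · rfl
      · exact hz' k
    · rw [leftGate_inl, ht, h]; exact hne
  -- Control off: `Q` now sees `f` with the live bit at `t`, which is why `f` must stay fixed after
  -- an update there.
  · have h2 : z (Sum.inl t) = c + 1 := zmod_two_eq_add_one.1 h
    have h1 : W z = Sum.elim (Function.update f t (z (Sum.inl t)))
        (Function.update (fun i => z (Sum.inl i)) t (f t)) := by
      rw [hWdef, condPerm_apply, if_pos h2]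
      funext k
      rw [bitPerm_apply, hσ']
      rcases k with k | k <;> by_cases hk : k = t
      · subst hk; simp [s]
      · simp [s, hk, hz']
      · subst hk; simp [s, hz']
      · simp [s, hk]
    have h3 : RevGate.leftGate ι Q (W z) = W z := by
      rw [h1]
      funext k
      rcases k with k | k
      · exact congrFun (hf _) k
      · rfl
    rw [h3, if_neg h, hWdef, condPerm_apply, if_pos, ← hWdef, h1]
    · funext k
      rw [bitPerm_apply, hσ']
      rcases k with k | k <;> by_cases hk : k = t
      · subst hk; simp [s]
      · simp [s, hk]
      · subst hk; simp [s]
      · simp [s, hk]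
    · rw [← hWdef, h1]; simpa using h2

/-- Adding several controls. -/
lemma GenOn.controls [Fintype ι] {Q : Perm (ι → ZMod 2)} (hQ : GenOn S Q)
    (hF : GenOn S fredkinGate) (f : ι → ZMod 2) (x : ι → ZMod 2) (T : Finset ι) :
    ∀ (hT : ∀ t ∈ T, ∀ z, Q z t = z t) (_ : ∀ g : ι → ZMod 2, (∀ i ∉ T, g i = f i) → Q g = g),
    GenOn S (condPerm Q (fun z => ∀ t ∈ T, z t = x t) (condPerm_agree_aux hT x)) := by
  induction T using Finset.induction_on with
  | empty =>
    intro hT _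
    convert hQ
    ext z k
    simp [condPerm_apply]
  | insert t T htT ih =>
    intro hT hf
    have hT' : ∀ t ∈ T, ∀ z, Q z t = z t := fun s hs => hT s (Finset.mem_insert_of_mem hs)
    have hf' : ∀ g : ι → ZMod 2, (∀ i ∉ T, g i = f i) → Q g = g := fun g hg =>
      hf g fun i hi => hg i fun h => hi (Finset.mem_insert_of_mem h)
    -- The control bits are not exchanged with the register, so the hypothesis on fixed strings
    -- leaves the values on `T` free.
    refine (ih hT' hf').control hF (t := t) (fun z => ?_) f (fun b => ?_) (x t) (fun z => ?_)
    · rw [condPerm_apply]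
      split_ifs
      · exact hT t (Finset.mem_insert_self _ _) z
      · rfl
    · rw [condPerm_apply]
      split_ifs
      · refine hf _ fun i hi => ?_
        rw [Function.update_of_ne]
        rintro rfl
        exact hi (Finset.mem_insert_self _ _)
      · rfl
    · simp only [condPerm_apply, Finset.forall_mem_insert]
      by_cases h1 : z t = x t <;> simp [h1]

/-- Controls on `T` confine `Q` to the strings that agree with `x` on `T`; if `Q` moves only `x` and
`y` among them, what remains is the transposition. The string `f` serves as the ancilla register and
need not be related to `x`. -/
lemma genOn_swap_of_controls [Fintype ι] (hF : GenOn S fredkinGate) {Q : Perm (ι → ZMod 2)}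
    (hQ : GenOn S Q) (T : Finset ι) (hT : ∀ t ∈ T, ∀ z, Q z t = z t) (f : ι → ZMod 2)
    (hf : ∀ g : ι → ZMod 2, (∀ i ∉ T, g i = f i) → Q g = g) {x y : ι → ZMod 2}
    (hxy : ∀ t ∈ T, y t = x t) (h1 : Q x = y) (h2 : Q y = x)
    (h3 : ∀ z, (∀ t ∈ T, z t = x t) → z ≠ x → z ≠ y → Q z = z) : GenOn S (swap x y) := by
  convert hQ.controls hF f x T hT hf
  refine Equiv.ext fun z => ?_
  rw [condPerm_apply, swap_apply_def]
  split_ifs with ha hb hc hd he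
  · rw [ha, h1]
  · subst ha; exact absurd (fun _ _ => rfl) hb
  · rw [hc, h2]
  · subst hc; exact absurd hxy hd
  · exact (h3 z he ha hc).symm
  · rfl

end

/-! ### Gates on some of the positions, and reduction to transpositions -/

/-- The gate `F` applied at the positions `f i`. -/
noncomputable def placeGate (f : ι ↪ κ) (F : Perm (ι → ZMod 2)) : Perm (κ → ZMod 2) where
  toFun z := Function.extend f (F (z ∘ f)) z
  invFun z := Function.extend f (F.symm (z ∘ f)) z
  left_inv z := by
    have h : Function.extend f (F (z ∘ f)) z ∘ f = F (z ∘ f) := Function.extend_comp f.injective _ _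
    funext k
    by_cases hk : ∃ i, f i = k
    · obtain ⟨i, rfl⟩ := hk
      simp only [h, f.injective.extend_apply, Equiv.symm_apply_apply, Function.comp_apply]
    · simp only [Function.extend_apply' _ _ _ hk]
  right_inv z := by
    have h : Function.extend f (F.symm (z ∘ f)) z ∘ f = F.symm (z ∘ f) :=
      Function.extend_comp f.injective _ _
    funext k
    by_cases hk : ∃ i, f i = k
    · obtain ⟨i, rfl⟩ := hk
      simp only [h, f.injective.extend_apply, Equiv.apply_symm_apply, Function.comp_apply]
    · simp only [Function.extend_apply' _ _ _ hk]

@[simp] lemma placeGate_apply_of_range (f : ι ↪ κ) (F : Perm (ι → ZMod 2)) (z : κ → ZMod 2)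
    (i : ι) : placeGate f F z (f i) = F (z ∘ f) i := f.injective.extend_apply _ _ _

lemma placeGate_apply_of_notMem (f : ι ↪ κ) (F : Perm (ι → ZMod 2)) (z : κ → ZMod 2)
    {k : κ} (hk : k ∉ Set.range f) : placeGate f F z k = z k := Function.extend_apply' _ _ _ hk

lemma GenOn.placeGate [Finite κ] {F : Perm (ι → ZMod 2)} (hF : GenOn S F) (f : ι ↪ κ) :
    GenOn S (placeGate f F) :=
  hF.place f (fun z i => placeGate_apply_of_range f F z i)
    (fun z _ hk => placeGate_apply_of_notMem f F z hk)

lemma placeGate_of_fixed (f : ι ↪ κ) (F : Perm (ι → ZMod 2)) {z : κ → ZMod 2}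
    (h : F (z ∘ f) = z ∘ f) : placeGate f F z = z := by
  funext k
  by_cases hk : k ∈ Set.range f
  · obtain ⟨i, rfl⟩ := hk
    rw [placeGate_apply_of_range, h, Function.comp_apply]
  · exact placeGate_apply_of_notMem f F z hk

/-- Transitivity is the conjugation `(y z)(x y)(y z) = (x z)`. Hence it suffices to link strings by
short steps. -/
lemma equivalence_genOn_swap [Fintype ι] [DecidableEq ι] :
    Equivalence (fun x y : ι → ZMod 2 => GenOn S (swap x y)) where
  refl x := by
    rw [swap_self]; exact GenOn.one
  symm h := by rwa [swap_comm]
  trans := by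
    intro x y z hxy hyz
    by_cases h1 : x = y
    · rwa [h1]
    by_cases h2 : x = z
    · rw [h2, swap_self]; exact GenOn.one
    have h3 := (hyz.mul hxy).mul hyz
    rwa [swap_mul_swap_mul_swap h1 h2, swap_comm] at h3

/-- The form in which completeness of the non-affine classes is proved: only transpositions within a
class of `r` have to be generated. -/
lemma genOn_of_rel [Fintype ι] [DecidableEq ι] {r : (ι → ZMod 2) → (ι → ZMod 2) → Prop}
    (hr : Equivalence r) (h : ∀ x y, r x y → GenOn S (swap x y)) {G : Perm (ι → ZMod 2)}
    (hG : ∀ x, r x (G x)) : GenOn S G :=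
  perm_induction_of_rel hr GenOn.one (fun _ _ => GenOn.mul) h G hG

/-! ### Conservative gates -/

/-- One transposition of positions at a time: exchange `i` and `j` under the control of all other
bits. If `y i ≠ y j`, only `y` and its image satisfy the controls and are moved. -/
lemma genOn_swap_bitPerm [Fintype ι] [DecidableEq ι] (hF : GenOn S fredkinGate) (σ : Perm ι)
    (x : ι → ZMod 2) : GenOn S (swap x (bitPerm σ x)) := by
  induction σ using Perm.swap_induction_on with
  | one => exact equivalence_genOn_swap.refl x
  | swap_mul σ i j hij ih =>
    refine equivalence_genOn_swap.trans ih ?_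
    have h0 : bitPerm (swap i j * σ) x = bitPerm (swap i j) (bitPerm σ x) := rfl
    rw [h0]
    generalize bitPerm σ x = y
    have hT : ∀ t ∈ (Finset.univ \ {i, j} : Finset ι), t ≠ i ∧ t ≠ j := by simp
    have hfix : ∀ z : ι → ZMod 2, z i = z j → bitPerm (swap i j) z = z := by
      intro z hz
      funext k
      rw [bitPerm_apply, symm_swap, swap_apply_def]
      split_ifs with h1 h2
      · rw [h1, hz]
      · rw [h2, hz]
      · rfl
    by_cases hy : y i = y j
    · rw [hfix y hy]; exact equivalence_genOn_swap.refl y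
    have hT' : ∀ t ∈ (Finset.univ \ {i, j} : Finset ι), ∀ z, bitPerm (swap i j) z t = z t := by
      intro t ht z
      rw [bitPerm_apply, symm_swap, swap_apply_of_ne_of_ne (hT t ht).1 (hT t ht).2]
    -- The zero string works as ancilla: its entries at `i` and `j` are equal.
    refine genOn_swap_of_controls hF (GenOn.bitPerm (swap i j)) (Finset.univ \ {i, j}) hT' 0
      (fun g hg => hfix g ?_) (fun t ht => hT' t ht y) rfl ?_ fun z hz h1 h2 => hfix z ?_
    · rw [hg i (by simp), hg j (by simp)]; rfl
    · funext k; simp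
    · by_contra hne
      by_cases h3 : z i = y i
      · refine h1 (funext fun k => ?_)
        by_cases hk : k = i
        · rw [hk, h3]
        by_cases hk' : k = j
        · rw [hk']
          revert hne h3 hy
          generalize z i = a, z j = b, y i = c, y j = d
          revert a b c d; decide
        · exact hz k (by simp [hk, hk'])
      · refine h2 (funext fun k => ?_)
        by_cases hk : k = i
        · rw [hk, bitPerm_apply, symm_swap, swap_apply_left]
          revert hne h3 hy
          generalize z i = a, z j = b, y i = c, y j = d
          revert a b c d; decide
        by_cases hk' : k = j
        · rw [hk', bitPerm_apply, symm_swap, swap_apply_right]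
          revert hne h3 hy
          generalize z i = a, z j = b, y i = c, y j = d
          revert a b c d; decide
        · rw [hT' k (by simp [hk, hk']), hz k (by simp [hk, hk'])]

lemma exists_bitPerm_of_hammingNorm_eq [Fintype ι] [DecidableEq ι] {x y : ι → ZMod 2}
    (h : hammingNorm x = hammingNorm y) : ∃ σ : Perm ι, bitPerm σ x = y := by
  have h1 : Fintype.card {i // x i ≠ 0} = Fintype.card {i // y i ≠ 0} := by
    rw [Fintype.card_subtype, Fintype.card_subtype]; exact h
  let e := Fintype.equivOfCardEq h1
  refine ⟨e.extendSubtype, ?_⟩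
  have h2 : ∀ i, y (e.extendSubtype i) = x i := by
    intro i
    by_cases hi : x i ≠ 0
    · have h3 := e.extendSubtype_mem i hi
      rw [(zmod_two_cases _).resolve_left h3, (zmod_two_cases _).resolve_left hi]
    · have h3 := e.extendSubtype_not_mem i hi
      rw [not_not.1 h3, not_not.1 hi]
  funext k
  rw [bitPerm_apply, ← h2, Equiv.apply_symm_apply]

lemma genOn_swap_of_hammingNorm_eq [Fintype ι] [DecidableEq ι] (hF : GenOn S fredkinGate)
    {x y : ι → ZMod 2} (h : hammingNorm x = hammingNorm y) : GenOn S (swap x y) := by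
  obtain ⟨σ, rfl⟩ := exists_bitPerm_of_hammingNorm_eq h
  exact genOn_swap_bitPerm hF σ x

/-! ### Gates preserving the Hamming weight modulo `k` -/

lemma genOn_swap_zero_one {k : ℕ} (hC : GenOn S (cGate k)) [Fintype ι] [DecidableEq ι]
    (h : Fintype.card ι = k) : GenOn S (swap (0 : ι → ZMod 2) 1) := by
  convert hC.reindex (Fintype.equivFinOfCardEq h).symm
  set e := (Fintype.equivFinOfCardEq h).symm
  refine Equiv.ext fun x => funext fun i => ?_
  obtain ⟨y, rfl⟩ : ∃ y : Bits k, x = fun i => y (e.symm i) := ⟨fun j => x (e j), by simp⟩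
  have h0 : (fun i => y (e.symm i)) = 0 ↔ y = 0 :=
    ⟨fun h => funext fun j => by simpa using congrFun h (e j), fun h => by subst h; rfl⟩
  have h1 : (fun i => y (e.symm i)) = 1 ↔ y = 1 :=
    ⟨fun h => funext fun j => by simpa using congrFun h (e j), fun h => by subst h; rfl⟩
  simp only [reindexGate_apply, cGate, swap_apply_def, h0, h1, Equiv.symm_apply_apply]
  split_ifs <;> rfl

/-- Apply `C_k` at `k` positions `U` where `x` is 1, controlled by all the others; this erases `k`
ones of `x`. -/
lemma exists_genOn_swap_sub {k : ℕ} (hk : 2 ≤ k) (hF : GenOn S fredkinGate)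
    (hC : GenOn S (cGate k)) [Fintype ι] [DecidableEq ι] (x : ι → ZMod 2)
    (hx : k ≤ hammingNorm x) : ∃ y, GenOn S (swap x y) ∧ hammingNorm y + k = hammingNorm x := by
  obtain ⟨U, hU, hUk⟩ := Finset.exists_subset_card_eq (hammingNorm.eq_1 x ▸ hx)
  have hxU : ∀ i ∈ U, x i = 1 := fun i hi => by
    have := hU hi
    simp only [Finset.mem_filter] at this
    exact (zmod_two_cases _).resolve_left this.2
  let f : {i // i ∈ U} ↪ ι := Function.Embedding.subtype _
  have hQ : GenOn S (placeGate f (swap 0 1)) :=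
    (genOn_swap_zero_one hC (by simpa using hUk)).placeGate f
  have hT : ∀ t ∈ Finset.univ \ U, ∀ z, placeGate f (swap 0 1) z t = z t := by
    intro t ht z
    refine placeGate_apply_of_notMem _ _ _ ?_
    rintro ⟨⟨i, hi⟩, rfl⟩
    simp at ht
    exact ht hi
  have hx1 : x ∘ f = 1 := funext fun i => hxU i i.2
  let y : ι → ZMod 2 := fun i => if i ∈ U then 0 else x i
  have hy0 : y ∘ f = 0 := funext fun i => if_pos i.2
  have hxy : ∀ t ∈ Finset.univ \ U, y t = x t := fun t ht => if_neg (by simpa using ht)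
  obtain ⟨u, v, hu, hv, huv⟩ : ∃ u v, u ∈ U ∧ v ∈ U ∧ u ≠ v := by
    obtain ⟨u, hu, v, hv, h⟩ := Finset.one_lt_card.1 (by omega : 1 < U.card)
    exact ⟨u, v, hu, hv, h⟩
  have hval : ∀ z w, (∀ t ∈ Finset.univ \ U, w t = z t) →
      swap 0 1 (z ∘ f) = w ∘ f → placeGate f (swap 0 1) z = w := by
    intro z w hzw h
    funext i
    by_cases hi : i ∈ U
    · have := placeGate_apply_of_range f (swap 0 1) z ⟨i, hi⟩
      rw [h] at this
      exact this
    · rw [hT i (by simpa using hi), hzw i (by simpa using hi)]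
  -- The ancilla string has a single 1 in `U`. Since `U` has at least two elements it is not
  -- constant there, so `C_k` fixes it.
  refine ⟨y, genOn_swap_of_controls hF hQ (Finset.univ \ U) hT (Pi.single u 1) (fun g hg => ?_)
    hxy (hval x y hxy ?_) (hval y x (fun t ht => (hxy t ht).symm) ?_) fun z hz h1 h2 => ?_, ?_⟩
  · refine placeGate_of_fixed _ _ (swap_apply_of_ne_of_ne (fun h => ?_) fun h => ?_)
    · have h3 := congrFun h ⟨u, hu⟩
      change g u = 0 at h3
      rw [hg u (by simp [hu])] at h3
      simp at h3
    · have h3 := congrFun h ⟨v, hv⟩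
      change g v = 1 at h3
      rw [hg v (by simp [hv])] at h3
      simp [huv.symm] at h3
  · rw [hx1, hy0, swap_apply_right]
  · rw [hx1, hy0, swap_apply_left]
  · refine placeGate_of_fixed _ _ (swap_apply_of_ne_of_ne (fun h => h2 ?_) fun h => h1 ?_)
    · funext i
      by_cases hi : i ∈ U
      · have h3 := congrFun (h.trans hy0.symm) ⟨i, hi⟩
        exact h3
      · rw [hz i (by simpa using hi), hxy i (by simpa using hi)]
    · funext i
      by_cases hi : i ∈ U
      · have h3 := congrFun (h.trans hx1.symm) ⟨i, hi⟩
        exact h3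
      · rw [hz i (by simpa using hi)]
  · rw [hammingNorm, hammingNorm]
    have h3 : Finset.univ.filter (fun i => y i ≠ 0) =
        Finset.univ.filter (fun i => x i ≠ 0) \ U := by
      ext i
      by_cases hi : i ∈ U <;> simp [y, hi]
    rw [h3, ← hUk, Finset.card_sdiff_add_card_eq_card hU]

/-- Ones are removed `k` at a time from the heavier string until the weights agree; the conservative
case finishes. -/
lemma genOn_swap_of_modEq {k : ℕ} (hk : 2 ≤ k) (hF : GenOn S fredkinGate)
    (hC : GenOn S (cGate k)) [Fintype ι] [DecidableEq ι] {x y : ι → ZMod 2}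
    (h : hammingNorm x ≡ hammingNorm y [MOD k]) : GenOn S (swap x y) := by
  induction hs : hammingNorm x + hammingNorm y using Nat.strong_induction_on
    generalizing x y with
  | _ s ih =>
    wlog hle : hammingNorm y ≤ hammingNorm x generalizing x y
    · rw [swap_comm]
      exact this h.symm (by omega) (by omega)
    rcases hle.eq_or_lt with heq | hlt
    · exact genOn_swap_of_hammingNorm_eq hF heq.symm
    · have h1 : k ≤ hammingNorm x := by
        have := (Nat.modEq_iff_dvd' hle).1 h.symm
        have := Nat.le_of_dvd (by omega) this
        omega
      obtain ⟨x', h2, h3⟩ := exists_genOn_swap_sub hk hF hC x h1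
      refine equivalence_genOn_swap.trans h2 (ih _ (by omega) ?_ rfl)
      have h4 : hammingNorm x' ≡ hammingNorm x [MOD k] := by
        rw [← h3]; simp [Nat.ModEq]
      exact h4.trans h

/-- For `k ≥ 3`, the gate `C_k` generates the Fredkin gate: three copies of `C_k` on two sets of
`k` positions with all but one position in common. -/
lemma genOn_fredkin_of_cGate {k : ℕ} (hk : 3 ≤ k) (hC : GenOn S (cGate k)) :
    GenOn S fredkinGate := by
  -- The three data bits and `k - 2` ancillas make `k + 1` positions; `g j` is `C_k` on all of them
  -- except the data bit `j`. The hypothesis `3 ≤ k` provides at least one ancilla.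
  let κ := Fin 3 ⊕ Fin (k - 2)
  let g : Fin 3 → Perm (κ → ZMod 2) := fun j =>
    placeGate (Function.Embedding.subtype (fun s : κ => s ≠ Sum.inl j)) (swap 0 1)
  have hcard : ∀ j : Fin 3, Fintype.card {s : κ // s ≠ Sum.inl j} = k := by
    intro j
    have := Fintype.card_subtype_compl (fun s : κ => s = Sum.inl j)
    simp [κ] at this ⊢
    omega
  have hg : ∀ j, GenOn S (g j) := fun j => (genOn_swap_zero_one hC (hcard j)).placeGate _
  let E : Bits 3 → ZMod 2 → κ → ZMod 2 := fun x r => Sum.elim x (fun _ => r)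
  let p : Fin (k - 2) := ⟨0, by omega⟩
  have hconst : ∀ (j : Fin 3) (x : Bits 3) (r b : ZMod 2),
      (E x r ∘ (Function.Embedding.subtype (fun s : κ => s ≠ Sum.inl j)) = fun _ => b) ↔
        (∀ i, i ≠ j → x i = b) ∧ r = b := by
    intro j x r b
    constructor
    · intro h
      refine ⟨fun i hi => congrFun h ⟨Sum.inl i, fun h' => hi (Sum.inl_injective h')⟩, ?_⟩
      exact congrFun h ⟨Sum.inr p, by simp⟩
    · rintro ⟨h1, h2⟩
      funext ⟨s, hs⟩
      rcases s with i | i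
      · exact h1 i fun h' => hs (congrArg _ h')
      · exact h2
  have hgE : ∀ (j : Fin 3) (x : Bits 3) (r : ZMod 2), g j (E x r) =
      if ∀ i, i ≠ j → x i = r then E (fun i => if i = j then x i else x i + 1) (r + 1)
      else E x r := by
    intro j x r
    split_ifs with h
    · have h1 := (hconst j x r r).2 ⟨h, rfl⟩
      have h2 : swap (0 : {s : κ // s ≠ Sum.inl j} → ZMod 2) 1
          (E x r ∘ (Function.Embedding.subtype (fun s : κ => s ≠ Sum.inl j))) =
          fun _ => r + 1 := by
        rw [h1]
        rcases zmod_two_cases r with rfl | rfl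
        · exact swap_apply_left _ _
        · exact swap_apply_right _ _
      funext s
      by_cases hs : s = Sum.inl j
      · subst hs
        have := placeGate_apply_of_notMem
          (Function.Embedding.subtype (fun s : κ => s ≠ Sum.inl j)) (swap 0 1) (E x r)
          (k := Sum.inl j) (by simp)
        rw [this]
        simp [E]
      · have := placeGate_apply_of_range
          (Function.Embedding.subtype (fun s : κ => s ≠ Sum.inl j)) (swap 0 1) (E x r) ⟨s, hs⟩
        rw [h2] at this
        refine this.trans ?_
        rcases s with i | i
        · have hi : i ≠ j := fun h' => hs (congrArg _ h')
          simp [E, hi, h i hi]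
        · rfl
    · refine placeGate_of_fixed _ _ (swap_apply_of_ne_of_ne (fun h' => h ?_) fun h' => h ?_)
      · obtain ⟨h1, h2⟩ := (hconst j x r 0).1 h'
        rw [h2]; exact h1
      · obtain ⟨h1, h2⟩ := (hconst j x r 1).1 h'
        rw [h2]; exact h1
  -- The ancillas always agree with each other, so one bit records them and the identity becomes a
  -- finite check independent of `k`.
  let g' : Fin 3 → Bits 3 × ZMod 2 → Bits 3 × ZMod 2 := fun j w =>
    if ∀ i, i ≠ j → w.1 i = w.2 then (fun i => if i = j then w.1 i else w.1 i + 1, w.2 + 1)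
    else w
  have hg' : ∀ j w, g j (E w.1 w.2) = E (g' j w).1 (g' j w).2 := by
    intro j w
    rw [hgE]
    simp only [g']
    split_ifs <;> rfl
  have key : ∀ x : Bits 3, g' 2 (g' 1 (g' 2 (x, 1))) = (fredkinGate x, 1) := by decide
  refine (((hg 2).mul (hg 1)).mul (hg 2)).ancilla Function.Embedding.inl (fun _ => 1) ?_
  intro z hz
  obtain ⟨x, rfl⟩ : ∃ x, z = E x 1 := by
    refine ⟨fun i => z (Sum.inl i), funext fun s => ?_⟩
    rcases s with i | i
    · rfl
    · exact hz (Sum.inr i) (by rintro ⟨j, hj⟩; cases hj)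
  have h1 : (g 2 * g 1 * g 2) (E x 1) = E (fredkinGate x) 1 := by
    change g 2 (g 1 (g 2 (E (x, (1 : ZMod 2)).1 (x, (1 : ZMod 2)).2))) = _
    rw [hg', hg', hg', key]
  rw [h1]
  refine ⟨fun i => rfl, ?_⟩
  rintro (j | j) hj
  · exact absurd ⟨j, rfl⟩ hj
  · rfl

/-- On 01 and 10, exchanging the bits undoes the complementation. This makes the parity classes the
case `k = 2` of the preceding argument. -/
lemma generates_cGate_two (h : Generates S notnotGate) : Generates S (cGate 2) := by
  have h1 : cGate 2 = notnotGate * bitPerm (swap 0 1) := by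
    refine Equiv.ext ?_
    decide
  rw [h1]
  exact h.comp (generates_bitPerm _)

/-! ### All gates -/

/-- Add bit `i` to bit `j`. -/
def cnotAt [DecidableEq ι] {i j : ι} (h : i ≠ j) : Perm (ι → ZMod 2) :=
  Function.Involutive.toPerm (fun z => Function.update z j (z j + z i)) (by
    intro z
    simp [Function.update_of_ne h, add_add_self])

@[simp] lemma cnotAt_apply [DecidableEq ι] {i j : ι} (h : i ≠ j) (z : ι → ZMod 2) :
    cnotAt h z = Function.update z j (z j + z i) := rfl

lemma genOn_cnotAt [Finite ι] [DecidableEq ι] (hS : GenOn S cnotGate) {i j : ι} (h : i ≠ j) :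
    GenOn S (cnotAt h) := by
  have hinj : Function.Injective (![i, j] : Fin 2 → ι) := by
    intro a b
    fin_cases a <;> fin_cases b <;> simp [h, h.symm]
  refine hS.place ⟨_, hinj⟩ (fun z k => ?_) (fun z l hl => ?_)
  · fin_cases k <;> simp [cnotGate, Function.Involutive.toPerm, h]
  · have h2 : l ≠ j := fun h => hl ⟨1, h.symm⟩
    simp [h2]

lemma genOn_cnot_of_toffoli (hS : GenOn S toffoliGate) : GenOn S cnotGate := by
  refine hS.ancilla ⟨Fin.succ, Fin.succ_injective 2⟩ 1 fun z hz => ?_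
  have h0 : z 0 = 1 := hz 0 (by simp)
  refine ⟨fun i => ?_, fun j hj => ?_⟩
  · fin_cases i <;> simp [toffoliGate, cnotGate, Function.Involutive.toPerm, h0]
  · obtain rfl : j = 0 := by
      by_contra h
      exact hj ⟨j.pred h, by simp⟩
    simpa [toffoliGate, Function.Involutive.toPerm] using h0

/-- The exchange of two bits by three CNOTs, with one common control added. -/
lemma generates_fredkin_of_toffoli (hS : Generates S toffoliGate) : Generates S fredkinGate := by
  have h1 : fredkinGate =
      toffoliGate * (bitPerm (swap 1 2) * toffoliGate * bitPerm (swap 1 2)) * toffoliGate := by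
    refine Equiv.ext ?_
    decide
  rw [h1]
  exact (hS.comp (((generates_bitPerm _).comp hS).comp (generates_bitPerm _))).comp hS

/-- This is NOT on bit `i` controlled by all other bits. NOT has no fixed string to use as an
ancilla register, so it is replaced by a CNOT whose control is the extra bit `none`: with that bit 0
in the register nothing moves, and in the end it is an ancilla held at 1. -/
lemma genOn_swap_update [Fintype ι] [DecidableEq ι] (hF : GenOn S fredkinGate)
    (hC : GenOn S cnotGate) (x : ι → ZMod 2) (i : ι) :
    GenOn S (swap x (Function.update x i (x i + 1))) := by
  have hne : (none : Option ι) ≠ some i := by simp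
  let T : Finset (Option ι) := (Finset.univ \ {i}).map Function.Embedding.some
  have hmem : ∀ t, some t ∈ T ↔ t ≠ i := by simp [T]
  have hT : ∀ t ∈ T, ∀ z, cnotAt hne z t = z t := by
    intro t ht z
    rw [cnotAt_apply, Function.update_of_ne]
    rintro rfl
    exact (hmem i).1 ht rfl
  have h1 := (genOn_cnotAt hC hne).controls hF 0 (fun o => o.elim 0 x) T hT (fun g hg => by
    have h2 : g none = 0 := hg none (by simp [T])
    rw [cnotAt_apply, h2, add_zero, Function.update_eq_self])
  refine h1.ancilla Function.Embedding.some 1 fun z hz => ?_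
  have h0 : z none = 1 := hz none (by simp)
  have hp : (∀ t ∈ T, z t = (t.elim 0 x : ZMod 2)) ↔ ∀ t, t ≠ i → z (some t) = x t := by
    constructor
    · intro h t ht
      exact h (some t) ((hmem t).2 ht)
    · rintro h (_ | t) ht
      · simp [T] at ht
      · exact h t ((hmem t).1 ht)
  rw [condPerm_apply]
  constructor
  · intro j
    change _ = swap x _ (fun i => z (some i)) j
    by_cases hz : ∀ t, t ≠ i → z (some t) = x t
    · rw [if_pos (hp.2 hz), cnotAt_apply, h0]
      by_cases hi : z (some i) = x i
      · have : (fun i => z (some i)) = x := by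
          funext t
          by_cases ht : t = i
          · rw [ht, hi]
          · exact hz t ht
        rw [this, swap_apply_left]
        by_cases hj : j = i
        · subst hj; simp [hi]
        · simp [hj, hz j hj]
      · have : (fun i => z (some i)) = Function.update x i (x i + 1) := by
          funext t
          by_cases ht : t = i
          · subst ht; simpa using zmod_two_eq_add_one.1 hi
          · simp [ht, hz t ht]
        rw [this, swap_apply_right]
        by_cases hj : j = i
        · subst hj; simp [zmod_two_eq_add_one.1 hi, add_add_self]
        · simp [hj, hz j hj]
    · rw [if_neg (fun h => hz (hp.1 h)), swap_apply_of_ne_of_ne]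
      · rfl
      · intro h; exact hz fun t _ => congrFun h t
      · intro h; refine hz fun t ht => ?_
        rw [congrFun h t, Function.update_of_ne ht]
  · intro j hj
    obtain rfl : j = none := by
      by_contra h
      obtain ⟨j, rfl⟩ := Option.ne_none_iff_exists'.1 h
      exact hj ⟨j, rfl⟩
    split_ifs
    · simpa using h0
    · exact h0

/-- All strings form one class, since `x` can be turned into `y` one bit at a time. -/
lemma generates_of_toffoli (hS : Generates S toffoliGate) {n : ℕ} (G : Gate n) :
    Generates S G := by
  have hF := genOn_fin.2 (generates_fredkin_of_toffoli hS)
  have hC := genOn_cnot_of_toffoli (genOn_fin.2 hS)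
  refine genOn_fin.1 (genOn_of_rel (r := fun _ _ => True) ⟨fun _ => trivial, fun _ => trivial,
    fun _ _ => trivial⟩ (fun x y _ => ?_) fun _ => trivial)
  have h1 : ∀ T : Finset (Fin n), GenOn S (swap x (T.piecewise y x)) := by
    intro T
    induction T using Finset.induction_on with
    | empty => rw [Finset.piecewise_empty]; exact equivalence_genOn_swap.refl x
    | insert i T hi ih =>
      refine equivalence_genOn_swap.trans ih ?_
      rw [Finset.piecewise_insert]
      by_cases h : y i = T.piecewise y x i
      · rw [h, Function.update_eq_self]; exact equivalence_genOn_swap.refl _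
      · rw [zmod_two_eq_add_one.1 h]
        exact genOn_swap_update hF hC _ i
  simpa using h1 Finset.univ

/-! ### Hamming weights -/

lemma hammingNorm_comp_equiv [Fintype ι] [Fintype κ] (e : κ ≃ ι) (x : ι → ZMod 2) :
    hammingNorm (fun k => x (e k)) = hammingNorm x := by
  rw [hammingNorm, hammingNorm]
  exact Finset.card_equiv e (by simp)

lemma hammingNorm_eq_sum [Fintype ι] (x : ι → ZMod 2) :
    hammingNorm x = ∑ i, (x i).val := by
  have h : ∀ b : ZMod 2, (if b ≠ 0 then 1 else 0) = b.val := by decide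
  rw [hammingNorm, Finset.card_filter]
  exact Finset.sum_congr rfl fun i _ => h _

lemma hammingNorm_snoc {n : ℕ} (x : Bits n) (b : ZMod 2) :
    hammingNorm (Fin.snoc x b : Bits (n + 1)) = hammingNorm x + b.val := by
  simp [hammingNorm_eq_sum, Fin.sum_univ_castSucc]

lemma hammingNorm_append {n m : ℕ} (x : Bits n) (a : Bits m) :
    hammingNorm (Fin.append x a) = hammingNorm x + hammingNorm a := by
  simp [hammingNorm_eq_sum, Fin.sum_univ_add]

lemma natCast_hammingNorm [Fintype ι] (x : ι → ZMod 2) :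
    (hammingNorm x : ZMod 2) = ∑ i, x i := by
  rw [hammingNorm_eq_sum, Nat.cast_sum]
  exact Finset.sum_congr rfl fun i _ => ZMod.natCast_rightInverse (x i)

lemma hammingNorm_modEq_two_iff [Fintype ι] [Fintype κ] (x : ι → ZMod 2) (y : κ → ZMod 2) :
    hammingNorm x ≡ hammingNorm y [MOD 2] ↔ ∑ i, x i = ∑ i, y i := by
  rw [← natCast_hammingNorm, ← natCast_hammingNorm, ZMod.natCast_eq_natCast_iff]

/-- If the gates in `S` change the weight modulo `k` by constants in `J`, so do the gates that `S`
generates. -/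
lemma Generates.hammingNorm_modEq {k : ℕ} (J : AddSubmonoid ℕ)
    (hS : ∀ F ∈ S, ∃ j ∈ J, ∀ x, hammingNorm (F.2 x) ≡ hammingNorm x + j [MOD k]) {n : ℕ}
    {G : Gate n} (h : Generates S G) :
    ∃ j ∈ J, ∀ x, hammingNorm (G x) ≡ hammingNorm x + j [MOD k] := by
  induction h with
  | base h => exact hS _ h
  | ident n => exact ⟨0, J.zero_mem, fun x => Nat.ModEq.refl _⟩
  | comp _ _ h1 h2 =>
    obtain ⟨i, hi, hi'⟩ := h1
    obtain ⟨j, hj, hj'⟩ := h2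
    refine ⟨j + i, J.add_mem hj hi, fun x => (hi' _).trans ?_⟩
    rw [← add_assoc]
    exact (hj' x).add_right _
  | swapping _ σ τ h h1 =>
    obtain ⟨j, hj, hj'⟩ := h1
    refine ⟨j, hj, fun x => ?_⟩
    rw [h x, hammingNorm_comp_equiv σ]
    refine (hj' _).trans ?_
    rw [hammingNorm_comp_equiv τ x]
  | @extension n F G _ h h1 =>
    obtain ⟨j, hj, hj'⟩ := h1
    refine ⟨j, hj, fun x => ?_⟩
    obtain ⟨y, b, rfl⟩ : ∃ (y : Bits n) (b : ZMod 2), x = Fin.snoc y b :=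
      ⟨_, _, (Fin.snoc_init_self x).symm⟩
    rw [h, hammingNorm_snoc, hammingNorm_snoc, add_right_comm]
    exact (hj' y).add_right _
  | ancilla a _ h h1 =>
    obtain ⟨j, hj, hj'⟩ := h1
    refine ⟨j, hj, fun x => ?_⟩
    have := hj' (Fin.append x a)
    rw [h, hammingNorm_append, hammingNorm_append, add_right_comm] at this
    exact Nat.ModEq.add_right_cancel' _ this

lemma Generates.hammingNorm_modEq_self {k : ℕ}
    (hS : ∀ F ∈ S, ∀ x, hammingNorm (F.2 x) ≡ hammingNorm x [MOD k]) {n : ℕ}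
    {G : Gate n} (h : Generates S G) (x : Bits n) :
    hammingNorm (G x) ≡ hammingNorm x [MOD k] := by
  obtain ⟨j, hj, hj'⟩ := h.hammingNorm_modEq ⊥
    (fun F hF => ⟨0, rfl, fun x => hS F hF x⟩)
  obtain rfl : j = 0 := hj
  exact hj' x

lemma hammingNorm_fredkinGate (x : Bits 3) : hammingNorm (fredkinGate x) = hammingNorm x := by
  revert x; decide

lemma hammingNorm_notGate (x : Bits 1) : hammingNorm (notGate x) ≡ hammingNorm x + 1 [MOD 2] := by
  revert x; decide

lemma hammingNorm_notnotGate (x : Bits 2) :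
    hammingNorm (notnotGate x) ≡ hammingNorm x [MOD 2] := by
  revert x; decide

lemma hammingNorm_cGate (k : ℕ) (x : Bits k) :
    hammingNorm (cGate k x) ≡ hammingNorm x [MOD k] := by
  have h1 : hammingNorm (1 : Bits k) = k := by simp [hammingNorm]
  rw [cGate, swap_apply_def]
  split_ifs with h h'
  · rw [h1, h, hammingNorm_zero]; simp [Nat.ModEq]
  · rw [h', h1, hammingNorm_zero]; simp [Nat.ModEq]
  · rfl

/-! ### Translations -/

lemma vec_add_self (b : ι → ZMod 2) : b + b = 0 := funext fun i => CharTwo.add_self_eq_zero (b i)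

lemma translate_mul (b c : ι → ZMod 2) :
    (Equiv.addRight b * Equiv.addRight c : Perm (ι → ZMod 2)) = Equiv.addRight (b + c) := by
  ext x k
  simp [add_assoc, add_comm (b k)]

/-- The vectors such that `S` generates the translations by them. -/
def translationGroup (S : Set AnyGate) (ι : Type*) [Finite ι] : AddSubgroup (ι → ZMod 2) where
  carrier := {b | GenOn S (Equiv.addRight b)}
  add_mem' := fun {b c} hb hc => by
    have := GenOn.mul hb hc
    rwa [translate_mul] at this
  zero_mem' := by
    have : (Equiv.addRight (0 : ι → ZMod 2)) = 1 := by ext; simp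
    rw [Set.mem_ofPred_eq, this]; exact GenOn.one
  neg_mem' := fun {b} hb => by
    have : -b = b := funext fun i => ZMod.neg_eq_self_mod_two _
    rwa [this]

lemma mem_translationGroup [Finite ι] {b : ι → ZMod 2} :
    b ∈ translationGroup S ι ↔ GenOn S (Equiv.addRight b) := Iff.rfl

lemma genOn_translate_single [Finite ι] [DecidableEq ι] (h : GenOn S notGate) (i : ι) :
    GenOn S (Equiv.addRight (Pi.single i 1 : ι → ZMod 2)) := by
  refine h.place ⟨fun _ => i, fun _ _ _ => Subsingleton.elim _ _⟩ (fun x j => ?_) (fun x j hj => ?_)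
  · simp only [notGate, Equiv.coe_addRight, Pi.add_apply, Pi.one_apply, add_right_inj]
    exact Pi.single_eq_same i 1
  · have : j ≠ i := fun h => hj ⟨0, h.symm⟩
    simp [this]

lemma genOn_translate [Fintype ι] (h : GenOn S notGate) (b : ι → ZMod 2) :
    GenOn S (Equiv.addRight b) := by
  classical
  rw [← mem_translationGroup, ← Finset.univ_sum_single b]
  refine sum_mem fun i _ => ?_
  rcases zmod_two_cases (b i) with hb | hb
  · rw [hb, Pi.single_zero]; exact zero_mem _
  · rw [hb]; exact genOn_translate_single h i

lemma genOn_translate_pair [Finite ι] [DecidableEq ι] (h : GenOn S notnotGate) {i j : ι}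
    (hij : i ≠ j) : GenOn S (Equiv.addRight (Pi.single i 1 + Pi.single j 1 : ι → ZMod 2)) := by
  have hinj : Function.Injective (![i, j] : Fin 2 → ι) := by
    intro a b
    fin_cases a <;> fin_cases b <;> simp [hij, hij.symm]
  refine h.place ⟨_, hinj⟩ (fun x k => ?_) (fun x l hl => ?_)
  · fin_cases k <;> simp [notnotGate, hij, hij.symm]
  · have h1 : l ≠ i := fun h => hl ⟨0, h.symm⟩
    have h2 : l ≠ j := fun h => hl ⟨1, h.symm⟩
    simp [h1, h2]

/-- Each 1 of `b` is paired with a fixed position `o`; the contributions at `o` add up to the sum of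
`b`, which is 0. -/
lemma genOn_translate_of_sum_eq_zero [Fintype ι] (h : GenOn S notnotGate) (b : ι → ZMod 2)
    (hb : ∑ i, b i = 0) : GenOn S (Equiv.addRight b) := by
  classical
  rcases isEmpty_or_nonempty ι with hι | ⟨⟨o⟩⟩
  · rw [Subsingleton.elim b 0]; exact zero_mem (translationGroup S ι)
  have h1 : b = ∑ i, (Pi.single i (b i) + Pi.single o (b i)) := by
    rw [Finset.sum_add_distrib, Finset.univ_sum_single]
    have : ∑ i, (Pi.single o (b i) : ι → ZMod 2) = Pi.single o (∑ i, b i) :=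
      (map_sum (AddMonoidHom.single (fun _ : ι => ZMod 2) o) b Finset.univ).symm
    rw [this, hb, Pi.single_zero, add_zero]
  rw [← mem_translationGroup, h1]
  refine sum_mem fun i _ => ?_
  rcases zmod_two_cases (b i) with hb | hb
  · rw [hb, Pi.single_zero, Pi.single_zero, add_zero]; exact zero_mem _
  · rw [hb]
    by_cases hio : i = o
    · have : (Pi.single i 1 + Pi.single o 1 : ι → ZMod 2) = 0 := by
        rw [hio]; exact vec_add_self _
      rw [this]; exact zero_mem _
    · exact genOn_translate_pair h hio

lemma generates_notnot_of_not (h : Generates S notGate) : Generates S notnotGate :=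
  genOn_fin.1 (genOn_translate (genOn_fin.2 h) 1)

/-! ### The non-affine classes -/

lemma gateClass_toffoli (n : ℕ) : gateClass {Toffoli} n = Set.univ :=
  Set.eq_univ_of_forall fun G => generates_of_toffoli (.base (Set.mem_singleton _)) G

lemma generates_of_modEq {k : ℕ} (hk : 2 ≤ k) (hF : Generates S fredkinGate)
    (hC : Generates S (cGate k)) {n : ℕ} {G : Gate n}
    (hG : ∀ x, hammingNorm (G x) ≡ hammingNorm x [MOD k]) : Generates S G :=
  genOn_fin.1 (genOn_of_rel (r := fun x y => hammingNorm x ≡ hammingNorm y [MOD k])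
    ⟨fun _ => rfl, fun h => h.symm, fun h h' => h.trans h'⟩
    (fun _ _ h => genOn_swap_of_modEq hk (genOn_fin.2 hF) (genOn_fin.2 hC) h)
    fun x => (hG x).symm)

lemma gateClass_C {k : ℕ} (hk : 3 ≤ k) (n : ℕ) : gateClass {C k} n =
    {G | ∀ x, hammingNorm (G x) ≡ hammingNorm x [MOD k]} := by
  have hC : Generates {C k} (cGate k) := .base rfl
  ext G
  refine ⟨fun h => h.hammingNorm_modEq_self ?_, fun h => generates_of_modEq (by omega)
    (genOn_fin.1 (genOn_fredkin_of_cGate hk (genOn_fin.2 hC))) hC h⟩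
  rintro F rfl
  exact hammingNorm_cGate k

lemma gateClass_fredkin (n : ℕ) : gateClass {Fredkin} n =
    {G | ∀ x, hammingNorm (G x) = hammingNorm x} := by
  ext G
  -- Congruence modulo 0 is equality, so conservation of the exact weight is an instance of the
  -- modular invariant.
  refine ⟨fun h x => Nat.modEq_zero_iff.1 (h.hammingNorm_modEq_self (k := 0) ?_ x), fun h => ?_⟩
  · rintro F rfl x
    exact Nat.modEq_zero_iff.2 (hammingNorm_fredkinGate x)
  · exact genOn_fin.1 (genOn_of_rel (r := fun x y => hammingNorm x = hammingNorm y)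
      ⟨fun _ => rfl, fun h => h.symm, fun h h' => h.trans h'⟩
      (fun _ _ h => genOn_swap_of_hammingNorm_eq (genOn_fin.2 (.base (Set.mem_singleton _))) h)
      fun x => (h x).symm)

lemma gateClass_fredkin_notnot (n : ℕ) : gateClass {Fredkin, NOTNOT} n =
    {G | IsParityPreserving G} := by
  ext G
  refine ⟨fun h => h.hammingNorm_modEq_self ?_, fun h => generates_of_modEq le_rfl
    (.base (Or.inl rfl)) (generates_cGate_two (.base (Or.inr rfl))) h⟩
  rintro F (rfl | rfl) x
  · exact congrArg (· % 2) (hammingNorm_fredkinGate x)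
  · exact hammingNorm_notnotGate x

/-- Flip bit `i`. -/
def flipAt [DecidableEq ι] (i : ι) : Perm (ι → ZMod 2) := Equiv.addRight (Pi.single i 1)

lemma hammingNorm_flipAt [Fintype ι] [DecidableEq ι] (i : ι) (x : ι → ZMod 2) :
    hammingNorm (flipAt i x) ≡ hammingNorm x + 1 [MOD 2] := by
  rw [← ZMod.natCast_eq_natCast_iff, Nat.cast_add, natCast_hammingNorm, natCast_hammingNorm]
  simp [flipAt, Finset.sum_add_distrib]

lemma flipAt_mul_flipAt [DecidableEq ι] (i : ι) : flipAt i * flipAt i = 1 := by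
  rw [flipAt, translate_mul, vec_add_self]
  ext; simp

lemma isParityRespecting_iff {n : ℕ} (i : Fin n) (G : Gate n) :
    IsParityRespecting G ↔ IsParityPreserving G ∨ IsParityPreserving (flipAt i * G) := by
  constructor
  · rintro ⟨j, hj⟩
    rcases Nat.even_or_odd' j with ⟨c, rfl | rfl⟩
    · exact Or.inl fun x => (hj x).trans (by simp [Nat.ModEq])
    · refine Or.inr fun x => (hammingNorm_flipAt i _).trans (((hj x).add_right 1).trans ?_)
      unfold Nat.ModEq
      omega
  · rintro (h | h)
    · exact ⟨0, h⟩
    · refine ⟨1, fun x => ?_⟩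
      have h1 := (hammingNorm_flipAt i (G x)).symm.trans (h x)
      have h2 := h1.add_right 1
      refine Nat.ModEq.trans ?_ h2
      unfold Nat.ModEq
      omega

lemma not_isParityPreserving_flipAt_mul {n : ℕ} (i : Fin n) {G : Gate n}
    (h : IsParityPreserving G) : ¬ IsParityPreserving (flipAt i * G) := by
  intro h'
  have h1 := (hammingNorm_flipAt i (G 0)).symm.trans (h' 0)
  have h2 := h 0
  rw [hammingNorm_zero] at h1 h2
  have h3 := (h2.add_right 1).symm.trans h1
  exact absurd h3 (by decide)

/-- Composing with a flip of bit `i` interchanges the gates that preserve parity with those that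
reverse it, and the two kinds are disjoint. -/
lemma ncard_isParityRespecting {n : ℕ} (i : Fin n) (Q : Gate n → Prop)
    (hQ : ∀ G, Q G → Q (flipAt i * G)) :
    {G : Gate n | Q G ∧ IsParityRespecting G}.ncard =
      2 * {G : Gate n | Q G ∧ IsParityPreserving G}.ncard := by
  have h1 : {G : Gate n | Q G ∧ IsParityRespecting G} = {G | Q G ∧ IsParityPreserving G} ∪
      (fun G => flipAt i * G) '' {G | Q G ∧ IsParityPreserving G} := by
    ext G
    simp only [Set.mem_ofPred_eq, Set.mem_union, Set.mem_image, isParityRespecting_iff i]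
    constructor
    · rintro ⟨h, h1 | h1⟩
      · exact Or.inl ⟨h, h1⟩
      · refine Or.inr ⟨_, ⟨hQ _ h, h1⟩, ?_⟩
        rw [← mul_assoc, flipAt_mul_flipAt, one_mul]
    · rintro (⟨h, h1⟩ | ⟨G, ⟨h, h1⟩, rfl⟩)
      · exact ⟨h, Or.inl h1⟩
      · refine ⟨hQ _ h, Or.inr ?_⟩
        rwa [← mul_assoc, flipAt_mul_flipAt, one_mul]
  rw [h1, Set.ncard_union_eq, Set.ncard_image_of_injective _ (mul_right_injective _), two_mul]
  rw [Set.disjoint_left]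
  rintro _ ⟨-, h⟩ ⟨G, ⟨-, h'⟩, rfl⟩
  exact not_isParityPreserving_flipAt_mul i h' h

lemma generates_of_isParityRespecting (hN : Generates S notGate) {n : ℕ}
    (Q : Gate n → Prop) (hQ : ∀ G i, Q G → Q (flipAt i * G))
    (hS : ∀ G : Gate n, Q G → IsParityPreserving G → Generates S G) {G : Gate n} (hG : Q G)
    (h : IsParityRespecting G) : Generates S G := by
  rcases isEmpty_or_nonempty (Fin n) with hn | ⟨⟨i⟩⟩
  · rw [Subsingleton.elim G 1]; exact .ident n
  · rcases (isParityRespecting_iff i G).1 h with h | h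
    · exact hS G hG h
    · have h1 : G = flipAt i * (flipAt i * G) := by
        rw [← mul_assoc, flipAt_mul_flipAt, one_mul]
      rw [h1]
      exact (genOn_fin.1 (genOn_translate_single (genOn_fin.2 hN) i)).comp (hS _ (hQ _ _ hG) h)

lemma gateClass_fredkin_not (n : ℕ) : gateClass {Fredkin, NOT} n =
    {G | IsParityRespecting G} := by
  ext G
  have hN : Generates {Fredkin, NOT} notGate := .base (Or.inr rfl)
  refine ⟨fun h => ?_, fun h => generates_of_isParityRespecting hN (fun _ => True)
    (fun _ _ => id) (fun G _ hG => generates_of_modEq le_rfl (.base (Or.inl rfl))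
      (generates_cGate_two (generates_notnot_of_not hN)) hG) trivial h⟩
  obtain ⟨j, -, hj⟩ := h.hammingNorm_modEq (k := 2) ⊤ (by
    rintro F (rfl | rfl)
    · exact ⟨0, trivial, fun x => congrArg (· % 2) (hammingNorm_fredkinGate x)⟩
    · exact ⟨1, trivial, hammingNorm_notGate⟩)
  exact ⟨j, hj⟩

/-! ### Counting -/

lemma ncard_preserving {α : Type*} [Fintype α] [DecidableEq α] (w : α → ℕ) (K : ℕ)
    (hw : ∀ x, w x < K) : {G : Perm α | ∀ x, w (G x) = w x}.ncard =
      ∏ i ∈ Finset.range K, ((Finset.univ.filter (fun x => w x = i)).card)! := by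
  -- The permutations preserving `w` are the stabilizer of `w` as a function on the strings: a
  -- product of symmetric groups of its fibres.
  have h := DomMulAct.stabilizer_card (fun x => (⟨w x, hw x⟩ : Fin K))
  rw [Finset.prod_range (fun i => ((Finset.univ.filter (fun x => w x = i)).card)!)]
  rw [← Nat.card_coe_set_eq, ← Nat.card_eq_fintype_card] at *
  refine Eq.trans (Nat.card_congr (Equiv.subtypeEquivRight fun G => ?_)) (h.trans ?_)
  · constructor
    · intro h
      funext x
      exact Fin.ext (h x)
    · intro h x
      exact congrArg Fin.val (congrFun h x)
  · refine Finset.prod_congr rfl fun i _ => ?_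
    rw [Fintype.card_subtype]
    simp [Fin.ext_iff]

lemma card_hammingNorm_eq (n j : ℕ) :
    (Finset.univ.filter (fun x : Bits n => hammingNorm x = j)).card = n.choose j := by
  have h : (Finset.powersetCard j (Finset.univ : Finset (Fin n))).card = n.choose j := by simp
  rw [← h]
  refine Finset.card_nbij' (fun x => Finset.univ.filter (fun i => x i ≠ 0))
    (fun T i => if i ∈ T then 1 else 0) ?_ ?_ ?_ ?_
  · intro x hx
    simpa [Finset.mem_powersetCard, hammingNorm] using hx
  · intro T hT
    simpa [hammingNorm] using hT
  · intro x _
    funext i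
    rcases zmod_two_cases (x i) with h | h <;> simp [h]
  · intro T _
    ext i
    simp

lemma card_hammingNorm_modEq (n k i : ℕ) :
    (Finset.univ.filter (fun x : Bits n => hammingNorm x ≡ i [MOD k])).card =
      ∑ j ∈ (Finset.range (n + 1)).filter (fun j => j ≡ i [MOD k]), n.choose j := by
  rw [Finset.card_eq_sum_card_fiberwise (f := fun x : Bits n => hammingNorm x)
    (t := (Finset.range (n + 1)).filter (fun j => j ≡ i [MOD k]))]
  · refine Finset.sum_congr rfl fun j hj => ?_
    rw [← card_hammingNorm_eq, Finset.filter_filter]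
    congr 1
    ext x
    simp only [Finset.mem_filter, Finset.mem_univ, true_and, and_iff_right_iff_imp]
    rintro rfl
    exact (Finset.mem_filter.1 hj).2
  · intro x hx
    have h1 : hammingNorm x ≤ n := by simpa using hammingNorm_le_card_fintype (x := x)
    have h2 : hammingNorm x ≡ i [MOD k] := by simpa using hx
    simp only [Finset.coe_filter, Finset.mem_range, Set.mem_ofPred_eq]
    exact ⟨by omega, h2⟩

lemma card_sum_eq (n : ℕ) (c : ZMod 2) :
    (Finset.univ.filter (fun x : Bits (n + 1) => ∑ i, x i = c)).card = 2 ^ n := by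
  have h1 : ∀ c : ZMod 2, (Finset.univ.filter (fun x : Bits (n + 1) => ∑ i, x i = c)).card =
      (Finset.univ.filter (fun x : Bits (n + 1) => ∑ i, x i = c + 1)).card := by
    intro c
    refine Finset.card_equiv (flipAt 0) fun x => ?_
    simp [flipAt, Finset.sum_add_distrib]
  have h2 := Finset.card_eq_sum_card_fiberwise (f := fun x : Bits (n + 1) => ∑ i, x i)
    (s := Finset.univ) (t := Finset.univ) (fun _ _ => Finset.mem_coe.2 (Finset.mem_univ _))
  have h3 : (Finset.univ : Finset (ZMod 2)) = {c, c + 1} := by revert c; decide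
  have h4 : c ≠ c + 1 := by revert c; decide
  rw [h3, Finset.sum_pair h4, ← h1 c] at h2
  simp only [Finset.card_univ, Fintype.card_fun, ZMod.card, Fintype.card_fin] at h2
  rw [pow_succ] at h2
  omega

lemma count_toffoli (n : ℕ) : count {Toffoli} n = (2 ^ n)! := by
  rw [count, gateClass_toffoli, Set.ncard_univ, Nat.card_eq_fintype_card, Fintype.card_perm]
  simp

lemma count_C {k : ℕ} (hk : 3 ≤ k) (n : ℕ) : count {C k} n = ∏ i ∈ Finset.range k,
    (∑ j ∈ (Finset.range (n + 1)).filter (fun j => j ≡ i [MOD k]), n.choose j)! := by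
  rw [count, gateClass_C hk]
  refine (ncard_preserving (fun x : Bits n => hammingNorm x % k) k
    (fun x => Nat.mod_lt _ (by omega))).trans (Finset.prod_congr rfl fun i hi => ?_)
  rw [← card_hammingNorm_modEq]
  simp only [Nat.ModEq, Nat.mod_eq_of_lt (Finset.mem_range.1 hi)]

lemma count_fredkin (n : ℕ) :
    count {Fredkin} n = ∏ i ∈ Finset.range (n + 1), (n.choose i)! := by
  rw [count, gateClass_fredkin]
  refine (ncard_preserving (fun x : Bits n => hammingNorm x) (n + 1) (fun x => ?_)).trans ?_
  · have : hammingNorm x ≤ n := by simpa using hammingNorm_le_card_fintype (x := x)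
    omega
  · simp only [card_hammingNorm_eq]

lemma ncard_isParityPreserving {n : ℕ} (hn : 1 ≤ n) :
    {G : Gate n | IsParityPreserving G}.ncard = ((2 ^ (n - 1))!) ^ 2 := by
  obtain ⟨n, rfl⟩ := Nat.exists_eq_add_of_le' hn
  refine (ncard_preserving (fun x : Bits (n + 1) => hammingNorm x % 2) 2
    (fun x => Nat.mod_lt _ (by omega))).trans ?_
  have h : ∀ i < 2, (Finset.univ.filter (fun x : Bits (n + 1) => hammingNorm x % 2 = i)).card =
      2 ^ n := by
    intro i hi
    rw [← card_sum_eq n (i : ZMod 2)]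
    congr 1
    ext x
    simp only [Finset.mem_filter, Finset.mem_univ, true_and]
    rw [← natCast_hammingNorm, ZMod.natCast_eq_natCast_iff, Nat.ModEq, Nat.mod_eq_of_lt hi]
  rw [Finset.prod_range_succ, Finset.prod_range_one, h 0 (by omega), h 1 (by omega)]
  simp [sq]

lemma count_fredkin_notnot {n : ℕ} (hn : 1 ≤ n) :
    count {Fredkin, NOTNOT} n = ((2 ^ (n - 1))!) ^ 2 := by
  rw [count, gateClass_fredkin_notnot, ncard_isParityPreserving hn]

lemma count_fredkin_not {n : ℕ} (hn : 1 ≤ n) :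
    count {Fredkin, NOT} n = 2 * ((2 ^ (n - 1))!) ^ 2 := by
  have := ncard_isParityRespecting (⟨0, hn⟩ : Fin n) (fun _ => True) (fun _ => id)
  simp only [true_and] at this
  rw [count, gateClass_fredkin_not, this, ncard_isParityPreserving hn]

/-! ### Affine and linear gates -/

/-- Affine maps over the two-element field, without coordinates. -/
def PreservesAffine (G : (ι → ZMod 2) → (κ → ZMod 2)) : Prop :=
  ∀ x y z, G (x + y + z) = G x + G y + G z

lemma vec_add_add_self (a b : ι → ZMod 2) : a + b + b = a := by
  rw [add_assoc, vec_add_self, add_zero]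

lemma PreservesAffine.map_add_zero {G : (ι → ZMod 2) → (κ → ZMod 2)} (h : PreservesAffine G)
    (x y : ι → ZMod 2) : G (x + y) + G 0 = (G x + G 0) + (G y + G 0) := by
  have h1 := h x y 0
  rw [add_zero] at h1
  rw [h1, vec_add_add_self, add_add_add_comm, vec_add_self, add_zero]

/-- An additive bijection of bit strings is given by an invertible matrix. -/
lemma exists_matrix_of_additive {n : ℕ} (L : Bits n → Bits n) (hL : ∀ x y, L (x + y) = L x + L y)
    (hb : Function.Injective L) :
    ∃ A : Matrix (Fin n) (Fin n) (ZMod 2), IsUnit A ∧ ∀ x, L x = A.mulVec x := by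
  let f : Bits n →+ Bits n := AddMonoidHom.mk' L hL
  let g : Bits n →ₗ[ZMod 2] Bits n := f.toZModLinearMap 2
  have h1 : ∀ x, L x = (LinearMap.toMatrix' g).mulVec x := fun x => by
    rw [LinearMap.toMatrix'_mulVec]; rfl
  refine ⟨LinearMap.toMatrix' g, Matrix.mulVec_injective_iff_isUnit.1 fun x y hxy => hb ?_, h1⟩
  rw [h1, h1]; exact hxy

lemma isLinear_iff {n : ℕ} {G : Gate n} : IsLinear G ↔ ∀ x y, G (x + y) = G x + G y := by
  constructor
  · rintro ⟨A, -, h⟩ x y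
    simp [h, Matrix.mulVec_add]
  · intro h
    exact exists_matrix_of_additive G h G.injective

lemma isAffine_iff {n : ℕ} {G : Gate n} : IsAffine G ↔ PreservesAffine G := by
  constructor
  · rintro ⟨A, -, b, h⟩ x y z
    simp only [h, Matrix.mulVec_add]
    have h1 := vec_add_self b
    calc A.mulVec x + A.mulVec y + A.mulVec z + b
        = A.mulVec x + A.mulVec y + A.mulVec z + b + (b + b) := by rw [h1, add_zero]
      _ = _ := by abel
  · intro h
    obtain ⟨A, hA, h1⟩ := exists_matrix_of_additive (fun x => G x + G 0)
      (fun x y => h.map_add_zero x y) fun x y hxy => G.injective (add_right_cancel hxy)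
    exact ⟨A, hA, G 0, fun x => by rw [← h1, vec_add_add_self]⟩

lemma snoc_add_snoc {n : ℕ} (x y : Bits n) (a b : ZMod 2) :
    (Fin.snoc x a + Fin.snoc y b : Bits (n + 1)) = Fin.snoc (x + y) (a + b) := by
  ext i
  induction i using Fin.lastCases <;> simp

lemma append_add_append {n m : ℕ} (x y : Bits n) (a b : Bits m) :
    Fin.append x a + Fin.append y b = Fin.append (x + y) (a + b) := by
  ext i
  induction i using Fin.addCases <;> simp

lemma append_left_injective' {n m : ℕ} {x y : Bits n} {a b : Bits m}
    (h : Fin.append x a = Fin.append y b) : x = y ∧ a = b := by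
  constructor
  · funext i; simpa using congrFun h (Fin.castAdd m i)
  · funext i; simpa using congrFun h (Fin.natAdd n i)

/-- The sum of three terms suits the ancilla rule because `a + a + a = a`: all inputs involved carry
the same ancilla string. -/
lemma Generates.preservesAffine (hS : ∀ F ∈ S, PreservesAffine F.2) {n : ℕ} {G : Gate n}
    (h : Generates S G) : PreservesAffine G := by
  induction h with
  | base h => exact hS _ h
  | ident n => exact fun x y z => rfl
  | comp _ _ h1 h2 => intro x y z; rw [Perm.mul_apply, h2, h1]; rfl
  | swapping _ σ τ h h1 =>
    intro x y z
    rw [h, h, h, h]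
    funext i
    exact congrFun (h1 (fun j => x (τ j)) (fun j => y (τ j)) (fun j => z (τ j))) (σ i)
  | @extension n F G _ h h1 =>
    intro x y z
    obtain ⟨x, a, rfl⟩ : ∃ (y : Bits n) (b : ZMod 2), x = Fin.snoc y b :=
      ⟨_, _, (Fin.snoc_init_self x).symm⟩
    obtain ⟨y, b, rfl⟩ : ∃ (x : Bits n) (b : ZMod 2), y = Fin.snoc x b :=
      ⟨_, _, (Fin.snoc_init_self y).symm⟩
    obtain ⟨z, c, rfl⟩ : ∃ (y : Bits n) (b : ZMod 2), z = Fin.snoc y b :=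
      ⟨_, _, (Fin.snoc_init_self z).symm⟩
    rw [snoc_add_snoc, snoc_add_snoc, h, h, h, h, h1, snoc_add_snoc, snoc_add_snoc]
  | ancilla a _ h h1 =>
    intro x y z
    have h2 := h1 (Fin.append x a) (Fin.append y a) (Fin.append z a)
    rw [append_add_append, append_add_append, vec_add_self, zero_add, h, h, h, h,
      append_add_append, append_add_append] at h2
    exact (append_left_injective' h2).1

/-- Gaussian elimination: an invertible matrix is a product of transvections, which are CNOT gates,
and of an invertible diagonal matrix. The latter is the identity, because 1 is the only nonzero
scalar. -/
lemma affine_induction {n : ℕ} {P : Gate n → Prop} (one : P 1)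
    (mul : ∀ F G, P F → P G → P (F * G)) (cnot : ∀ (i j : Fin n) (h : i ≠ j), P (cnotAt h))
    (flip : ∀ i, P (flipAt i)) {G : Gate n} (hG : IsAffine G) : P G := by
  obtain ⟨A, hA, b, h⟩ := hG
  have hdet : ∀ A : Matrix (Fin n) (Fin n) (ZMod 2), A.det ≠ 0 → Function.Bijective A.mulVec := by
    intro A hA
    refine Finite.injective_iff_bijective.1 (Matrix.mulVec_injective_iff_isUnit.2 ?_)
    rw [Matrix.isUnit_iff_isUnit_det]
    exact hA.isUnit
  have hlin : ∀ G : Gate n, (∀ x, G x = A.mulVec x) → P G := by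
    refine Matrix.diagonal_transvection_induction_of_det_ne_zero
      (fun A => ∀ G : Gate n, (∀ x, G x = A.mulVec x) → P G) A ?_ ?_ ?_ ?_
    · rw [Matrix.isUnit_iff_isUnit_det] at hA
      exact hA.ne_zero
    · intro D hD G hG
      have h1 : G = 1 := by
        ext x i
        rw [hG, Matrix.mulVec_diagonal]
        have : D i ≠ 0 := by
          rw [Matrix.det_diagonal] at hD
          exact Finset.prod_ne_zero_iff.1 hD i (Finset.mem_univ i)
        rw [(zmod_two_cases (D i)).resolve_left this]
        simp
      rw [h1]; exact one
    · rintro ⟨i, j, hij, c⟩ G hG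
      have hval : ∀ x k, G x k = x k + (Pi.single i (c * x j) : Bits n) k := by
        intro x k
        rw [hG]
        change (Matrix.transvection i j c).mulVec x k = _
        rw [Matrix.transvection, Matrix.add_mulVec, Matrix.one_mulVec, Matrix.single_mulVec]
        simp [Pi.single]
      rcases zmod_two_cases c with rfl | rfl
      · have h1 : G = 1 := by
          ext x k
          rw [hval]; simp
        rw [h1]; exact one
      · convert cnot j i hij.symm
        ext x k
        rw [hval, cnotAt_apply]
        by_cases hk : k = i
        · subst hk; simp
        · simp [hk]
    · intro A B hA hB h1 h2 G hG
      have h3 : G = Equiv.ofBijective _ (hdet A hA) * Equiv.ofBijective _ (hdet B hB) := by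
        ext x k
        simp [hG, Matrix.mulVec_mulVec]
      rw [h3]
      exact mul _ _ (h1 _ fun x => rfl) (h2 _ fun x => rfl)
  have htr : ∀ b : Bits n, P (Equiv.addRight b) := by
    intro b
    rw [← Finset.univ_sum_single b]
    refine Finset.sum_induction _ (fun b => P (Equiv.addRight b)) ?_ ?_ fun i _ => ?_
    · intro b c hb hc
      rw [← translate_mul]; exact mul _ _ hb hc
    · convert one; ext; simp
    · rcases zmod_two_cases (b i) with hb | hb
      · rw [hb, Pi.single_zero]; convert one; ext; simp
      · rw [hb]; exact flip i
  have hA' : A.det ≠ 0 := by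
    rw [Matrix.isUnit_iff_isUnit_det] at hA
    exact hA.ne_zero
  have h1 : G = Equiv.addRight b * Equiv.ofBijective _ (hdet A hA') := by
    ext x k
    simp [h]
  rw [h1]
  exact mul _ _ (htr b) (hlin _ fun x => rfl)

lemma genOn_not_of_cnot (hS : GenOn S cnotGate) : GenOn S notGate := by
  refine hS.ancilla ⟨Fin.succ, Fin.succ_injective 1⟩ 1 fun z hz => ?_
  have h0 : z 0 = 1 := hz 0 (by simp)
  refine ⟨fun i => ?_, fun j hj => ?_⟩
  · fin_cases i; simp [notGate, cnotGate, Function.Involutive.toPerm, h0]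
  · obtain rfl : j = 0 := by
      by_contra h
      exact hj ⟨j.pred h, by simp⟩
    simpa [cnotGate, Function.Involutive.toPerm] using h0

lemma genOn_notnot_of_cnotnot (hS : GenOn S cnotnotGate) : GenOn S notnotGate := by
  refine hS.ancilla ⟨Fin.succ, Fin.succ_injective 2⟩ 1 fun z hz => ?_
  have h0 : z 0 = 1 := hz 0 (by simp)
  refine ⟨fun i => ?_, fun j hj => ?_⟩
  · fin_cases i <;> simp [notnotGate, cnotnotGate, Function.Involutive.toPerm, h0]
  · obtain rfl : j = 0 := by
      by_contra h
      exact hj ⟨j.pred h, by simp⟩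
    simpa [cnotnotGate, Function.Involutive.toPerm] using h0

lemma gateClass_cnot (n : ℕ) : gateClass {CNOT} n = {G | IsAffine G} := by
  have hC : GenOn {CNOT} cnotGate := genOn_fin.2 (.base (Set.mem_singleton _))
  ext G
  refine ⟨fun h => isAffine_iff.2 (h.preservesAffine ?_), fun h => affine_induction (.ident n)
    (fun _ _ => .comp) (fun _ _ h => genOn_fin.1 (genOn_cnotAt hC h))
    (fun i => genOn_fin.1 (genOn_translate_single (genOn_not_of_cnot hC) i)) h⟩
  rintro F rfl
  change PreservesAffine cnotGate
  intro x y z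
  ext i
  fin_cases i
  · rfl
  · simp [cnotGate, Function.Involutive.toPerm]
    ring

/-! ### Parity-preserving affine gates -/

/-- The gate `G` together with one more bit that keeps the parity of the whole string. -/
def parityLift [Fintype ι] (G : Perm (ι → ZMod 2)) : Perm (Option ι → ZMod 2) where
  toFun z o := o.elim (z none + ∑ i, z (some i) + ∑ i, G (fun i => z (some i)) i)
    (G fun i => z (some i))
  invFun z o := o.elim (z none + ∑ i, z (some i) + ∑ i, G.symm (fun i => z (some i)) i)
    (G.symm fun i => z (some i))
  left_inv z := by
    funext o
    rcases o with _ | i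
    · simp [add_add_self]
    · simp
  right_inv z := by
    funext o
    rcases o with _ | i
    · have key : ∀ a b c : ZMod 2, a + b + c + c + b = a := by decide
      simpa using key _ _ _
    · simp

@[simp] lemma parityLift_none [Fintype ι] (G : Perm (ι → ZMod 2)) (z : Option ι → ZMod 2) :
    parityLift G z none = z none + ∑ i, z (some i) + ∑ i, G (fun i => z (some i)) i := rfl

@[simp] lemma parityLift_some [Fintype ι] (G : Perm (ι → ZMod 2)) (z : Option ι → ZMod 2)
    (i : ι) : parityLift G z (some i) = G (fun i => z (some i)) i := rfl

/-- Multiplicativity lets a factorization into gates that do not preserve parity be lifted factor by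
factor. -/
lemma parityLift_mul [Fintype ι] (F G : Perm (ι → ZMod 2)) :
    parityLift (F * G) = parityLift F * parityLift G := by
  ext z o
  rcases o with _ | i
  · simp [add_add_self]
  · simp

lemma parityLift_one [Fintype ι] : parityLift (1 : Perm (ι → ZMod 2)) = 1 := by
  ext z o
  rcases o with _ | i
  · simp [add_add_self]
  · simp

/-- For `G` preserving parity the extra bit never changes, so it is a legitimate ancilla. -/
lemma genOn_of_parityLift [Fintype ι] {G : Perm (ι → ZMod 2)} (h : GenOn S (parityLift G))
    (hG : ∀ x, ∑ i, G x i = ∑ i, x i) : GenOn S G := by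
  refine h.ancilla Function.Embedding.some 0 fun z hz => ⟨fun i => rfl, fun j hj => ?_⟩
  obtain rfl : j = none := by
    by_contra h
    obtain ⟨j, rfl⟩ := Option.ne_none_iff_exists'.1 h
    exact hj ⟨j, rfl⟩
  rw [parityLift_none, hG, add_add_self, hz none hj]

lemma genOn_parityLift_cnotAt [Fintype ι] [DecidableEq ι] (hS : GenOn S cnotnotGate) {i j : ι}
    (h : i ≠ j) : GenOn S (parityLift (cnotAt h)) := by
  have hinj : Function.Injective (![some i, some j, none] : Fin 3 → Option ι) := by
    intro a b
    fin_cases a <;> fin_cases b <;> simp [h, h.symm]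
  have hsum : ∀ z : ι → ZMod 2, ∑ k, Function.update z j (z j + z i) k = ∑ k, z k + z i := by
    intro z
    have : Function.update z j (z j + z i) = z + Pi.single j (z i) := by
      funext k
      by_cases hk : k = j
      · subst hk; simp
      · simp [hk]
    rw [this]
    simp [Finset.sum_add_distrib]
  refine hS.place ⟨_, hinj⟩ (fun z k => ?_) (fun z l hl => ?_)
  · fin_cases k
    · simp [cnotnotGate, Function.Involutive.toPerm, h]
    · simp [cnotnotGate, Function.Involutive.toPerm]
    · simp [cnotnotGate, Function.Involutive.toPerm, hsum, ← add_assoc, add_add_self]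
  · rcases l with _ | l
    · exact absurd ⟨2, rfl⟩ hl
    · have h2 : l ≠ j := fun h => hl ⟨1, by simp [h]⟩
      simp [h2]

lemma genOn_parityLift_flipAt [Fintype ι] [DecidableEq ι] (hS : GenOn S notnotGate) (i : ι) :
    GenOn S (parityLift (flipAt i)) := by
  convert genOn_translate_pair hS (Option.some_ne_none i)
  ext z o
  rcases o with _ | k
  · simp [flipAt, Finset.sum_add_distrib, ← add_assoc, add_add_self]
  · by_cases hk : k = i
    · subst hk; simp [flipAt]
    · simp [flipAt, hk]

/-- A CNOT or NOT factor of `G` may break parity, but its lift does not: it is a CNOTNOT or a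
NOTNOT. -/
lemma generates_of_cnotnot (hS : Generates S cnotnotGate) {n : ℕ} {G : Gate n} (h : IsAffine G)
    (hG : IsParityPreserving G) : Generates S G := by
  have h0 := genOn_fin.2 hS
  refine genOn_fin.1 (genOn_of_parityLift ?_ fun x => (hammingNorm_modEq_two_iff _ _).1 (hG x))
  refine affine_induction (P := fun G => GenOn S (parityLift G)) ?_ ?_
    (fun i j h => genOn_parityLift_cnotAt h0 h)
    (fun i => genOn_parityLift_flipAt (genOn_notnot_of_cnotnot h0) i) h
  · rw [parityLift_one]; exact .one
  · intro F G hF hG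
    rw [parityLift_mul]; exact hF.mul hG

lemma preservesAffine_cnotnotGate : PreservesAffine cnotnotGate := by
  intro x y z
  ext i
  fin_cases i
  · rfl
  · simp [cnotnotGate, Function.Involutive.toPerm]
    ring
  · simp [cnotnotGate, Function.Involutive.toPerm]
    ring

lemma preservesAffine_translate (b : ι → ZMod 2) : PreservesAffine (Equiv.addRight b) := by
  intro x y z
  simp only [Equiv.coe_addRight]
  have h1 := vec_add_self b
  calc x + y + z + b = x + y + z + b + (b + b) := by rw [h1, add_zero]
    _ = _ := by abel

lemma hammingNorm_cnotnotGate (x : Bits 3) :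
    hammingNorm (cnotnotGate x) ≡ hammingNorm x [MOD 2] := by
  revert x; decide

lemma gateClass_cnotnot (n : ℕ) : gateClass {CNOTNOT} n =
    {G | IsAffine G ∧ IsParityPreserving G} := by
  ext G
  refine ⟨fun h => ⟨isAffine_iff.2 (h.preservesAffine ?_), h.hammingNorm_modEq_self ?_⟩,
    fun h => generates_of_cnotnot (.base (Set.mem_singleton _)) h.1 h.2⟩
  · rintro F rfl
    exact preservesAffine_cnotnotGate
  · rintro F rfl
    exact hammingNorm_cnotnotGate

lemma IsAffine.flipAt_mul {n : ℕ} {G : Gate n} (h : IsAffine G) (i : Fin n) :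
    IsAffine (flipAt i * G) := by
  obtain ⟨A, hA, b, h⟩ := h
  exact ⟨A, hA, b + Pi.single i 1, fun x => by simp [flipAt, h, add_assoc]⟩

lemma gateClass_cnotnot_not (n : ℕ) : gateClass {CNOTNOT, NOT} n =
    {G | IsAffine G ∧ IsParityRespecting G} := by
  ext G
  refine ⟨fun h => ⟨isAffine_iff.2 (h.preservesAffine ?_), ?_⟩, fun h =>
    generates_of_isParityRespecting (.base (Or.inr rfl)) IsAffine (fun _ i h => h.flipAt_mul i)
      (fun G h1 h2 => generates_of_cnotnot (.base (Or.inl rfl)) h1 h2) h.1 h.2⟩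
  · rintro F (rfl | rfl)
    · exact preservesAffine_cnotnotGate
    · exact preservesAffine_translate _
  · obtain ⟨j, -, hj⟩ := h.hammingNorm_modEq (k := 2) ⊤ (by
      rintro F (rfl | rfl)
      · exact ⟨0, trivial, hammingNorm_cnotnotGate⟩
      · exact ⟨1, trivial, hammingNorm_notGate⟩)
    exact ⟨j, hj⟩

/-! ### Counting affine gates -/

lemma prod_two_pow_sub (n : ℕ) : ∏ i ∈ Finset.range n, (2 ^ n - 2 ^ i) =
    2 ^ (n * (n - 1) / 2) * ∏ i ∈ Finset.Icc 1 n, (2 ^ i - 1) := by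
  rw [← Finset.sum_range_id, ← Finset.prod_pow_eq_pow_sum]
  have h1 : ∏ i ∈ Finset.Icc 1 n, (2 ^ i - 1) = ∏ i ∈ Finset.range n, (2 ^ (n - i) - 1) := by
    rw [← Finset.prod_range_reflect, Finset.range_eq_Ico, ← Finset.Ico_add_one_right_eq_Icc,
      ← Finset.prod_Ico_add' (fun i => 2 ^ i - 1) 0 n 1]
    refine Finset.prod_congr rfl fun i hi => ?_
    have := Finset.mem_Ico.1 hi
    congr 2
    omega
  rw [h1, ← Finset.prod_mul_distrib]
  refine Finset.prod_congr rfl fun i hi => ?_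
  have := Finset.mem_range.1 hi
  rw [Nat.mul_sub, ← pow_add, mul_one]
  congr 2
  omega

lemma ncard_isAffine (n : ℕ) : {G : Gate n | IsAffine G}.ncard =
    2 ^ (n * (n + 1) / 2) * ∏ i ∈ Finset.Icc 1 n, (2 ^ i - 1) := by
  let f : GL (Fin n) (ZMod 2) × Bits n → Gate n := fun p =>
    Equiv.ofBijective (fun x => p.1.1.mulVec x + p.2) (Finite.injective_iff_bijective.1
      fun x y h => Matrix.mulVec_injective_iff_isUnit.2 p.1.isUnit (add_right_cancel h))
  have hf : ∀ p x, f p x = p.1.1.mulVec x + p.2 := fun _ _ => rfl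
  have hinj : Function.Injective f := by
    intro p q h
    have h1 : ∀ x, f p x = f q x := fun x => by rw [h]
    have h2 : p.2 = q.2 := by simpa [hf] using h1 0
    refine Prod.ext (Units.ext (Matrix.ext_iff_mulVec.2 fun x => ?_)) h2
    have h3 := h1 x
    rw [hf, hf, h2] at h3
    exact add_right_cancel h3
  have hrange : {G : Gate n | IsAffine G} = Set.range f := by
    ext G
    constructor
    · rintro ⟨A, hA, b, h⟩
      exact ⟨(hA.unit, b), Equiv.ext fun x => (h x).symm⟩
    · rintro ⟨p, rfl⟩
      exact ⟨p.1.1, p.1.isUnit, p.2, hf p⟩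
  rw [hrange, ← Nat.card_coe_set_eq, Nat.card_range_of_injective hinj, Nat.card_prod,
    Matrix.card_GL_field]
  simp only [ZMod.card, Nat.card_eq_fintype_card, Fintype.card_fun, Fintype.card_fin]
  rw [← Finset.prod_range (fun i => 2 ^ n - 2 ^ i), prod_two_pow_sub, mul_right_comm, ← pow_add]
  congr 2
  rcases n with _ | n
  · rfl
  · have h1 : (n + 1) * (n + 1 + 1) = (n + 1) * (n + 1 - 1) + 2 * (n + 1) := by
      simp; ring
    rw [h1, Nat.add_mul_div_left _ _ (by norm_num)]

/-- The parity-preserving gate on `n + 1` bits that applies `B` to the last `n` bits of a string of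
even weight, and `B` followed by adding `v` if the weight is odd. -/
def evenOddGate {n : ℕ} (B : Gate n) (v : Bits n) : Gate (n + 1) where
  toFun z := Fin.cons (∑ i, z i + ∑ i, (B (Fin.tail z) + (∑ i, z i) • v) i)
    (B (Fin.tail z) + (∑ i, z i) • v)
  invFun z := Fin.cons (∑ i, z i + ∑ i, B.symm (Fin.tail z + (∑ i, z i) • v) i)
    (B.symm (Fin.tail z + (∑ i, z i) • v))
  left_inv z := by
    simp only [Fin.sum_univ_succ (f := Fin.cons _ _), Fin.cons_zero, Fin.cons_succ, Fin.tail_cons,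
      add_add_self, vec_add_add_self, Equiv.symm_apply_apply]
    rw [Fin.sum_univ_succ]
    conv_rhs => rw [← Fin.cons_self_tail z]
    congr 1
    exact add_add_self _ _
  right_inv z := by
    simp only [Fin.sum_univ_succ (f := Fin.cons _ _), Fin.cons_zero, Fin.cons_succ, Fin.tail_cons,
      add_add_self, vec_add_add_self, Equiv.apply_symm_apply]
    rw [Fin.sum_univ_succ]
    conv_rhs => rw [← Fin.cons_self_tail z]
    congr 1
    exact add_add_self _ _

lemma evenOddGate_apply {n : ℕ} (B : Gate n) (v : Bits n) (z : Bits (n + 1)) :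
    evenOddGate B v z = Fin.cons (∑ i, z i + ∑ i, (B (Fin.tail z) + (∑ i, z i) • v) i)
    (B (Fin.tail z) + (∑ i, z i) • v) := rfl

lemma sum_evenOddGate {n : ℕ} (B : Gate n) (v : Bits n) (z : Bits (n + 1)) :
    ∑ i, evenOddGate B v z i = ∑ i, z i := by
  rw [evenOddGate_apply, Fin.sum_univ_succ]
  simp only [Fin.cons_zero, Fin.cons_succ, add_add_self]

lemma bits_succ_ext {n : ℕ} {x y : Bits (n + 1)} (h : Fin.tail x = Fin.tail y)
    (h' : ∑ i, x i = ∑ i, y i) : x = y := by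
  have h1 : ∀ i : Fin n, x i.succ = y i.succ := fun i => congrFun h i
  rw [Fin.sum_univ_succ, Fin.sum_univ_succ, Finset.sum_congr rfl fun i _ => h1 i] at h'
  funext i
  refine Fin.cases (add_right_cancel h') h1 i

/-- In the coordinates tail and parity, `G` is an affine bijection `B` of the tails of even strings;
on odd strings, affinity leaves only the choice of one further vector `v`, and that choice is free.
-/
lemma ncard_isAffine_isParityPreserving (n : ℕ) :
    {G : Gate (n + 1) | IsAffine G ∧ IsParityPreserving G}.ncard =
      {G : Gate n | IsAffine G}.ncard * 2 ^ n := by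
  have hinj : Function.Injective (fun p : Gate n × Bits n => evenOddGate p.1 p.2) := by
    rintro ⟨B, v⟩ ⟨B', v'⟩ h
    have h1 : ∀ z, B (Fin.tail z) + (∑ i, z i) • v = B' (Fin.tail z) + (∑ i, z i) • v' := by
      intro z
      have := congrArg Fin.tail (DFunLike.congr_fun h z)
      simpa [evenOddGate_apply] using this
    have h2 : B = B' := by
      refine Equiv.ext fun y => ?_
      have := h1 (Fin.cons (∑ i, y i) y)
      simpa [Fin.sum_univ_succ, CharTwo.add_self_eq_zero] using this
    have h3 : v = v' := by
      have := h1 (Fin.cons 1 0)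
      simpa [Fin.sum_univ_succ, h2] using this
    rw [h2, h3]
  have himage : {G : Gate (n + 1) | IsAffine G ∧ IsParityPreserving G} =
      (fun p : Gate n × Bits n => evenOddGate p.1 p.2) '' ({G | IsAffine G} ×ˢ Set.univ) := by
    ext G
    constructor
    · rintro ⟨h1, h2⟩
      have h1 := isAffine_iff.1 h1
      have h2 : ∀ x, ∑ i, G x i = ∑ i, x i := fun x => (hammingNorm_modEq_two_iff _ _).1 (h2 x)
      -- The even string with the given tail.
      let e : Bits n → Bits (n + 1) := fun y => Fin.cons (∑ i, y i) y
      have he : ∀ y, ∑ i, e y i = 0 := fun y => by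
        simp [e, Fin.sum_univ_succ, CharTwo.add_self_eq_zero]
      have he' : ∀ x y z, e (x + y + z) = e x + e y + e z := by
        intro x y z
        funext i
        refine Fin.cases ?_ (fun i => ?_) i
        · simp [e, Finset.sum_add_distrib]
        · simp [e]
      have hB : Function.Injective (fun y => Fin.tail (G (e y))) := by
        intro x y h
        have h3 := G.injective (bits_succ_ext h (by rw [h2, h2, he, he]))
        have := congrArg Fin.tail h3
        simpa [e] using this
      let B : Gate n := Equiv.ofBijective _ (Finite.injective_iff_bijective.1 hB)
      have hBv : ∀ y, B y = Fin.tail (G (e y)) := fun _ => rfl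
      -- An odd string is `e` of its tail plus the first basis vector, so `v` is the effect of that
      -- basis vector under the linear part of `G`.
      refine ⟨(B, Fin.tail (G (Fin.cons 1 0)) + Fin.tail (G 0)), ⟨isAffine_iff.2 ?_, trivial⟩, ?_⟩
      · intro x y z
        rw [hBv, he', h1]
        rfl
      · refine Equiv.ext fun z => bits_succ_ext ?_ (by
          rw [h2]; exact sum_evenOddGate _ _ _)
        change Fin.tail (evenOddGate _ _ z) = _
        rw [evenOddGate_apply, Fin.tail_cons, hBv]
        rcases zmod_two_cases (∑ i, z i) with hz | hz
        · rw [hz, zero_smul, add_zero]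
          congr 2
          refine bits_succ_ext ?_ ?_
          · simp [e]
          · rw [he, hz]
        · rw [hz, one_smul]
          have h3 : z = e (Fin.tail z) + Fin.cons 1 0 + 0 := by
            refine bits_succ_ext ?_ ?_
            · funext i; simp [e, Fin.tail]
            · rw [add_zero, hz]
              simp only [Pi.add_apply, Finset.sum_add_distrib, he]
              simp [Fin.sum_univ_succ]
          conv_rhs => rw [h3, h1]
          rw [← add_assoc]
          rfl
    · rintro ⟨⟨B, v⟩, ⟨hB, -⟩, rfl⟩
      refine ⟨isAffine_iff.2 fun x y z => bits_succ_ext ?_ ?_, fun x =>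
        (hammingNorm_modEq_two_iff _ _).2 (sum_evenOddGate B v x)⟩
      · have hB := isAffine_iff.1 hB
        have h1 : Fin.tail (x + y + z) = Fin.tail x + Fin.tail y + Fin.tail z := rfl
        have h2 : ∀ x y z : Bits (n + 1), Fin.tail (x + y + z) =
          Fin.tail x + Fin.tail y + Fin.tail z := fun _ _ _ => rfl
        simp only [h2, evenOddGate_apply, Fin.tail_cons, hB _ _ _, Pi.add_apply,
          Finset.sum_add_distrib, add_smul]
        abel
      · simp only [Pi.add_apply, Finset.sum_add_distrib, sum_evenOddGate]
  rw [himage, Set.ncard_image_of_injective _ hinj, Set.ncard_prod, Set.ncard_univ]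
  simp

lemma count_cnotnot {n : ℕ} (hn : 1 ≤ n) : count {CNOTNOT} n =
    2 ^ (n * (n + 1) / 2 - 1) * ∏ i ∈ Finset.Icc 1 (n - 1), (2 ^ i - 1) := by
  obtain ⟨n, rfl⟩ := Nat.exists_eq_add_of_le' hn
  rw [count, gateClass_cnotnot, ncard_isAffine_isParityPreserving, ncard_isAffine,
    mul_right_comm, ← pow_add, Nat.add_sub_cancel]
  congr 2
  have h1 : (n + 1) * (n + 1 + 1) = n * (n + 1) + 2 * (n + 1) := by ring
  rw [h1, Nat.add_mul_div_left _ _ (by norm_num)]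
  omega

lemma count_cnotnot_not {n : ℕ} (hn : 1 ≤ n) : count {CNOTNOT, NOT} n =
    2 ^ (n * (n + 1) / 2) * ∏ i ∈ Finset.Icc 1 (n - 1), (2 ^ i - 1) := by
  have h1 := count_cnotnot hn
  rw [count, gateClass_cnotnot] at h1
  rw [count, gateClass_cnotnot_not,
    ncard_isParityRespecting ⟨0, hn⟩ IsAffine (fun _ h => h.flipAt_mul _), h1, ← mul_assoc,
    ← pow_succ']
  congr 2
  have : 1 * (1 + 1) ≤ n * (n + 1) := by gcongr
  omega

/-! ### Orthogonal gates -/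

/-- Additive gates that preserve the standard bilinear form. -/
def IsOrthogonal [Fintype ι] (G : Perm (ι → ZMod 2)) : Prop :=
  (∀ x y, G (x + y) = G x + G y) ∧ ∀ x y, G x ⬝ᵥ G y = x ⬝ᵥ y

lemma dotProduct_self_eq_sum [Fintype ι] (x : ι → ZMod 2) : x ⬝ᵥ x = ∑ i, x i := by
  have h : ∀ b : ZMod 2, b * b = b := by decide
  exact Finset.sum_congr rfl fun i _ => h _

lemma eq_zero_of_dotProduct [Fintype ι] {x : ι → ZMod 2} (h : ∀ y, y ⬝ᵥ x = 0) : x = 0 := by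
  classical
  funext i
  simpa using h (Pi.single i 1)

lemma map_zero_of_additive {G : (ι → ZMod 2) → (κ → ZMod 2)}
    (h : ∀ x y, G (x + y) = G x + G y) : G 0 = 0 := by
  have := h 0 0
  rwa [add_zero, vec_add_self] at this

lemma snoc_dotProduct_snoc {n : ℕ} (x y : Bits n) (a b : ZMod 2) :
    (Fin.snoc x a : Bits (n + 1)) ⬝ᵥ (Fin.snoc y b : Bits (n + 1)) = x ⬝ᵥ y + a * b := by
  simp [dotProduct, Fin.sum_univ_castSucc]

lemma append_dotProduct_append {n m : ℕ} (x y : Bits n) (a b : Bits m) :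
    Fin.append x a ⬝ᵥ Fin.append y b = x ⬝ᵥ y + a ⬝ᵥ b := by
  simp [dotProduct, Fin.sum_univ_add]

lemma dotProduct_comp_perm {n : ℕ} (σ : Perm (Fin n)) (x y : Bits n) :
    (fun i => x (σ i)) ⬝ᵥ (fun i => y (σ i)) = x ⬝ᵥ y :=
  Equiv.sum_comp σ (fun i => x i * y i)

lemma isOrthogonal_one [Fintype ι] : IsOrthogonal (1 : Perm (ι → ZMod 2)) :=
  ⟨fun _ _ => rfl, fun _ _ => rfl⟩

lemma IsOrthogonal.mul [Fintype ι] {F G : Perm (ι → ZMod 2)} (hF : IsOrthogonal F)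
    (hG : IsOrthogonal G) : IsOrthogonal (F * G) := by
  constructor
  · intro x y
    simp only [Perm.mul_apply, hG.1, hF.1]
  · intro x y
    simp only [Perm.mul_apply, hG.2, hF.2]

/-- Over two elements `x ⬝ᵥ x = x ⬝ᵥ 1`, so the all-ones vector is determined by the bilinear form.
-/
lemma IsOrthogonal.map_one [Fintype ι] {G : Perm (ι → ZMod 2)} (hG : IsOrthogonal G) :
    G 1 = 1 := by
  have h : ∀ y, y ⬝ᵥ (G 1 + 1) = 0 := by
    intro y
    obtain ⟨x, rfl⟩ := G.surjective y
    rw [dotProduct_add, hG.2, dotProduct_one, dotProduct_one, ← dotProduct_self_eq_sum,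
      ← dotProduct_self_eq_sum, hG.2, CharTwo.add_self_eq_zero]
  have h1 := eq_zero_of_dotProduct h
  rw [← vec_add_add_self (G 1) 1, h1, zero_add]

lemma Generates.isOrthogonal (hS : ∀ F ∈ S, IsOrthogonal F.2) {n : ℕ} {G : Gate n}
    (h : Generates S G) : IsOrthogonal G := by
  induction h with
  | base h => exact hS _ h
  | ident n => exact isOrthogonal_one
  | comp _ _ h1 h2 => exact h1.mul h2
  | swapping _ σ τ h h1 =>
    constructor
    · intro x y
      rw [h, h, h]
      funext i
      exact congrFun (h1.1 (fun j => x (τ j)) (fun j => y (τ j))) (σ i)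
    · intro x y
      rw [h, h, dotProduct_comp_perm σ, h1.2, dotProduct_comp_perm τ]
  | @extension n F G _ h h1 =>
    have hsn : ∀ x : Bits (n + 1), ∃ (y : Bits n) (b : ZMod 2), x = Fin.snoc y b :=
      fun x => ⟨_, _, (Fin.snoc_init_self x).symm⟩
    constructor
    · intro x y
      obtain ⟨x, a, rfl⟩ := hsn x
      obtain ⟨y, b, rfl⟩ := hsn y
      rw [snoc_add_snoc, h, h, h, h1.1, snoc_add_snoc]
    · intro x y
      obtain ⟨x, a, rfl⟩ := hsn x
      obtain ⟨y, b, rfl⟩ := hsn y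
      rw [h, h, snoc_dotProduct_snoc, snoc_dotProduct_snoc, h1.2]
  | @ancilla n k F G a _ h h1 =>
    have hadd : ∀ x y, G (x + y) = G x + G y + G 0 := by
      intro x y
      have h2 := h1.1 (Fin.append x a + Fin.append y a) (Fin.append 0 a)
      rw [h1.1 (Fin.append x a), append_add_append, append_add_append, vec_add_self, zero_add,
        add_zero, h, h, h, h, append_add_append, append_add_append] at h2
      exact (append_left_injective' h2).1
    have hsub : ∀ x, F (Fin.append x 0) = Fin.append (G x + G 0) 0 := by
      intro x
      have h2 := h1.1 (Fin.append x a) (Fin.append 0 a)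
      rwa [append_add_append, vec_add_self, add_zero, h, h, append_add_append,
        vec_add_self] at h2
    -- Ancillas cannot introduce a translation here: `(x, 0)` and `(0, a)` are orthogonal, and so
    -- are their images `(G x + G 0, 0)` and `(G 0, a)`. As `x` varies, the first component takes
    -- all values, so `G 0` is orthogonal to everything.
    have hzero : G 0 = 0 := by
      refine eq_zero_of_dotProduct fun y => ?_
      obtain ⟨x, hx⟩ := G.surjective (y + G 0)
      have h2 := h1.2 (Fin.append x 0) (Fin.append 0 a)
      rw [hsub, h, append_dotProduct_append, append_dotProduct_append, hx, vec_add_add_self] at h2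
      simpa using h2
    constructor
    · intro x y
      rw [hadd, hzero, add_zero]
    · intro x y
      have h2 := h1.2 (Fin.append x 0) (Fin.append y 0)
      rw [hsub, hsub, append_dotProduct_append, append_dotProduct_append, hzero] at h2
      simpa using h2

/-- The gate `G` together with a bit that it ignores. -/
def snocGate {n : ℕ} (G : Gate n) : Gate (n + 1) where
  toFun z := Fin.snoc (G (Fin.init z)) (z (Fin.last n))
  invFun z := Fin.snoc (G.symm (Fin.init z)) (z (Fin.last n))
  left_inv z := by simp
  right_inv z := by simp

@[simp] lemma snocGate_snoc {n : ℕ} (G : Gate n) (x : Bits n) (b : ZMod 2) :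
    snocGate G (Fin.snoc x b : Bits (n + 1)) = (Fin.snoc (G x) b : Bits (n + 1)) := by
  simp [snocGate]

lemma snocGate_injective {n : ℕ} : Function.Injective (snocGate (n := n)) := by
  intro F G h
  refine Equiv.ext fun x => ?_
  have := congrArg Fin.init (DFunLike.congr_fun h (Fin.snoc x 0 : Bits (n + 1)))
  simpa using this

lemma Generates.snocGate {n : ℕ} {G : Gate n} (h : Generates S G) : Generates S (snocGate G) :=
  h.extension (snocGate_snoc G)

/-- Orthogonal gates that preserve the Hamming weight modulo `m`. -/
def orthogonalClass (m n : ℕ) : Set (Gate n) :=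
  {G | IsOrthogonal G ∧ ∀ x, hammingNorm (G x) ≡ hammingNorm x [MOD m]}

lemma mul_mem_orthogonalClass {m n : ℕ} {F G : Gate n} (hF : F ∈ orthogonalClass m n)
    (hG : G ∈ orthogonalClass m n) : F * G ∈ orthogonalClass m n :=
  ⟨hF.1.mul hG.1, fun x => (hF.2 _).trans (hG.2 x)⟩

lemma one_mem_orthogonalClass {m n : ℕ} : (1 : Gate n) ∈ orthogonalClass m n :=
  ⟨isOrthogonal_one, fun _ => rfl⟩

lemma inv_induction {n : ℕ} {P : Gate n → Prop} (one : P 1)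
    (mul : ∀ F G, P F → P G → P (F * G)) {G : Gate n} (h : P G) : P G⁻¹ := by
  have h1 : G⁻¹ = G ^ (orderOf G - 1) := by
    rw [inv_eq_iff_mul_eq_one, ← pow_succ', Nat.sub_add_cancel (orderOf_pos G), pow_orderOf_eq_one]
  rw [h1]
  induction orderOf G - 1 with
  | zero => exact one
  | succ k ih => rw [pow_succ]; exact mul _ _ ih h

lemma inv_mem_orthogonalClass {m n : ℕ} {G : Gate n} (h : G ∈ orthogonalClass m n) :
    G⁻¹ ∈ orthogonalClass m n :=
  inv_induction one_mem_orthogonalClass (fun _ _ => mul_mem_orthogonalClass) h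

lemma bitPerm_mem_orthogonalClass {m n : ℕ} (σ : Perm (Fin n)) :
    (bitPerm σ : Gate n) ∈ orthogonalClass m n :=
  ⟨⟨fun _ _ => rfl, fun x y => dotProduct_comp_perm σ.symm x y⟩,
    fun x => congrArg (· % m) (hammingNorm_comp_equiv σ.symm x)⟩

lemma snocGate_mem_orthogonalClass {m n : ℕ} {G : Gate n} (h : G ∈ orthogonalClass m n) :
    snocGate G ∈ orthogonalClass m (n + 1) := by
  have hsn : ∀ x : Bits (n + 1), ∃ (y : Bits n) (b : ZMod 2), x = Fin.snoc y b :=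
    fun x => ⟨_, _, (Fin.snoc_init_self x).symm⟩
  refine ⟨⟨fun x y => ?_, fun x y => ?_⟩, fun x => ?_⟩
  · obtain ⟨x, a, rfl⟩ := hsn x
    obtain ⟨y, b, rfl⟩ := hsn y
    simp only [snoc_add_snoc, snocGate_snoc, h.1.1]
  · obtain ⟨x, a, rfl⟩ := hsn x
    obtain ⟨y, b, rfl⟩ := hsn y
    simp only [snoc_dotProduct_snoc, snocGate_snoc, h.1.2]
  · obtain ⟨x, a, rfl⟩ := hsn x
    rw [snocGate_snoc, hammingNorm_snoc, hammingNorm_snoc]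
    exact (h.2 x).add_right _

/-- The last basis vector. -/
def lastVec (n : ℕ) : Bits (n + 1) := Fin.snoc 0 1

lemma dotProduct_lastVec {n : ℕ} (x : Bits (n + 1)) : x ⬝ᵥ lastVec n = x (Fin.last n) := by
  conv_lhs => rw [← Fin.snoc_init_self x]
  rw [lastVec, snoc_dotProduct_snoc]
  simp

lemma hammingNorm_lastVec (n : ℕ) : hammingNorm (lastVec n) = 1 := by
  rw [lastVec, hammingNorm_snoc, hammingNorm_zero]; rfl

/-- The last bit is the inner product with `lastVec n`, so a map fixing this vector preserves the
last bit and acts on the orthogonal complement, which is the space of the first `n` bits. -/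
lemma exists_snocGate {m n : ℕ} {G : Gate (n + 1)} (h : G ∈ orthogonalClass m (n + 1))
    (hG : G (lastVec n) = lastVec n) : ∃ F ∈ orthogonalClass m n, G = snocGate F := by
  have hlast : ∀ x, G x (Fin.last n) = x (Fin.last n) := by
    intro x
    have h1 := h.1.2 x (lastVec n)
    rwa [hG, dotProduct_lastVec, dotProduct_lastVec] at h1
  have h0 : ∀ x : Bits n, G (Fin.snoc x 0 : Bits (n + 1)) =
      Fin.snoc (Fin.init (G (Fin.snoc x 0 : Bits (n + 1)))) 0 := by
    intro x
    conv_lhs => rw [← Fin.snoc_init_self (G (Fin.snoc x 0 : Bits (n + 1))), hlast]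
    simp
  have hinj : Function.Injective
      (fun x : Bits n => Fin.init (G (Fin.snoc x 0 : Bits (n + 1)))) := by
    intro x y hxy
    have h1 : G (Fin.snoc x 0 : Bits (n + 1)) = G (Fin.snoc y 0 : Bits (n + 1)) := by
      rw [h0 x, h0 y]; exact congrArg (fun u : Bits n => (Fin.snoc u 0 : Bits (n + 1))) hxy
    have h2 := congrArg Fin.init (G.injective h1)
    simpa using h2
  let F : Gate n := Equiv.ofBijective _ (Finite.injective_iff_bijective.1 hinj)
  have hF : ∀ x, G (Fin.snoc x 0 : Bits (n + 1)) = Fin.snoc (F x) 0 := h0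
  have hGF : G = snocGate F := by
    refine Equiv.ext fun z => ?_
    rw [← Fin.snoc_init_self z, snocGate_snoc]
    have h1 : (Fin.snoc (Fin.init z) (z (Fin.last n)) : Bits (n + 1)) =
        Fin.snoc (Fin.init z) 0 + Fin.snoc 0 (z (Fin.last n)) := by
      rw [snoc_add_snoc]; simp
    rw [h1, h.1.1, hF]
    have h2 : G (Fin.snoc 0 (z (Fin.last n)) : Bits (n + 1)) = Fin.snoc 0 (z (Fin.last n)) := by
      rcases zmod_two_cases (z (Fin.last n)) with hz | hz
      · have : (Fin.snoc 0 0 : Bits (n + 1)) = 0 := by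
          ext i
          induction i using Fin.lastCases <;> simp
        rw [hz, this]
        exact map_zero_of_additive h.1.1
      · rw [hz]; exact hG
    rw [h2, snoc_add_snoc]
    simp
  refine ⟨F, ⟨⟨fun x y => ?_, fun x y => ?_⟩, fun x => ?_⟩, hGF⟩
  · have h1 := h.1.1 (Fin.snoc x 0 : Bits (n + 1)) (Fin.snoc y 0 : Bits (n + 1))
    rw [snoc_add_snoc, add_zero, hF, hF, hF, snoc_add_snoc] at h1
    simpa using congrArg Fin.init h1
  · have h1 := h.1.2 (Fin.snoc x 0 : Bits (n + 1)) (Fin.snoc y 0 : Bits (n + 1))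
    simpa only [hF, snoc_dotProduct_snoc, mul_zero, add_zero] using h1
  · have h1 := h.2 (Fin.snoc x 0 : Bits (n + 1))
    rw [hF, hammingNorm_snoc, hammingNorm_snoc] at h1
    simpa using h1

/-- The candidates for the image of the last basis vector. -/
def basisImages (m n : ℕ) : Set (Bits (n + 1)) :=
  {v | hammingNorm v ≡ 1 [MOD m] ∧ (v ≠ 1 ∨ n = 0)}

/-- The all-ones string is fixed by orthogonal maps, so it is not the image of a basis vector,
except when there is only one bit and the two coincide. -/
lemma apply_lastVec_mem_basisImages {m n : ℕ} {G : Gate (n + 1)}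
    (h : G ∈ orthogonalClass m (n + 1)) : G (lastVec n) ∈ basisImages m n := by
  have h0 := h.2 (lastVec n)
  rw [hammingNorm_lastVec] at h0
  refine ⟨h0, ?_⟩
  by_contra! hc
  obtain ⟨h1, h2⟩ := hc
  have h3 : lastVec n = 1 := G.injective (h1.trans h.1.map_one.symm)
  have h4 := congrFun h3 ((⟨0, by omega⟩ : Fin n).castSucc)
  rw [lastVec, Fin.snoc_castSucc] at h4
  exact zero_ne_one h4

/-- An induction principle for gates, without the ancilla rule. -/
lemma orthogonalClass_induction (m : ℕ) (P : ∀ n, Gate n → Prop) (one : ∀ n, P n 1)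
    (mul : ∀ n F G, P n F → P n G → P n (F * G)) (snoc : ∀ n G, P n G → P (n + 1) (snocGate G))
    (reach : ∀ n, ∀ v ∈ basisImages m n, ∃ K ∈ orthogonalClass m (n + 1), P (n + 1) K ∧
      K v = lastVec n) {n : ℕ} {G : Gate n} (hG : G ∈ orthogonalClass m n) : P n G := by
  induction n with
  | zero => rw [Subsingleton.elim G 1]; exact one 0
  | succ n ih =>
    obtain ⟨K, hK, hP, hv⟩ := reach n _ (apply_lastVec_mem_basisImages hG)
    obtain ⟨F, hF, hF'⟩ := exists_snocGate (mul_mem_orthogonalClass hK hG) hv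
    have h1 : G = K⁻¹ * snocGate F := by rw [← hF', inv_mul_cancel_left]
    rw [h1]
    exact mul _ _ _ (inv_induction (one _) (mul _) hP) (snoc _ _ (ih hF))

/-- Orbit and stabilizer of `lastVec n`: `reach` says that the orbit consists of all candidates, and
`exists_snocGate` identifies the stabilizer. -/
lemma ncard_orthogonalClass_succ (m n : ℕ)
    (reach : ∀ v ∈ basisImages m n, ∃ K ∈ orthogonalClass m (n + 1), K v = lastVec n) :
    (orthogonalClass m (n + 1)).ncard = (basisImages m n).ncard * (orthogonalClass m n).ncard := by
  classical
  choose! K hK hKv using reach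
  have hKinv : ∀ v ∈ basisImages m n, (K v)⁻¹ (lastVec n) = v := fun v hv => by
    rw [Perm.inv_eq_iff_eq, hKv v hv]
  have hfix : ∀ F ∈ orthogonalClass m n, snocGate F (lastVec n) = lastVec n := fun F hF => by
    rw [lastVec, snocGate_snoc, map_zero_of_additive hF.1.1]
  have himage : orthogonalClass m (n + 1) = (fun p : Bits (n + 1) × Gate n =>
      (K p.1)⁻¹ * snocGate p.2) '' (basisImages m n ×ˢ orthogonalClass m n) := by
    ext G
    constructor
    · intro h
      have hv := apply_lastVec_mem_basisImages h
      obtain ⟨F, hF, hF'⟩ := exists_snocGate (mul_mem_orthogonalClass (hK _ hv) h) (hKv _ hv)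
      exact ⟨(_, F), ⟨hv, hF⟩, by simp only [← hF', inv_mul_cancel_left]⟩
    · rintro ⟨⟨v, F⟩, ⟨hv, hF⟩, rfl⟩
      exact mul_mem_orthogonalClass (inv_mem_orthogonalClass (hK v hv))
        (snocGate_mem_orthogonalClass hF)
  rw [himage, Set.InjOn.ncard_image, Set.ncard_prod]
  rintro ⟨v, F⟩ ⟨hv, hF⟩ ⟨v', F'⟩ ⟨hv', hF'⟩ h
  have h1 : v = v' := by
    have := DFunLike.congr_fun h (lastVec n)
    simpa [Perm.mul_apply, hfix F hF, hfix F' hF', hKinv v hv, hKinv v' hv'] using this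
  subst h1
  exact Prod.ext rfl (snocGate_injective (mul_left_cancel h))

lemma ncard_orthogonalClass_zero (m : ℕ) : (orthogonalClass m 0).ncard = 1 := by
  rw [Set.ncard_eq_one]
  exact ⟨1, Set.eq_singleton_iff_unique_mem.2
    ⟨one_mem_orthogonalClass, fun _ _ => Subsingleton.elim _ _⟩⟩

lemma exists_bitPerm_lastVec {n : ℕ} {v : Bits (n + 1)} (hv : hammingNorm v = 1) :
    ∃ σ : Perm (Fin (n + 1)), bitPerm σ v = lastVec n :=
  exists_bitPerm_of_hammingNorm_eq (hv.trans (hammingNorm_lastVec n).symm)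

/-! ### The gates `T_k` -/

lemma tGate_apply {k : ℕ} (hk : Even k) (x : Bits k) (i : Fin k) :
    tGate k hk x i = x i + ∑ j, x j := rfl

lemma isOrthogonal_tGate {k : ℕ} (hk : Even k) : IsOrthogonal (tGate k hk) := by
  have hk0 : (k : ZMod 2) = 0 := (ZMod.natCast_eq_zero_iff_even).2 hk
  constructor
  · intro x y
    funext i
    simp only [tGate_apply, Pi.add_apply, Finset.sum_add_distrib]
    ring
  · intro x y
    have h : ∀ i, tGate k hk x i * tGate k hk y i =
        x i * y i + x i * (∑ j, y j) + (∑ j, x j) * y i + (∑ j, x j) * ∑ j, y j := by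
      intro i
      rw [tGate_apply, tGate_apply]
      ring
    simp only [dotProduct, h, Finset.sum_add_distrib, ← Finset.sum_mul, ← Finset.mul_sum,
      Finset.sum_const, Finset.card_univ, Fintype.card_fin, nsmul_eq_mul, hk0, zero_mul, add_zero,
      add_add_self]

/-- Applying `T_k` to `k - 1` ones and one zero. -/
lemma exists_placeGate_tGate {m : ℕ} (hm : Even (m + 2)) {n : ℕ} (v : Bits n)
    (hv : m + 1 ≤ hammingNorm v) (hv1 : v ≠ 1) :
    ∃ f : Fin (m + 2) ↪ Fin n, hammingNorm (placeGate f (tGate (m + 2) hm) v) + m =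
      hammingNorm v ∧ placeGate f (tGate (m + 2) hm) v ≠ 1 := by
  obtain ⟨U, hU, hUk⟩ := Finset.exists_subset_card_eq (hammingNorm.eq_1 v ▸ hv)
  have hvU : ∀ i ∈ U, v i = 1 := fun i hi => by
    have := hU hi
    simp only [Finset.mem_filter] at this
    exact (zmod_two_cases _).resolve_left this.2
  obtain ⟨j, hj⟩ : ∃ j, v j ≠ 1 := by
    by_contra! hc
    exact hv1 (funext hc)
  have hj : v j = 0 := (zmod_two_cases _).resolve_right hj
  have hjU : j ∉ U := fun h => by
    have := hvU j h
    rw [hj] at this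
    exact zero_ne_one this
  -- The `m + 1` ones of `U` have odd parity, so `T_{m+2}` complements the whole set, leaving a
  -- single 1 at `j`: the weight drops by `m`. The new zeros on `U` also keep the result away from
  -- the all-ones string, so the step can be repeated.
  have hcard : (insert j U).card = m + 2 := by rw [Finset.card_insert_of_notMem hjU, hUk]
  let e := (Finset.equivFinOfCardEq hcard).symm
  let f : Fin (m + 2) ↪ Fin n := e.toEmbedding.trans (Function.Embedding.subtype _)
  have hsum : ∑ a, v (f a) = 1 := by
    have h1 : ∑ a, v (f a) = ∑ i : {i // i ∈ insert j U}, v i :=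
      Equiv.sum_comp e (fun i => v i)
    rw [h1, Finset.sum_coe_sort (insert j U) v, Finset.sum_insert hjU, hj, zero_add,
      Finset.sum_congr rfl hvU, Finset.sum_const, hUk, nsmul_one]
    have : Odd (m + 1) := by
      rcases hm with ⟨c, hc⟩
      exact ⟨c - 1, by omega⟩
    exact ZMod.natCast_eq_one_iff_odd.2 this
  have hin : ∀ i ∈ insert j U, placeGate f (tGate (m + 2) hm) v i = v i + 1 := by
    intro i hi
    obtain ⟨a, ha⟩ := e.surjective ⟨i, hi⟩
    have hfa : f a = i := congrArg Subtype.val ha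
    rw [← hfa, placeGate_apply_of_range, tGate_apply]
    simp only [Function.comp_apply, hsum]
  have hout : ∀ i, i ∉ insert j U → placeGate f (tGate (m + 2) hm) v i = v i := by
    intro i hi
    refine placeGate_apply_of_notMem _ _ _ ?_
    rintro ⟨a, rfl⟩
    exact hi (e a).2
  refine ⟨f, ?_, fun h => ?_⟩
  · set w := placeGate f (tGate (m + 2) hm) v
    have h1 : Finset.univ.filter (fun i => w i ≠ 0) =
        insert j (Finset.univ.filter (fun i => v i ≠ 0) \ U) := by
      ext i
      by_cases hi : i ∈ insert j U
      · rcases Finset.mem_insert.1 hi with rfl | hiU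
        · simp [hin _ hi, hj]
        · have hij : i ≠ j := fun h => hjU (h ▸ hiU)
          have h11 : (1 + 1 : ZMod 2) = 0 := rfl
          simp [hin _ hi, hvU i hiU, hiU, hij, h11]
      · have h2 := hout i hi
        rw [Finset.mem_insert, not_or] at hi
        simp [h2, hi.1, hi.2]
    have h2 : j ∉ Finset.univ.filter (fun i => v i ≠ 0) \ U := by simp [hj]
    rw [hammingNorm, hammingNorm, h1, Finset.card_insert_of_notMem h2,
      ← Finset.card_sdiff_add_card_eq_card hU, hUk]
    omega
  · obtain ⟨u, hu⟩ : U.Nonempty := Finset.card_pos.1 (by omega)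
    have h3 := hin u (Finset.mem_insert_of_mem hu)
    rw [h, hvU u hu] at h3
    have h4 : (1 : ZMod 2) = 1 + 1 := h3
    exact absurd h4 (by decide)

/-- Weight descends in steps of `m` until it is 1, and then a permutation of positions suffices. The
predicate `P` is left open to serve generation by `T_k`, membership in the orthogonal class, and
liftability to `F_4`. -/
lemma exists_map_lastVec {m : ℕ} (hm2 : 2 ≤ m) (hm : Even (m + 2)) {n : ℕ}
    {P : Gate (n + 1) → Prop} (mul : ∀ F G, P F → P G → P (F * G)) (perm : ∀ σ, P (bitPerm σ))
    (place : ∀ f, P (placeGate f (tGate (m + 2) hm))) {v : Bits (n + 1)}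
    (hv : v ∈ basisImages m n) : ∃ K, P K ∧ K v = lastVec n := by
  obtain ⟨h1, h2⟩ := hv
  induction hs : hammingNorm v using Nat.strong_induction_on generalizing v with
  | _ s ih =>
    by_cases hv1 : hammingNorm v = 1
    · obtain ⟨σ, hσ⟩ := exists_bitPerm_lastVec hv1
      exact ⟨_, perm σ, hσ⟩
    · have h4 : 1 ≤ hammingNorm v := by
        by_contra hc
        have h0 : hammingNorm v = 0 := by omega
        rw [h0, Nat.ModEq, Nat.mod_eq_of_lt (by omega : 0 < m), Nat.mod_eq_of_lt hm2] at h1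
        omega
      have h5 : m + 1 ≤ hammingNorm v := by
        have h6 := (Nat.modEq_iff_dvd' h4).1 h1.symm
        have := Nat.le_of_dvd (by omega) h6
        omega
      have h6 : v ≠ 1 := by
        refine h2.resolve_right fun hn => ?_
        subst hn
        have : hammingNorm v ≤ 1 := by simpa using hammingNorm_le_card_fintype (x := v)
        omega
      obtain ⟨f, hf, hf'⟩ := exists_placeGate_tGate hm v h5 h6
      obtain ⟨K, hK, hKv⟩ := ih _ (by omega) (v := placeGate f (tGate (m + 2) hm) v) (by
        rw [← hf] at h1
        simpa [Nat.ModEq] using h1) (Or.inl hf') rfl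
      exact ⟨K * placeGate f (tGate (m + 2) hm), mul _ _ hK (place f), hKv⟩

lemma generates_placeGate {k n : ℕ} {F : Gate k} (h : Generates S F) (f : Fin k ↪ Fin n) :
    Generates S (placeGate f F) :=
  genOn_fin.1 ((genOn_fin.2 h).placeGate f)

/-- The class of `T_k` when `T_k` preserves weights modulo `k - 2`. -/
lemma gateClass_tGate {m : ℕ} (hm2 : 2 ≤ m) (hm : Even (m + 2))
    (hT : ∀ x, hammingNorm (tGate (m + 2) hm x) ≡ hammingNorm x [MOD m]) (n : ℕ) :
    gateClass {⟨m + 2, tGate (m + 2) hm⟩} n = orthogonalClass m n := by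
  have hsub : ∀ n (G : Gate n), Generates {⟨m + 2, tGate (m + 2) hm⟩} G →
      G ∈ orthogonalClass m n := by
    intro n G h
    refine ⟨h.isOrthogonal ?_, h.hammingNorm_modEq_self ?_⟩
    · rintro F rfl
      exact isOrthogonal_tGate hm
    · rintro F rfl
      exact hT
  refine Set.Subset.antisymm (hsub n) fun G hG => ?_
  refine orthogonalClass_induction m (fun n G => Generates {⟨m + 2, tGate (m + 2) hm⟩} G)
    .ident (fun _ _ _ => .comp) (fun _ _ => .snocGate) (fun n v hv => ?_) hG
  obtain ⟨K, hK, hKv⟩ := exists_map_lastVec hm2 hm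
    (P := Generates {⟨m + 2, tGate (m + 2) hm⟩}) (fun _ _ => .comp) generates_bitPerm
    (generates_placeGate (.base (Set.mem_singleton _))) hv
  exact ⟨K, hsub _ K hK, hK, hKv⟩

lemma ncard_orthogonalClass_succ_of_tGate {m : ℕ} (hm2 : 2 ≤ m) (hm : Even (m + 2))
    (hT : ∀ x, hammingNorm (tGate (m + 2) hm x) ≡ hammingNorm x [MOD m]) (n : ℕ) :
    (orthogonalClass m (n + 1)).ncard = (basisImages m n).ncard * (orthogonalClass m n).ncard := by
  refine ncard_orthogonalClass_succ m n fun v hv => ?_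
  refine exists_map_lastVec hm2 hm (P := fun G => G ∈ orthogonalClass m (n + 1))
    (fun _ _ => mul_mem_orthogonalClass) bitPerm_mem_orthogonalClass (fun f => ?_) hv
  rw [← gateClass_tGate hm2 hm hT]
  exact generates_placeGate (.base (Set.mem_singleton _)) f

lemma hammingNorm_tGate_four (x : Bits 4) :
    hammingNorm (tGate (2 + 2) (by decide) x) ≡ hammingNorm x [MOD 2] := by
  revert x; decide

-- An odd weight `w` becomes `6 - w`, and `6 - 2w` is divisible by 4.
set_option maxRecDepth 10000 in
lemma hammingNorm_tGate_six (x : Bits 6) :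
    hammingNorm (tGate (4 + 2) (by decide) x) ≡ hammingNorm x [MOD 4] := by
  revert x; decide

lemma gateClass_T4 (n : ℕ) : gateClass {T4} n = orthogonalClass 2 n :=
  gateClass_tGate le_rfl (by decide) hammingNorm_tGate_four n

lemma gateClass_T6 (n : ℕ) : gateClass {T6} n = orthogonalClass 4 n :=
  gateClass_tGate (by norm_num) (by decide) hammingNorm_tGate_six n

/-! ### The trivial class -/

/-- Modulus 0 requires weight exactly 1, so the candidate images are the basis vectors and position
permutations reach them all. -/
lemma gateClass_empty (n : ℕ) : gateClass ∅ n = orthogonalClass 0 n := by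
  refine Set.Subset.antisymm (fun G h => ⟨h.isOrthogonal (by simp),
    h.hammingNorm_modEq_self (by simp)⟩) fun G hG => ?_
  refine orthogonalClass_induction 0 (fun n G => Generates ∅ G)
    .ident (fun _ _ _ => .comp) (fun _ _ => .snocGate) (fun n v hv => ?_) hG
  obtain ⟨σ, hσ⟩ := exists_bitPerm_lastVec (Nat.modEq_zero_iff.1 hv.1)
  exact ⟨_, bitPerm_mem_orthogonalClass σ, generates_bitPerm σ, hσ⟩

lemma ncard_basisImages_zero (n : ℕ) : (basisImages 0 n).ncard = n + 1 := by
  have h1 : basisImages 0 n =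
      (Finset.univ.filter (fun x : Bits (n + 1) => hammingNorm x = 1) : Finset _) := by
    ext v
    simp only [basisImages, Finset.coe_filter, Finset.mem_univ, true_and, Set.mem_ofPred_eq,
      Nat.modEq_zero_iff]
    refine and_iff_left_of_imp fun h => ?_
    by_contra! hc
    rw [hc.1] at h
    have : hammingNorm (1 : Bits (n + 1)) = n + 1 := by simp [hammingNorm]
    omega
  rw [h1, Set.ncard_coe_finset, card_hammingNorm_eq, Nat.choose_one_right]

lemma count_empty (n : ℕ) : count ∅ n = n ! := by
  rw [count, gateClass_empty]
  induction n with
  | zero => exact ncard_orthogonalClass_zero 0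
  | succ n ih =>
    rw [ncard_orthogonalClass_succ, ncard_basisImages_zero, ih, Nat.factorial_succ]
    intro v hv
    obtain ⟨σ, hσ⟩ := exists_bitPerm_lastVec (Nat.modEq_zero_iff.1 hv.1)
    exact ⟨_, bitPerm_mem_orthogonalClass σ, hσ⟩

/-! ### Counting the classes of `T_4` and `T_6` -/

lemma hammingNorm_one_bits (n : ℕ) : hammingNorm (1 : Bits n) = n := by
  simp [hammingNorm]

lemma ncard_basisImages_of_not_modEq {m n : ℕ} (h : n = 0 ∨ ¬ n + 1 ≡ 1 [MOD m]) :
    (basisImages m n).ncard =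
      (Finset.univ.filter (fun x : Bits (n + 1) => hammingNorm x ≡ 1 [MOD m])).card := by
  rw [← Set.ncard_coe_finset]
  congr 1
  ext v
  simp only [basisImages, Finset.coe_filter, Finset.mem_univ, true_and, Set.mem_ofPred_eq]
  refine and_iff_left_of_imp fun hv => ?_
  rcases h with h | h
  · exact Or.inr h
  · refine Or.inl ?_
    rintro rfl
    rw [hammingNorm_one_bits] at hv
    exact h hv

/-- Here the all-ones string has an admissible weight, so it has to be discarded from the count. -/
lemma ncard_basisImages_of_modEq {m n : ℕ} (hn : n ≠ 0) (h : n + 1 ≡ 1 [MOD m]) :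
    (basisImages m n).ncard + 1 =
      (Finset.univ.filter (fun x : Bits (n + 1) => hammingNorm x ≡ 1 [MOD m])).card := by
  have h1 : basisImages m n =
      ((Finset.univ.filter (fun x : Bits (n + 1) => hammingNorm x ≡ 1 [MOD m])).erase 1 :
        Finset _) := by
    ext v
    simp [basisImages, hn]
  rw [h1, Set.ncard_coe_finset, Finset.card_erase_add_one]
  simpa [hammingNorm_one_bits] using h

lemma card_hammingNorm_odd (n : ℕ) :
    (Finset.univ.filter (fun x : Bits (n + 1) => hammingNorm x ≡ 1 [MOD 2])).card = 2 ^ n := by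
  rw [← card_sum_eq n 1]
  congr 1
  ext x
  simp only [Finset.mem_filter, Finset.mem_univ, true_and]
  rw [← natCast_hammingNorm, ← ZMod.natCast_eq_natCast_iff, Nat.cast_one]

lemma ncard_orthogonalClass_two_succ (n : ℕ) : (orthogonalClass 2 (n + 1)).ncard =
    (basisImages 2 n).ncard * (orthogonalClass 2 n).ncard :=
  ncard_orthogonalClass_succ_of_tGate le_rfl (by decide) hammingNorm_tGate_four n

lemma ncard_orthogonalClass_two_odd (m : ℕ) : (orthogonalClass 2 (2 * m + 1)).ncard =
    2 ^ (m ^ 2) * ∏ i ∈ Finset.Icc 1 m, (2 ^ (2 * i) - 1) := by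
  induction m with
  | zero =>
    rw [mul_zero, ncard_orthogonalClass_two_succ, ncard_orthogonalClass_zero,
      ncard_basisImages_of_not_modEq (Or.inl rfl), card_hammingNorm_odd]
    simp
  | succ m ih =>
    have h1 : (basisImages 2 (2 * m + 1)).ncard = 2 ^ (2 * m + 1) := by
      rw [ncard_basisImages_of_not_modEq, card_hammingNorm_odd]
      right
      unfold Nat.ModEq
      omega
    have h2 : (basisImages 2 (2 * m + 2)).ncard = 2 ^ (2 * (m + 1)) - 1 := by
      refine Nat.eq_sub_of_add_eq ?_
      rw [ncard_basisImages_of_modEq (by omega), card_hammingNorm_odd]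
      · rfl
      · unfold Nat.ModEq
        omega
    have h3 : 2 * (m + 1) + 1 = 2 * m + 1 + 1 + 1 := by ring
    rw [h3, ncard_orthogonalClass_two_succ, h2, ncard_orthogonalClass_two_succ, h1, ih,
      Finset.prod_Icc_succ_top (by omega)]
    have h4 : (m + 1) ^ 2 = m ^ 2 + (2 * m + 1) := by ring
    rw [h4, pow_add]
    ring

lemma ncard_orthogonalClass_two_even (m : ℕ) : (orthogonalClass 2 (2 * m + 2)).ncard =
    2 ^ ((m + 1) ^ 2) * ∏ i ∈ Finset.Icc 1 m, (2 ^ (2 * i) - 1) := by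
  have h1 : (basisImages 2 (2 * m + 1)).ncard = 2 ^ (2 * m + 1) := by
    rw [ncard_basisImages_of_not_modEq, card_hammingNorm_odd]
    right
    unfold Nat.ModEq
    omega
  rw [ncard_orthogonalClass_two_succ, h1, ncard_orthogonalClass_two_odd]
  have h4 : (m + 1) ^ 2 = m ^ 2 + (2 * m + 1) := by ring
  rw [h4, pow_add]
  ring

/-- The number of strings of weight `i` modulo `4`. -/
def weightCount (n i : ℕ) : ℕ :=
  (Finset.univ.filter (fun x : Bits n => hammingNorm x ≡ i [MOD 4])).card

/-- Pascal's rule by the last bit; `i + 3` stands for `i - 1` modulo 4 and avoids subtraction. -/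
lemma weightCount_succ (n i : ℕ) :
    weightCount (n + 1) i = weightCount n i + weightCount n (i + 3) := by
  have hsplit : ∀ b : ZMod 2, ((Finset.univ.filter
      (fun x : Bits (n + 1) => hammingNorm x ≡ i [MOD 4])).filter
      (fun x => x (Fin.last n) = b)).card = (Finset.univ.filter
      (fun x : Bits n => hammingNorm x + b.val ≡ i [MOD 4])).card := by
    intro b
    refine Finset.card_nbij' Fin.init (fun x => Fin.snoc x b) ?_ ?_ ?_ ?_
    · intro x hx
      simp only [Finset.coe_filter, Finset.mem_filter, Finset.mem_univ, true_and,
        Set.mem_ofPred_eq] at hx ⊢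
      rw [← hx.2, ← hammingNorm_snoc, Fin.snoc_init_self]
      exact hx.1
    · intro x hx
      simp only [Finset.coe_filter, Finset.mem_filter, Finset.mem_univ, true_and,
        Set.mem_ofPred_eq] at hx ⊢
      rw [hammingNorm_snoc]
      exact ⟨hx, Fin.snoc_last _ _⟩
    · intro x hx
      simp only [Finset.coe_filter, Finset.mem_filter, Finset.mem_univ, true_and,
        Set.mem_ofPred_eq] at hx
      change (Fin.snoc (Fin.init x) b : Bits (n + 1)) = x
      rw [← hx.2, Fin.snoc_init_self]
    · intro x _
      exact Fin.init_snoc _ _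
  rw [weightCount, Finset.card_eq_sum_card_fiberwise (f := fun x : Bits (n + 1) => x (Fin.last n))
    (t := {0, 1}) (fun x _ => by simpa using zmod_two_cases (x (Fin.last n))),
    Finset.sum_pair (by decide), hsplit, hsplit, weightCount, weightCount]
  congr 2
  ext x
  have : (1 : ZMod 2).val = 1 := rfl
  simp only [Finset.mem_filter, Finset.mem_univ, true_and, this]
  unfold Nat.ModEq
  omega

lemma weightCount_congr (n : ℕ) {i j : ℕ} (h : i ≡ j [MOD 4]) :
    weightCount n i = weightCount n j := by
  unfold weightCount
  congr 1
  ext x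
  simp only [Finset.mem_filter, Finset.mem_univ, true_and]
  exact ⟨fun h' => h'.trans h, fun h' => h'.trans h.symm⟩

lemma weightCount_add (n : ℕ) :
    weightCount (n + 1) 1 = weightCount n 1 + weightCount n 0 ∧
    weightCount (n + 2) 1 = weightCount n 1 + 2 * weightCount n 0 + weightCount n 3 ∧
    weightCount (n + 3) 1 =
      weightCount n 1 + 3 * weightCount n 0 + 3 * weightCount n 3 + weightCount n 2 ∧
    weightCount (n + 4) 0 =
      2 * weightCount n 0 + 4 * weightCount n 3 + 6 * weightCount n 2 + 4 * weightCount n 1 ∧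
    weightCount (n + 4) 1 =
      2 * weightCount n 1 + 4 * weightCount n 0 + 6 * weightCount n 3 + 4 * weightCount n 2 ∧
    weightCount (n + 4) 2 =
      2 * weightCount n 2 + 4 * weightCount n 1 + 6 * weightCount n 0 + 4 * weightCount n 3 ∧
    weightCount (n + 4) 3 =
      2 * weightCount n 3 + 4 * weightCount n 2 + 6 * weightCount n 1 + 4 * weightCount n 0 := by
  have c0 : ∀ n, weightCount (n + 1) 0 = weightCount n 0 + weightCount n 3 :=
    fun n => weightCount_succ n 0
  have c1 : ∀ n, weightCount (n + 1) 1 = weightCount n 1 + weightCount n 0 :=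
    fun n => (weightCount_succ n 1).trans
      (congrArg _ (weightCount_congr n (by decide : 1 + 3 ≡ 0 [MOD 4])))
  have c2 : ∀ n, weightCount (n + 1) 2 = weightCount n 2 + weightCount n 1 :=
    fun n => (weightCount_succ n 2).trans
      (congrArg _ (weightCount_congr n (by decide : 2 + 3 ≡ 1 [MOD 4])))
  have c3 : ∀ n, weightCount (n + 1) 3 = weightCount n 3 + weightCount n 2 :=
    fun n => (weightCount_succ n 3).trans
      (congrArg _ (weightCount_congr n (by decide : 3 + 3 ≡ 2 [MOD 4])))
  refine ⟨c1 n, ?_, ?_, ?_, ?_, ?_, ?_⟩ <;>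
  · simp only [c0 (n + 3), c1 (n + 3), c2 (n + 3), c3 (n + 3), c0 (n + 2), c1 (n + 2), c2 (n + 2),
      c3 (n + 2), c0 (n + 1), c1 (n + 1), c2 (n + 1), c3 (n + 1), c0 n, c1 n, c2 n, c3 n]
    ring

/-- The roots-of-unity filter explains the form: `(1 + i)^(4m+2) = 2i(-4)^m` is purely imaginary,
hence corrections only in the odd residues. The proof uses the four-step recurrence, under which the
sign alternates. -/
lemma weightCount_aux (m : ℕ) :
    (weightCount (4 * m + 2) 0 : ℤ) = 2 ^ (4 * m) ∧
    (weightCount (4 * m + 2) 1 : ℤ) = 2 ^ (4 * m) + (-1) ^ m * 2 ^ (2 * m) ∧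
    (weightCount (4 * m + 2) 2 : ℤ) = 2 ^ (4 * m) ∧
    (weightCount (4 * m + 2) 3 : ℤ) = 2 ^ (4 * m) - (-1) ^ m * 2 ^ (2 * m) := by
  induction m with
  | zero => decide
  | succ m ih =>
    obtain ⟨h0, h1, h2, h3⟩ := ih
    obtain ⟨-, -, -, w0, w1, w2, w3⟩ := weightCount_add (4 * m + 2)
    have hs : 4 * (m + 1) + 2 = 4 * m + 2 + 4 := by ring
    have e1 : (2 : ℤ) ^ (4 * (m + 1)) = 16 * 2 ^ (4 * m) := by ring
    have e2 : (2 : ℤ) ^ (2 * (m + 1)) = 4 * 2 ^ (2 * m) := by ring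
    have e3 : (-1 : ℤ) ^ (m + 1) = - (-1) ^ m := by ring
    rw [hs, e1, e2, e3, w0, w1, w2, w3]
    push_cast
    rw [h0, h1, h2, h3]
    refine ⟨?_, ?_, ?_, ?_⟩ <;> ring

lemma ncard_orthogonalClass_four_succ (n : ℕ) : (orthogonalClass 4 (n + 1)).ncard =
    (basisImages 4 n).ncard * (orthogonalClass 4 n).ncard :=
  ncard_orthogonalClass_succ_of_tGate (by norm_num) (by decide) hammingNorm_tGate_six n

lemma ncard_orthogonalClass_four_one : (orthogonalClass 4 1).ncard = 1 := by
  rw [ncard_orthogonalClass_four_succ, ncard_orthogonalClass_zero,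
    ncard_basisImages_of_not_modEq (Or.inl rfl)]
  decide

lemma ncard_basisImages_four {n r : ℕ} (hr : n % 4 = r) (h : r ≠ 0) :
    (basisImages 4 n).ncard = weightCount (n + 1) 1 := by
  rw [ncard_basisImages_of_not_modEq]
  · rfl
  · right
    unfold Nat.ModEq
    omega

lemma ncard_orthogonalClass_four_step (m : ℕ) :
    ((orthogonalClass 4 (4 * m + 3)).ncard : ℤ) =
      2 ^ (2 * m) * (2 ^ (2 * m + 1) + (-1) ^ m) * (orthogonalClass 4 (4 * m + 2)).ncard ∧
    ((orthogonalClass 4 (4 * m + 4)).ncard : ℤ) =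
      2 ^ (4 * m + 2) * (orthogonalClass 4 (4 * m + 3)).ncard ∧
    ((orthogonalClass 4 (4 * m + 5)).ncard : ℤ) =
      (2 ^ (2 * m + 2) + (-1) ^ m) * (2 ^ (2 * m + 1) - (-1) ^ m) *
        (orthogonalClass 4 (4 * m + 4)).ncard ∧
    ((orthogonalClass 4 (4 * m + 6)).ncard : ℤ) =
      2 ^ (2 * m + 2) * (2 ^ (2 * m + 2) - (-1) ^ m) * (orthogonalClass 4 (4 * m + 5)).ncard := by
  obtain ⟨h0, h1, h2, h3⟩ := weightCount_aux m
  obtain ⟨v3, v4, v5, -, v6, -, -⟩ := weightCount_add (4 * m + 2)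
  have hsq : ((-1 : ℤ) ^ m) * (-1) ^ m = 1 := by rw [← mul_pow]; simp
  have e4 : (2 : ℤ) ^ (4 * m) = 2 ^ (2 * m) * 2 ^ (2 * m) := by rw [← pow_add]; congr 1; ring
  have b3 := ncard_basisImages_four (n := 4 * m + 2) (r := 2) (by omega) (by omega)
  have b4 := ncard_basisImages_four (n := 4 * m + 3) (r := 3) (by omega) (by omega)
  -- Of the four lengths only `4m + 5` is 1 modulo 4, so only here is the all-ones string
  -- subtracted.
  have b5 : (basisImages 4 (4 * m + 4)).ncard + 1 = weightCount (4 * m + 5) 1 :=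
    ncard_basisImages_of_modEq (by omega) (by unfold Nat.ModEq; omega)
  have b6 := ncard_basisImages_four (n := 4 * m + 5) (r := 1) (by omega) (by omega)
  have w3 : (weightCount (4 * m + 3) 1 : ℤ) = 2 ^ (2 * m) * (2 ^ (2 * m + 1) + (-1) ^ m) := by
    have h := congrArg (Nat.cast : ℕ → ℤ) v3
    push_cast at h
    rw [h0, h1] at h
    refine h.trans ?_
    rw [e4]; ring
  have w4 : (weightCount (4 * m + 4) 1 : ℤ) = 2 ^ (4 * m + 2) := by
    have h := congrArg (Nat.cast : ℕ → ℤ) v4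
    push_cast at h
    rw [h0, h1, h3] at h
    refine h.trans ?_
    ring
  have w5 : (weightCount (4 * m + 5) 1 : ℤ) =
      (2 ^ (2 * m + 2) + (-1) ^ m) * (2 ^ (2 * m + 1) - (-1) ^ m) + 1 := by
    have h := congrArg (Nat.cast : ℕ → ℤ) v5
    push_cast at h
    rw [h0, h1, h2, h3] at h
    refine h.trans ?_
    rw [e4, pow_add, pow_add]
    linear_combination (1 : ℤ) * hsq
  have w6 : (weightCount (4 * m + 6) 1 : ℤ) =
      2 ^ (2 * m + 2) * (2 ^ (2 * m + 2) - (-1) ^ m) := by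
    have h := congrArg (Nat.cast : ℕ → ℤ) v6
    push_cast at h
    rw [h0, h1, h2, h3] at h
    refine h.trans ?_
    rw [e4]; ring
  refine ⟨?_, ?_, ?_, ?_⟩
  · rw [ncard_orthogonalClass_four_succ (4 * m + 2), b3, Nat.cast_mul, w3]
  · rw [ncard_orthogonalClass_four_succ (4 * m + 3), b4, Nat.cast_mul, w4]
  · rw [ncard_orthogonalClass_four_succ (4 * m + 4), Nat.cast_mul]
    congr 1
    have := congrArg (Nat.cast : ℕ → ℤ) b5
    rw [w5] at this
    push_cast at this
    linarith
  · rw [ncard_orthogonalClass_four_succ (4 * m + 5), b6, Nat.cast_mul, w6]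

lemma orthogonalClass_four_formulas_aux {m : ℕ}
    (h2 : ((orthogonalClass 4 (4 * m + 2)).ncard : ℤ) =
      2 ^ (4 * m ^ 2 + 1) * ∏ i ∈ Finset.Icc 1 (2 * m), ((2 : ℤ) ^ (2 * i) - 1)) :
    ((orthogonalClass 4 (4 * m + 3)).ncard : ℤ) =
      2 ^ (4 * m ^ 2 + 2 * m + 1) * (2 ^ (2 * m + 1) + (-1) ^ m) *
        ∏ i ∈ Finset.Icc 1 (2 * m), ((2 : ℤ) ^ (2 * i) - 1) ∧
    ((orthogonalClass 4 (4 * m + 4)).ncard : ℤ) =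
      2 ^ (4 * m ^ 2 + 6 * m + 3) * (2 ^ (2 * m + 1) + (-1) ^ m) *
        ∏ i ∈ Finset.Icc 1 (2 * m), ((2 : ℤ) ^ (2 * i) - 1) ∧
    ((orthogonalClass 4 (4 * m + 5)).ncard : ℤ) =
      2 ^ (4 * m ^ 2 + 6 * m + 3) * (2 ^ (2 * m + 2) + (-1) ^ m) *
        ∏ i ∈ Finset.Icc 1 (2 * m + 1), ((2 : ℤ) ^ (2 * i) - 1) ∧
    ((orthogonalClass 4 (4 * (m + 1) + 2)).ncard : ℤ) =
      2 ^ (4 * (m + 1) ^ 2 + 1) * ∏ i ∈ Finset.Icc 1 (2 * (m + 1)), ((2 : ℤ) ^ (2 * i) - 1) := by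
  obtain ⟨s3, s4, s5, s6⟩ := ncard_orthogonalClass_four_step m
  have hsq : ((-1 : ℤ) ^ m) * (-1) ^ m = 1 := by rw [← mul_pow]; simp
  have h3 : ((orthogonalClass 4 (4 * m + 3)).ncard : ℤ) =
      2 ^ (4 * m ^ 2 + 2 * m + 1) * (2 ^ (2 * m + 1) + (-1) ^ m) *
        ∏ i ∈ Finset.Icc 1 (2 * m), ((2 : ℤ) ^ (2 * i) - 1) := by
    rw [s3, h2]; ring
  have h4 : ((orthogonalClass 4 (4 * m + 4)).ncard : ℤ) =
      2 ^ (4 * m ^ 2 + 6 * m + 3) * (2 ^ (2 * m + 1) + (-1) ^ m) *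
        ∏ i ∈ Finset.Icc 1 (2 * m), ((2 : ℤ) ^ (2 * i) - 1) := by
    rw [s4, h3]; ring
  -- The factors `2^(2i) - 1` of the product appear one half at a time at successive lengths; `f1`
  -- and `f2` join the halves.
  have f1 : (2 : ℤ) ^ (2 * (2 * m + 1)) - 1 =
      (2 ^ (2 * m + 1) + (-1) ^ m) * (2 ^ (2 * m + 1) - (-1) ^ m) := by
    rw [mul_comm 2, pow_mul]
    linear_combination (1 : ℤ) * hsq
  have f2 : (2 : ℤ) ^ (2 * (2 * m + 2)) - 1 =
      (2 ^ (2 * m + 2) + (-1) ^ m) * (2 ^ (2 * m + 2) - (-1) ^ m) := by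
    rw [mul_comm 2, pow_mul]
    linear_combination (1 : ℤ) * hsq
  have h5 : ((orthogonalClass 4 (4 * m + 5)).ncard : ℤ) =
      2 ^ (4 * m ^ 2 + 6 * m + 3) * (2 ^ (2 * m + 2) + (-1) ^ m) *
        ∏ i ∈ Finset.Icc 1 (2 * m + 1), ((2 : ℤ) ^ (2 * i) - 1) := by
    rw [s5, h4, Finset.prod_Icc_succ_top (by omega), f1]; ring
  refine ⟨h3, h4, h5, ?_⟩
  have e1 : 4 * (m + 1) + 2 = 4 * m + 6 := by ring
  have e2 : 2 * (m + 1) = 2 * m + 1 + 1 := by ring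
  have e3 : 4 * (m + 1) ^ 2 + 1 = 4 * m ^ 2 + 6 * m + 3 + (2 * m + 2) := by ring
  have hp : ∏ i ∈ Finset.Icc 1 (2 * m + 1 + 1), ((2 : ℤ) ^ (2 * i) - 1) =
      (∏ i ∈ Finset.Icc 1 (2 * m + 1), ((2 : ℤ) ^ (2 * i) - 1)) * (2 ^ (2 * (2 * m + 2)) - 1) :=
    Finset.prod_Icc_succ_top (by omega) _
  rw [e1, e2, e3, s6, h5, hp, f2,
    pow_add _ _ (2 * m + 2)]
  ring

lemma ncard_orthogonalClass_four (m : ℕ) :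
    ((orthogonalClass 4 (4 * m + 2)).ncard : ℤ) =
      2 ^ (4 * m ^ 2 + 1) * ∏ i ∈ Finset.Icc 1 (2 * m), ((2 : ℤ) ^ (2 * i) - 1) := by
  induction m with
  | zero =>
    have h : (basisImages 4 1).ncard = 2 := by
      rw [ncard_basisImages_four (n := 1) (r := 1) rfl (by omega)]
      decide
    rw [mul_zero, zero_add, ncard_orthogonalClass_four_succ, h, ncard_orthogonalClass_four_one]
    simp
  | succ m ih => exact (orthogonalClass_four_formulas_aux ih).2.2.2

lemma count_T4 (n : ℕ) (hn : 1 ≤ n) (m : ℕ) :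
    (n = 2 * m → count {T4} n = 2 ^ (m ^ 2) * ∏ i ∈ Finset.Icc 1 (m - 1), (2 ^ (2 * i) - 1)) ∧
    (n = 2 * m + 1 → count {T4} n = 2 ^ (m ^ 2) * ∏ i ∈ Finset.Icc 1 m, (2 ^ (2 * i) - 1)) := by
  rw [count, gateClass_T4]
  constructor
  · rintro rfl
    obtain ⟨m, rfl⟩ := Nat.exists_eq_add_of_le' (show 1 ≤ m by omega)
    exact ncard_orthogonalClass_two_even m
  · rintro rfl
    exact ncard_orthogonalClass_two_odd m

lemma count_T6 (n m : ℕ) :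
    (n = 4 * m + 2 → (count {T6} n : ℤ) =
      2 ^ (4 * m ^ 2 + 1) * ∏ i ∈ Finset.Icc 1 (2 * m), ((2 : ℤ) ^ (2 * i) - 1)) ∧
    (n = 4 * m + 3 → (count {T6} n : ℤ) =
      2 ^ (4 * m ^ 2 + 2 * m + 1) * (2 ^ (2 * m + 1) + (-1) ^ m) *
        ∏ i ∈ Finset.Icc 1 (2 * m), ((2 : ℤ) ^ (2 * i) - 1)) ∧
    (1 ≤ m → n = 4 * m → (count {T6} n : ℤ) =
      2 ^ (4 * m ^ 2 - 2 * m + 1) * (2 ^ (2 * m - 1) - (-1) ^ m) *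
        ∏ i ∈ Finset.Icc 1 (2 * m - 2), ((2 : ℤ) ^ (2 * i) - 1)) ∧
    (1 ≤ m → n = 4 * m + 1 → (count {T6} n : ℤ) =
      2 ^ (4 * m ^ 2 - 2 * m + 1) * (2 ^ (2 * m) - (-1) ^ m) *
        ∏ i ∈ Finset.Icc 1 (2 * m - 1), ((2 : ℤ) ^ (2 * i) - 1)) := by
  rw [count, gateClass_T6]
  have hexp : ∀ m : ℕ, 4 * (m + 1) ^ 2 - 2 * (m + 1) + 1 = 4 * m ^ 2 + 6 * m + 3 := by
    intro m
    have : 4 * (m + 1) ^ 2 = 4 * m ^ 2 + 6 * m + 2 + 2 * (m + 1) := by ring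
    omega
  refine ⟨?_, ?_, ?_, ?_⟩
  · rintro rfl
    exact ncard_orthogonalClass_four m
  · rintro rfl
    exact (orthogonalClass_four_formulas_aux (ncard_orthogonalClass_four m)).1
  · rintro hm rfl
    obtain ⟨m, rfl⟩ := Nat.exists_eq_add_of_le' hm
    have h := (orthogonalClass_four_formulas_aux (ncard_orthogonalClass_four m)).2.1
    -- Length `4m + 4` is `4(m + 1)`; the shift of `m` reverses the sign.
    rw [hexp, pow_succ (-1 : ℤ), mul_neg_one, sub_neg_eq_add]
    exact h
  · rintro hm rfl
    obtain ⟨m, rfl⟩ := Nat.exists_eq_add_of_le' hm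
    have h := (orthogonalClass_four_formulas_aux (ncard_orthogonalClass_four m)).2.2.1
    rw [hexp, pow_succ (-1 : ℤ), mul_neg_one, sub_neg_eq_add]
    exact h

/-! ### Linear parts -/

/-- Adding translations to the generators of a linear class does not change the linear parts. -/
lemma Generates.exists_linear_part (hS : IsLinearClass S)
    (h' : ∀ F ∈ S', ∃ b, Generates S (Equiv.addRight b * F.2)) {n : ℕ} {G : Gate n}
    (h : Generates S' G) : Generates S (Equiv.addRight (G 0) * G) := by
  have hadd : ∀ {n : ℕ} {G : Gate n}, Generates S G → ∀ x y, G (x + y) = G x + G y :=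
    fun h => isLinear_iff.1 (hS _ _ h)
  have hval : ∀ {n : ℕ} (b : Bits n) (G : Gate n) (x : Bits n),
      ((Equiv.addRight b * G : Gate n)) x = G x + b := fun _ _ _ => rfl
  induction h with
  | @base n G h =>
    obtain ⟨b, hb⟩ := h' _ h
    have h0 := map_zero_of_additive (hadd hb)
    have h1 : b = G 0 := by
      rw [hval] at h0
      rw [← vec_add_add_self b (G 0), add_comm b, h0, zero_add]
    rw [← h1]; exact hb
  | ident n =>
    convert Generates.ident (S := S) n
    ext; simp
  | @comp n F G _ _ h1 h2 =>
    convert h1.comp h2 using 1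
    refine Equiv.ext fun x => ?_
    have h3 := hadd h1 (G x) (G 0)
    simp only [hval, Perm.mul_apply] at h3 ⊢
    rw [add_add_add_comm, vec_add_self, add_zero] at h3
    exact h3.symm
  | @swapping n F G _ σ τ h h1 =>
    refine h1.swapping σ τ fun x => ?_
    rw [hval, h, h]
    rfl
  | @extension n F G _ h h1 =>
    refine h1.extension fun x b => ?_
    have h0 : (0 : Bits (n + 1)) = Fin.snoc 0 0 := by
      ext i
      induction i using Fin.lastCases <;> simp
    rw [hval, h0, h, h, snoc_add_snoc, add_zero, hval]
  | @ancilla n k F G a _ h h1 =>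
    -- The linear part sees differences of inputs: `(x, a)` minus `(0, a)` has zero ancillas, and so
    -- does the image.
    refine h1.ancilla 0 fun x => ?_
    have h2 := hadd h1 (Fin.append x a) (Fin.append 0 a)
    rw [append_add_append, vec_add_self, add_zero] at h2
    rw [h2, hval, hval, h, h, hval]
    rw [add_add_add_comm, vec_add_self, add_zero, append_add_append, vec_add_self]

/-- Every gate of `S'` is a translation by its value at 0 after its linear part; both are unique,
since linear gates fix 0. -/
lemma count_of_linear_part (hS : IsLinearClass S)
    (h' : ∀ F ∈ S', ∃ b, Generates S (Equiv.addRight b * F.2)) (hsub : S ⊆ S') {n : ℕ}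
    (B : Set (Bits n)) (hB : ∀ G : Gate n, Generates S' G → G 0 ∈ B)
    (hB' : ∀ b ∈ B, Generates S' (Equiv.addRight b)) :
    count S' n = count S n * B.ncard := by
  have himage : gateClass S' n =
      (fun p : Gate n × Bits n => Equiv.addRight p.2 * p.1) '' (gateClass S n ×ˢ B) := by
    ext G
    constructor
    · intro h
      refine ⟨(_, G 0), ⟨h.exists_linear_part hS h', hB G h⟩, ?_⟩
      refine Equiv.ext fun x => ?_
      exact vec_add_add_self _ _
    · rintro ⟨⟨G, b⟩, ⟨hG, hb⟩, rfl⟩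
      exact (hB' b hb).comp (Generates.mono hG fun F hF => .base (hsub hF))
  rw [count, count, himage, Set.InjOn.ncard_image, Set.ncard_prod]
  rintro ⟨F, b⟩ ⟨hF, -⟩ ⟨G, c⟩ ⟨hG, -⟩ h
  have h1 : ∀ x, F x + b = G x + c := fun x => DFunLike.congr_fun h x
  have hbc : b = c := by
    have := h1 0
    rwa [map_zero_of_additive (isLinear_iff.1 (hS _ _ hF)),
      map_zero_of_additive (isLinear_iff.1 (hS _ _ hG)), zero_add, zero_add] at this
  refine Prod.ext (Equiv.ext fun x => ?_) hbc
  have := h1 x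
  rw [hbc] at this
  exact add_right_cancel this

lemma count_union_not (hS : IsLinearClass S) (n : ℕ) :
    count (S ∪ {NOT}) n = count S n * 2 ^ n := by
  have hN : Generates (S ∪ {NOT}) notGate := .base (Or.inr rfl)
  rw [count_of_linear_part hS ?_ Set.subset_union_left Set.univ (fun _ _ => trivial)
    (fun b _ => genOn_fin.1 (genOn_translate (genOn_fin.2 hN) b)), Set.ncard_univ]
  · simp
  · rintro F (hF | rfl)
    · have h0 : (Equiv.addRight 0 * F.2 : Gate F.1) = F.2 := by ext; simp
      exact ⟨0, by rw [h0]; exact .base hF⟩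
    · have h1 : (Equiv.addRight 1 * NOT.2 : Gate 1) = 1 :=
        Equiv.ext fun x => vec_add_add_self x 1
      refine ⟨1, ?_⟩
      change Generates S (Equiv.addRight 1 * NOT.2 : Gate 1)
      rw [h1]
      exact .ident 1

/-! ### Linear classes are orthogonal -/

/-- In a linear class, a vanishing matrix entry of `G` vanishes in the transpose of the inverse:
otherwise a transvection obtained by conjugating a swap with `G` gives a nonlinear gate when one
bit is an ancilla. -/
lemma IsLinearClass.inv_apply_eq_zero (hS : IsLinearClass S) {n : ℕ} {G : Gate n}
    (hG : Generates S G) {i k : Fin n} (h : G (Pi.single i 1) k = 0) :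
    G⁻¹ (Pi.single k 1) i = 0 := by
  by_contra hne
  have h1 : G.symm (Pi.single k 1) i = 1 := (zmod_two_cases _).resolve_left hne
  have hadd := isLinear_iff.1 (hS _ _ hG)
  let ι := Fin n ⊕ Unit
  let F : Perm (ι → ZMod 2) := leftGate Unit G
  have hF : GenOn S F := (genOn_fin.2 hG).leftGate
  have hFadd : ∀ x y, F (x + y) = F x + F y := by
    intro x y
    funext o
    rcases o with j | u
    · exact congrFun (hadd (fun i => x (Sum.inl i)) (fun i => y (Sum.inl i))) j
    · rfl
  let s : Perm (ι → ZMod 2) := bitPerm (swap (Sum.inl i) (Sum.inr ()))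
  let u : ι → ZMod 2 := Pi.single (Sum.inl i) 1 + Pi.single (Sum.inr ()) 1
  -- Swapping bit `i` with the extra bit is a transvection along `u`, and `H` is its conjugate along
  -- `v = F u`.
  have hs : ∀ z, s z = z + (z (Sum.inl i) + z (Sum.inr ())) • u := by
    intro z
    have key : ∀ a b : ZMod 2, a = b + (b + a) := by decide
    have key' : ∀ a b : ZMod 2, b = a + (b + a) := by decide
    funext o
    simp only [s, bitPerm_apply, symm_swap]
    by_cases ho : o = Sum.inl i
    · subst ho
      simp [u, ← key]
    · by_cases ho' : o = Sum.inr ()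
      · subst ho'
        simp [u, ← key']
      · rw [swap_apply_of_ne_of_ne ho ho']
        simp [u, ho, ho']
  let H : Perm (ι → ZMod 2) := F * s * F⁻¹
  have hH : GenOn S H := (hF.mul (GenOn.bitPerm _)).mul hF.inv
  let v := F u
  have hHz : ∀ z, H z = z + (F.symm z (Sum.inl i) + F.symm z (Sum.inr ())) • v := by
    intro z
    have h2 : H z = F (s (F.symm z)) := rfl
    rw [h2, hs, hFadd, Equiv.apply_symm_apply]
    congr 1
    generalize F.symm z (Sum.inl i) + F.symm z (Sum.inr ()) = c
    rcases zmod_two_cases c with rfl | rfl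
    · rw [zero_smul, zero_smul, map_zero_of_additive hFadd]
    · rw [one_smul, one_smul]
  -- As `v` vanishes at `k`, the gate `H` never changes bit `k`, which may therefore be held at 1 as
  -- an ancilla.
  have hvk : v (Sum.inl k) = 0 := by
    change G (fun j => u (Sum.inl j)) k = 0
    have hu : (fun j => u (Sum.inl j)) = Pi.single i 1 := by
      funext j
      simp [u, Pi.single_apply]
    rw [hu, h]
  have hHk : ∀ z, H z (Sum.inl k) = z (Sum.inl k) := by
    intro z
    rw [hHz, Pi.add_apply, Pi.smul_apply, hvk, smul_zero, add_zero]
  let κ := {o : ι // o ≠ Sum.inl k}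
  let f : κ ↪ ι := Function.Embedding.subtype _
  have hrange : ∀ o, o ∉ Set.range f → o = Sum.inl k := by
    intro o ho
    by_contra hc
    exact ho ⟨⟨o, hc⟩, rfl⟩
  let e : (κ → ZMod 2) → ι → ZMod 2 := fun x o =>
    if ho : o ≠ Sum.inl k then x ⟨o, ho⟩ else 1
  have hek : ∀ x, e x (Sum.inl k) = 1 := fun x => dif_neg (by simp)
  have hef : ∀ x j, e x (f j) = x j := fun x j => dif_pos j.2
  have hinj : Function.Injective (fun (x : κ → ZMod 2) j => H (e x) (f j)) := by
    intro x y hxy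
    have h3 : H (e x) = H (e y) := by
      funext o
      by_cases ho : o ∈ Set.range f
      · obtain ⟨j, rfl⟩ := ho
        exact congrFun hxy j
      · rw [hrange o ho, hHk, hHk, hek, hek]
    have h4 := H.injective h3
    funext j
    rw [← hef x, ← hef y, h4]
  let G' : Perm (κ → ZMod 2) := Equiv.ofBijective _ (Finite.injective_iff_bijective.1 hinj)
  have hG' : GenOn S G' := by
    refine hH.ancilla f 1 fun z hz => ?_
    have hze : z = e fun j => z (f j) := by
      funext o
      by_cases ho : o ∈ Set.range f
      · obtain ⟨j, rfl⟩ := ho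
        exact (hef (fun j => z (f j)) j).symm
      · rw [hz o ho, hrange o ho]
        exact (hek fun j => z (f j)).symm
    refine ⟨fun j => ?_, fun o ho => ?_⟩
    · change H z (f j) = H (e fun j => z (f j)) (f j)
      rw [← hze]
    · have := hz o ho
      rw [hrange o ho] at this ⊢
      rw [hHk, this]
  obtain ⟨m, g, hg⟩ := hG'
  have h5 := congrFun (map_zero_of_additive (isLinear_iff.1 (hS _ _ hg)))
    (g ⟨Sum.inr (), by simp⟩)
  rw [reindexGate_apply, Equiv.symm_apply_apply] at h5
  -- Linearity of the restricted gate sends 0 to 0. But `e 0` is the basis vector at `k`, whose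
  -- preimage has entry 1 at `i` and 0 at the extra bit, so `H` adds `v` and turns the extra bit on.
  have h6 : H (e 0) (Sum.inr ()) = 0 := h5
  have he0 : e 0 = Pi.single (Sum.inl k) 1 := by
    funext o
    by_cases ho : o = Sum.inl k
    · subst ho
      rw [hek, Pi.single_eq_same]
    · rw [Pi.single_eq_of_ne ho]
      exact dif_pos ho
  have h7 : F.symm (Pi.single (Sum.inl k) 1) (Sum.inl i) = 1 := by
    change G.symm (fun j => (Pi.single (Sum.inl k) 1 : ι → ZMod 2) (Sum.inl j)) i = 1
    have hu : (fun j => (Pi.single (Sum.inl k) 1 : ι → ZMod 2) (Sum.inl j)) = Pi.single k 1 := by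
      funext j
      by_cases hj : j = k
      · rw [hj, Pi.single_eq_same, Pi.single_eq_same]
      · rw [Pi.single_eq_of_ne hj, Pi.single_eq_of_ne fun h => hj (Sum.inl_injective h)]
    rw [hu, h1]
  have h8 : F.symm (Pi.single (Sum.inl k) 1) (Sum.inr ()) = 0 := by
    change (Pi.single (Sum.inl k) 1 : ι → ZMod 2) (Sum.inr ()) = 0
    simp
  have h9 : v (Sum.inr ()) = 1 := by
    change u (Sum.inr ()) = 1
    simp [u]
  rw [he0, hHz, h7, h8] at h6
  simp [h9] at h6

/-- Applied to `G` and to its inverse, the preceding lemma gives the transpose and the inverse of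
the matrix the same zeros; over two elements the matrices are then equal. -/
lemma IsLinearClass.isOrthogonal (hS : IsLinearClass S) {n : ℕ} {G : Gate n}
    (hG : Generates S G) : IsOrthogonal G := by
  refine ⟨isLinear_iff.1 (hS _ _ hG), ?_⟩
  obtain ⟨A, -, hA⟩ := hS _ _ hG
  obtain ⟨B, -, hB⟩ := hS _ _ hG.inv
  have hAB : B = A.transpose := by
    ext i k
    have h1 : G (Pi.single i 1) k = A k i := by rw [hA]; simp
    have h2 : G⁻¹ (Pi.single k 1) i = B i k := by rw [hB]; simp
    have h3 : G (Pi.single i 1) k = 0 ↔ G⁻¹ (Pi.single k 1) i = 0 := by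
      refine ⟨hS.inv_apply_eq_zero hG, fun h => ?_⟩
      have := hS.inv_apply_eq_zero hG.inv h
      rwa [inv_inv] at this
    rw [Matrix.transpose_apply, ← h1, ← h2]
    revert h3
    generalize G (Pi.single i 1) k = a, G⁻¹ (Pi.single k 1) i = b
    revert a b
    decide
  intro x y
  have h1 : G⁻¹ (G x) = x := G.symm_apply_apply x
  rw [hB, hAB] at h1
  conv_rhs => rw [← h1]
  rw [hA y, Matrix.dotProduct_mulVec, Matrix.mulVec_transpose]

/-- Orthogonality makes the gates of `S` preserve parity. With NOTNOT added parity is still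
preserved, so exactly the even translations occur. -/
lemma count_union_notnot (hS : IsLinearClass S) {n : ℕ} (hn : 1 ≤ n) :
    count (S ∪ {NOTNOT}) n = count S n * 2 ^ (n - 1) := by
  have hN : Generates (S ∪ {NOTNOT}) notnotGate := .base (Or.inr rfl)
  rw [count_of_linear_part hS ?_ Set.subset_union_left {b | ∑ i, b i = 0} (fun G hG => ?_)
    (fun b hb => genOn_fin.1 (genOn_translate_of_sum_eq_zero (genOn_fin.2 hN) b hb))]
  · obtain ⟨n, rfl⟩ := Nat.exists_eq_add_of_le' hn
    congr 1
    rw [Nat.add_sub_cancel, ← card_sum_eq n 0, ← Set.ncard_coe_finset]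
    congr 1
    ext b
    simp
  · rintro F (hF | rfl)
    · have h0 : (Equiv.addRight 0 * F.2 : Gate F.1) = F.2 := by ext; simp
      exact ⟨0, by rw [h0]; exact .base hF⟩
    · have h1 : (Equiv.addRight 1 * NOTNOT.2 : Gate 2) = 1 :=
        Equiv.ext fun x => vec_add_add_self x 1
      refine ⟨1, ?_⟩
      change Generates S (Equiv.addRight 1 * NOTNOT.2 : Gate 2)
      rw [h1]
      exact .ident 2
  · have h1 := hG.hammingNorm_modEq_self (k := 2) (by
      rintro F (hF | rfl) x
      · have h2 := hS.isOrthogonal (Generates.base hF)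
        rw [hammingNorm_modEq_two_iff, ← dotProduct_self_eq_sum, ← dotProduct_self_eq_sum, h2.2]
      · exact hammingNorm_notnotGate x) 0
    rw [hammingNorm_modEq_two_iff] at h1
    simpa using h1

/-! ### The class of `F_4` -/

lemma isLinearClass_T4 : IsLinearClass {T4} := by
  intro m G hG
  rw [gateClass_T4] at hG
  exact isLinear_iff.2 hG.1.1

lemma fGate_four_eq : fGate 4 (by decide) = Equiv.addRight 1 * tGate 4 (by decide) := by
  refine Equiv.ext fun x => ?_
  funext i
  exact (add_assoc (x i) _ _).symm

lemma hammingNorm_fGate_four (x : Bits 4) :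
    hammingNorm (fGate 4 (by decide) x) ≡ hammingNorm x [MOD 4] := by
  revert x; decide

/-- Every gate in the class of `T_4` is the linear part of a gate in the class of `F_4`. -/
lemma exists_translate_generates_F4 {n : ℕ} {G : Gate n} (hG : Generates {T4} G) :
    ∃ b, Generates {F4} (Equiv.addRight b * G) := by
  have hG : G ∈ gateClass {T4} n := hG
  rw [gateClass_T4] at hG
  -- Membership in the orthogonal class is carried along because composing `F` with a translation by
  -- `c` produces a translation by `F c`, by additivity.
  let P : ∀ n, Gate n → Prop := fun n G =>
    G ∈ orthogonalClass 2 n ∧ ∃ b, Generates {F4} (Equiv.addRight b * G)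
  have hz : ∀ n, (Equiv.addRight 0 : Gate n) = 1 := fun n => by ext; simp
  have mul : ∀ n F G, P n F → P n G → P n (F * G) := by
    rintro n F G ⟨hF, b, hb⟩ ⟨hG, c, hc⟩
    refine ⟨mul_mem_orthogonalClass hF hG, F c + b, ?_⟩
    convert hb.comp hc using 1
    refine Equiv.ext fun x => ?_
    simp only [Perm.mul_apply, Equiv.coe_addRight, hF.1.1, add_assoc]
  have perm : ∀ n σ, P n (bitPerm σ) := by
    intro n σ
    refine ⟨bitPerm_mem_orthogonalClass σ, 0, ?_⟩
    rw [hz, one_mul]; exact generates_bitPerm σ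
  refine (orthogonalClass_induction 2 P ?_ mul ?_ ?_ hG).2
  · intro n
    refine ⟨one_mem_orthogonalClass, 0, ?_⟩
    rw [hz, one_mul]; exact .ident n
  · rintro n G ⟨hG, b, hb⟩
    refine ⟨snocGate_mem_orthogonalClass hG, Fin.snoc b 0, hb.extension fun x c => ?_⟩
    simp only [Perm.mul_apply, Equiv.coe_addRight, snocGate_snoc, snoc_add_snoc, add_zero]
  · intro n v hv
    have place : ∀ f, P (n + 1) (placeGate f (tGate (2 + 2) (by decide))) := by
      intro f
      refine ⟨?_, Function.extend f 1 0, ?_⟩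
      · rw [← gateClass_T4]
        exact generates_placeGate (.base (Set.mem_singleton _)) f
      · have hF : Generates {F4} (fGate 4 (by decide)) := .base (Set.mem_singleton _)
        convert generates_placeGate hF f using 1
        refine Equiv.ext fun x => funext fun j => ?_
        change placeGate f (tGate (2 + 2) (by decide)) x j + Function.extend f 1 0 j = _
        by_cases hj : j ∈ Set.range f
        · obtain ⟨a, rfl⟩ := hj
          rw [placeGate_apply_of_range, placeGate_apply_of_range, f.injective.extend_apply,
            fGate_four_eq]
          rfl
        · rw [placeGate_apply_of_notMem _ _ _ hj, placeGate_apply_of_notMem _ _ _ hj,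
            Function.extend_apply' _ _ _ hj, Pi.zero_apply, add_zero]
    obtain ⟨K, hK, hKv⟩ := exists_map_lastVec le_rfl _ (mul _) (perm _) place hv
    exact ⟨K, hK.1, hK, hKv⟩

/-- If `c i = 1`, then `y = 0` forces the weight of `c` to be 0 modulo 4, and the basis vector at
`i` forces it to be 2. -/
lemma eq_zero_of_hammingNorm_add {n : ℕ} {c : Bits n}
    (h : ∀ y, hammingNorm (y + c) ≡ hammingNorm y [MOD 4]) : c = 0 := by
  by_contra hc
  obtain ⟨i, hi⟩ : ∃ i, c i ≠ 0 := Function.ne_iff.1 hc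
  have hi : c i = 1 := (zmod_two_cases _).resolve_left hi
  have h0 := h 0
  have h1 := h (Pi.single i 1)
  have h2 : hammingNorm (Pi.single i 1 : Bits n) = 1 := by
    rw [hammingNorm_eq_sum, Finset.sum_eq_single i]
    · rw [Pi.single_eq_same]; rfl
    · intro j _ hj
      rw [Pi.single_eq_of_ne hj]; rfl
    · simp
  have h3 : hammingNorm (Pi.single i 1 + c) + 1 = hammingNorm c := by
    rw [hammingNorm_eq_sum, hammingNorm_eq_sum, ← Finset.add_sum_erase _ _ (Finset.mem_univ i),
      ← Finset.add_sum_erase _ (fun j => (c j).val) (Finset.mem_univ i), hi, Pi.add_apply, hi,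
      Pi.single_eq_same]
    have h4 : ∀ j ∈ Finset.univ.erase i, ((Pi.single i 1 + c : Bits n) j).val = (c j).val := by
      intro j hj
      rw [Pi.add_apply, Pi.single_eq_of_ne (Finset.ne_of_mem_erase hj), zero_add]
    rw [Finset.sum_congr rfl h4]
    have h5 : ((1 + 1 : ZMod 2)).val = 0 := rfl
    have h6 : ((1 : ZMod 2)).val = 1 := rfl
    rw [h5, h6]
    ring
  rw [zero_add, hammingNorm_zero] at h0
  rw [h2] at h1
  unfold Nat.ModEq at h0 h1
  omega

/-- Passing to the linear part is onto by `exists_translate_generates_F4`. It is injective because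
two gates with the same linear part differ by a translation preserving weights modulo 4, which must
be zero. -/
lemma count_F4 (n : ℕ) : count {F4} n = count {T4} n := by
  have hlin : ∀ G : Gate n, Generates {F4} G → Generates {T4} (Equiv.addRight (G 0) * G) := by
    intro G hG
    refine hG.exists_linear_part isLinearClass_T4 ?_
    rintro F rfl
    refine ⟨1, ?_⟩
    have h1 : (Equiv.addRight 1 * F4.2 : Gate 4) = tGate 4 (by decide) := by
      refine Equiv.ext fun x => ?_
      change fGate 4 (by decide) x + 1 = _
      rw [fGate_four_eq]
      exact vec_add_add_self _ _
    change Generates {T4} (Equiv.addRight 1 * F4.2 : Gate 4)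
    rw [h1]
    exact .base (Set.mem_singleton _)
  have hmod : ∀ G : Gate n, Generates {F4} G → ∀ x, hammingNorm (G x) ≡ hammingNorm x [MOD 4] := by
    intro G hG
    refine hG.hammingNorm_modEq_self ?_
    rintro F rfl
    exact hammingNorm_fGate_four
  have himage : gateClass {T4} n = (fun G : Gate n => Equiv.addRight (G 0) * G) ''
      gateClass {F4} n := by
    ext G
    constructor
    · intro hG
      obtain ⟨b, hb⟩ := exists_translate_generates_F4 hG
      refine ⟨_, hb, Equiv.ext fun x => ?_⟩
      have h0 : G 0 = 0 := map_zero_of_additive (isLinear_iff.1 (isLinearClass_T4 _ _ hG))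
      simp only [Perm.mul_apply, Equiv.coe_addRight, h0, zero_add]
      exact vec_add_add_self _ _
    · rintro ⟨G, hG, rfl⟩
      exact hlin G hG
  rw [count, count, himage, Set.InjOn.ncard_image]
  intro F hF G hG h
  have h1 : ∀ x, F x + F 0 = G x + G 0 := fun x => DFunLike.congr_fun h x
  have h2 : ∀ x, G x + (G 0 + F 0) = F x := by
    intro x
    rw [← add_assoc, ← h1, vec_add_add_self]
  have h3 : G 0 + F 0 = 0 := by
    refine eq_zero_of_hammingNorm_add fun y => ?_
    obtain ⟨x, rfl⟩ := G.surjective y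
    rw [h2]
    exact (hmod F hF x).trans (hmod G hG x).symm
  refine Equiv.ext fun x => ?_
  rw [← h2, h3, add_zero]

end RevGate

/-! ### The counting theorem assembled -/

theorem mainTheorem11 (n : ℕ) (hn : 1 ≤ n) :
    -- all gates, and the non-affine classes
    (Nat.card (RevGate.Gate n) = RevGate.count {RevGate.Toffoli} n ∧
      RevGate.count {RevGate.Toffoli} n = (2 ^ n)!) ∧
    RevGate.count {RevGate.Fredkin, RevGate.NOT} n = 2 * ((2 ^ (n - 1))!) ^ 2 ∧
    RevGate.count {RevGate.Fredkin, RevGate.NOTNOT} n = ((2 ^ (n - 1))!) ^ 2 ∧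
    (∀ k : ℕ, 3 ≤ k →
      RevGate.count {RevGate.C k} n =
        ∏ i ∈ Finset.range k,
          (∑ j ∈ (Finset.range (n + 1)).filter (fun j => j ≡ i [MOD k]), n.choose j)!) ∧
    RevGate.count {RevGate.Fredkin} n = ∏ i ∈ Finset.range (n + 1), (n.choose i)! ∧
    -- affine gates
    ({G : RevGate.Gate n | RevGate.IsAffine G}.ncard = RevGate.count {RevGate.CNOT} n ∧
      RevGate.count {RevGate.CNOT} n =
        2 ^ (n * (n + 1) / 2) * ∏ i ∈ Finset.Icc 1 n, (2 ^ i - 1)) ∧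
    -- parity-preserving and parity-respecting affine gates
    ({G : RevGate.Gate n | RevGate.IsAffine G ∧ RevGate.IsParityPreserving G}.ncard =
        RevGate.count {RevGate.CNOTNOT} n ∧
      RevGate.count {RevGate.CNOTNOT} n =
        2 ^ (n * (n + 1) / 2 - 1) * ∏ i ∈ Finset.Icc 1 (n - 1), (2 ^ i - 1)) ∧
    ({G : RevGate.Gate n | RevGate.IsAffine G ∧ RevGate.IsParityRespecting G}.ncard =
        RevGate.count {RevGate.CNOTNOT, RevGate.NOT} n ∧
      RevGate.count {RevGate.CNOTNOT, RevGate.NOT} n =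
        2 ^ (n * (n + 1) / 2) * ∏ i ∈ Finset.Icc 1 (n - 1), (2 ^ i - 1)) ∧
    -- the trivial class
    RevGate.count ∅ n = n ! ∧
    -- T₄
    (∀ m : ℕ,
      (n = 2 * m → RevGate.count {RevGate.T4} n =
        2 ^ (m ^ 2) * ∏ i ∈ Finset.Icc 1 (m - 1), (2 ^ (2 * i) - 1)) ∧
      (n = 2 * m + 1 → RevGate.count {RevGate.T4} n =
        2 ^ (m ^ 2) * ∏ i ∈ Finset.Icc 1 m, (2 ^ (2 * i) - 1))) ∧
    -- T₆, as an equation between integers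
    (n = 1 → RevGate.count {RevGate.T6} n = 1) ∧
    (∀ m : ℕ,
      (n = 4 * m + 2 → (RevGate.count {RevGate.T6} n : ℤ) =
        2 ^ (4 * m ^ 2 + 1) * ∏ i ∈ Finset.Icc 1 (2 * m), ((2 : ℤ) ^ (2 * i) - 1)) ∧
      (n = 4 * m + 3 → (RevGate.count {RevGate.T6} n : ℤ) =
        2 ^ (4 * m ^ 2 + 2 * m + 1) * (2 ^ (2 * m + 1) + (-1) ^ m) *
          ∏ i ∈ Finset.Icc 1 (2 * m), ((2 : ℤ) ^ (2 * i) - 1)) ∧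
      (1 ≤ m → n = 4 * m → (RevGate.count {RevGate.T6} n : ℤ) =
        2 ^ (4 * m ^ 2 - 2 * m + 1) * (2 ^ (2 * m - 1) - (-1) ^ m) *
          ∏ i ∈ Finset.Icc 1 (2 * m - 2), ((2 : ℤ) ^ (2 * i) - 1)) ∧
      (1 ≤ m → n = 4 * m + 1 → (RevGate.count {RevGate.T6} n : ℤ) =
        2 ^ (4 * m ^ 2 - 2 * m + 1) * (2 ^ (2 * m) - (-1) ^ m) *
          ∏ i ∈ Finset.Icc 1 (2 * m - 1), ((2 : ℤ) ^ (2 * i) - 1))) ∧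
    -- F₄
    RevGate.count {RevGate.F4} n = RevGate.count {RevGate.T4} n ∧
    -- adding NOT or NOTNOT to a linear class
    (∀ S : Set RevGate.AnyGate, RevGate.IsLinearClass S →
      RevGate.count (S ∪ {RevGate.NOT}) n = RevGate.count S n * 2 ^ n ∧
      RevGate.count (S ∪ {RevGate.NOTNOT}) n = RevGate.count S n * 2 ^ (n - 1)) := by
  have hall : Nat.card (RevGate.Gate n) = (2 ^ n)! := by
    rw [Nat.card_eq_fintype_card, Fintype.card_perm]
    simp
  refine ⟨⟨hall.trans (RevGate.count_toffoli n).symm, RevGate.count_toffoli n⟩,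
    RevGate.count_fredkin_not hn, RevGate.count_fredkin_notnot hn,
    fun k hk => RevGate.count_C hk n, RevGate.count_fredkin n,
    ⟨?_, ?_⟩, ⟨?_, RevGate.count_cnotnot hn⟩, ⟨?_, RevGate.count_cnotnot_not hn⟩,
    RevGate.count_empty n, RevGate.count_T4 n hn, ?_, RevGate.count_T6 n, RevGate.count_F4 n,
    fun S hS => ⟨RevGate.count_union_not hS n, RevGate.count_union_notnot hS hn⟩⟩
  · rw [RevGate.count, RevGate.gateClass_cnot]
  · rw [RevGate.count, RevGate.gateClass_cnot, RevGate.ncard_isAffine]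
  · rw [RevGate.count, RevGate.gateClass_cnotnot]
  · rw [RevGate.count, RevGate.gateClass_cnotnot_not]
  · rintro rfl
    rw [RevGate.count, RevGate.gateClass_T6, RevGate.ncard_orthogonalClass_four_one]
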